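/- Let $G\subset \mathrm{GL}_n(\mathbb R)$ be a closed subgroup with Lie algebra $\mathfrak g$. A \emph{$G$-structure with connection} $(P,\theta,\omega)$ is a manifold $P$ with a smooth, proper, locally free and effective right $G$-action, $\dim P=n+\dim G$, a pointwise surjective $\theta\in\Omega^1(P,\mathbb R^n)$ with $\theta(\tilde\alpha)=0$ and $g^*\theta=g^{-1}\theta$, and $\omega\in\Omega^1(P,\mathfrak g)$ with $\omega(\tilde\alpha)=\alpha$ and $g^*\omega=\mathrm{Ad}_{g^{-1}}\omega$ for all $g\in G$, $\alpha\in\mathfrak g$ with infinitesimal generator $\tilde\alpha$. A \emph{local equivalence} from $(P',\theta',\omega')$ to $(P,\theta,\omega)$ is a diffeomorphism $\Phi$ from an open subset of $P'$ onto an open subset of $P$ with $\Phi^*\theta=\theta'$ and $\Phi^*\omega=\omega'$; it is a \emph{$G$-equivariant} local equivalence if moreover these open subsets are $G$-saturated and $\Phi$ is $G$-equivariant. A smooth function $I:P\to\mathbb R$ is \emph{invariant} if $I\circ\Phi=I$ for every local equivalence $\Phi$ of $(P,\theta,\omega)$ with itself, and $(P,\theta,\omega)$ is \emph{fully regular} if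 the dimension of $\{d_pI: I \text{ invariant}\}\subset T_p^*P$ does not depend on $p$. Write $p\sim q$ if some local equivalence of $(P,\theta,\omega)$ with itself maps $p$ to $q$, let $h:P\to X=P/{\sim}$ be the quotient map, with the $G$-action $[p]g=[pg]$ and the (possibly non-Hausdorff) smooth structure for which $h$ is a submersion. The \emph{classifying algebroid} is the trivial bundle $A=X\times(\mathbb R^n\oplus\mathfrak g)$ with the Lie algebroid structure whose differential $d_A$ on sections of $\Lambda^\bullet A^*$ is characterized by $H^*d_A=dH^*$, where $H=(\theta,\omega):TP\to A$ covers $h$; it carries the $G$-action $(x,u,\alpha)g=(xg,g^{-1}u,\mathrm{Ad}_{g^{-1}}\alpha)$, the action morphism $(x,\alpha)\mapsto(x,0,\alpha)$, and the projections to $\mathbb R^n$ and $\mathfrak g$ as tautological and connection forms. A \emph{$G$-realization} of $A$ is a $G$-structure with connection $(P',\theta',\omega')$ together with a smooth bundle map $H':TP'\to A$ covering a smooth map $h':P'\to X$ which is a Lie algebroid morphism ($H'^*d_A=dH'^*$), is $G$-equivariant, intertwines the action morphisms ($H'(\tilde\alpha_{p'})=(h'(p'),0,\alpha)$), and pulls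 the tautological and connection forms of $A$ back to $\theta'$ and $\omega'$. \textbf{Proposition.} Let $(P,\theta,\omega)$ be a fully regular $G$-structure with connection and let $(P',H',h')$ be a $G$-realization of its classifying algebroid. Let $p_0'\in P'$ and $p_0\in P$ satisfy $h'(p_0')=h(p_0)$. Then there is a local equivalence $\Phi$ from $(P',\theta',\omega')$ to $(P,\theta,\omega)$, defined near $p_0'$, with $\Phi(p_0')=p_0$ and $h\circ\Phi=h'$. If moreover $p_0'$ and $p_0$ have the same stabilizer in $G$ (for instance, if $G$ acts freely on $P$ and on $P'$), then there is such a $\Phi$ which is a $G$-equivariant local equivalence. -/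

import Mathlib

open Set Filter Topology Manifold
open scoped ContDiff

noncomputable section

namespace GStr

/-- Euclidean space of dimension `n`. -/
abbrev Vec (n : ℕ) : Type := EuclideanSpace ℝ (Fin n)

/-- The general linear group of Euclidean `n`-space. -/
abbrev GLin (n : ℕ) : Type := (Vec n →L[ℝ] Vec n)ˣ

section Forms

variable {E : Type*} [NormedAddCommGroup E] [NormedSpace ℝ E]
  {P : Type*} [TopologicalSpace P] [ChartedSpace E P]
  {E' : Type*} [NormedAddCommGroup E'] [NormedSpace ℝ E']
  {P' : Type*} [TopologicalSpace P'] [ChartedSpace E' P']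
  {W : Type*} [NormedAddCommGroup W] [NormedSpace ℝ W]

variable (E P W) in
/-- `W`-valued 1-forms on the manifold `P` (not necessarily smooth). -/
abbrev OneForm : Type _ := (p : P) → TangentSpace 𝓘(ℝ, E) p →L[ℝ] W

variable (E P W) in
/-- `W`-valued `k`-forms on the manifold `P` (not necessarily smooth). -/
abbrev DForm (k : ℕ) : Type _ := (p : P) → TangentSpace 𝓘(ℝ, E) p [⋀^Fin k]→L[ℝ] W

/-- The differential at `x` of the inverse of the chart centred at `p₀`. -/
def chartInv (p₀ : P) (x : E) :
    E →L[ℝ] TangentSpace 𝓘(ℝ, E) ((extChartAt 𝓘(ℝ, E) p₀).symm x) :=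
  mfderiv 𝓘(ℝ, E) 𝓘(ℝ, E) (extChartAt 𝓘(ℝ, E) p₀).symm x

/-- The expression of a 1-form in the chart centred at `p₀`. -/
def OneForm.inChart (η : OneForm E P W) (p₀ : P) : E → E →L[ℝ] W := fun x =>
  (η ((extChartAt 𝓘(ℝ, E) p₀).symm x)).comp (chartInv p₀ x)

/-- A 1-form is smooth if its expressions in all charts are smooth. -/
def OneForm.Smooth (η : OneForm E P W) : Prop :=
  ∀ p₀ : P, ContDiffOn ℝ ∞ (η.inChart p₀) (extChartAt 𝓘(ℝ, E) p₀).target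

/-- The expression of a `k`-form in the chart centred at `p₀`. -/
def DForm.inChart {k : ℕ} (η : DForm E P W k) (p₀ : P) : E → E [⋀^Fin k]→L[ℝ] W := fun x =>
  (η ((extChartAt 𝓘(ℝ, E) p₀).symm x)).compContinuousLinearMap (chartInv p₀ x)

/-- The exterior derivative of a `k`-form, computed at `p` in the chart centred at `p`. -/
def DForm.d {k : ℕ} (η : DForm E P W k) : DForm E P W (k + 1) := fun p =>
  (extDeriv (η.inChart p) (extChartAt 𝓘(ℝ, E) p p)).compContinuousLinearMap
    (mfderiv 𝓘(ℝ, E) 𝓘(ℝ, E) (extChartAt 𝓘(ℝ, E) p) p)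

/-- The exterior derivative is natural under local diffeomorphisms. -/
theorem DForm.d_natural [IsManifold 𝓘(ℝ, E) ∞ P] [IsManifold 𝓘(ℝ, E') ∞ P'] {k : ℕ}
    (η : DForm E P W k) (η' : DForm E' P' W k) {Φ : OpenPartialHomeomorph P' P}
    (hΦ : ContMDiffOn 𝓘(ℝ, E') 𝓘(ℝ, E) ∞ Φ Φ.source)
    (h : ∀ r ∈ Φ.source,
      (η (Φ r)).compContinuousLinearMap (mfderiv 𝓘(ℝ, E') 𝓘(ℝ, E) Φ r) = η' r)
    {p : P'} (hp : p ∈ Φ.source)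
    (hη : DifferentiableAt ℝ (η.inChart (Φ p)) (extChartAt 𝓘(ℝ, E) (Φ p) (Φ p))) :
    (η.d (Φ p)).compContinuousLinearMap (mfderiv 𝓘(ℝ, E') 𝓘(ℝ, E) Φ p) = η'.d p := by
  set c' := extChartAt 𝓘(ℝ, E') p with hc'
  set c := extChartAt 𝓘(ℝ, E) (Φ p) with hc
  have hx0 : c'.symm (c' p) = p := extChartAt_to_inv p
  let F : E' → E := fun x => c (Φ (c'.symm x))
  -- smoothness at nearby points
  have hnear : ∀ᶠ x in 𝓝 (c' p), x ∈ c'.target ∧ c'.symm x ∈ Φ.source ∧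
      Φ (c'.symm x) ∈ c.source := by
    have t1 : c'.target ∈ 𝓝 (c' p) := extChartAt_target_mem_nhds p
    have t2 : ContinuousAt c'.symm (c' p) := continuousAt_extChartAt_symm p
    have t3 : Φ.source ∈ 𝓝 (c'.symm (c' p)) := by
      rw [hx0]; exact Φ.open_source.mem_nhds hp
    have t4 : ContinuousAt (fun x => Φ (c'.symm x)) (c' p) := by
      refine ContinuousAt.comp ?_ t2
      rw [hx0]; exact Φ.continuousAt hp
    have t5 : c.source ∈ 𝓝 (Φ (c'.symm (c' p))) := by
      rw [hx0]; exact extChartAt_source_mem_nhds (Φ p)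
    filter_upwards [t1, t2.preimage_mem_nhds t3, t4.preimage_mem_nhds t5] with x a b d
      using ⟨a, b, d⟩
  have d_c' : ∀ x ∈ c'.target, ContMDiffAt 𝓘(ℝ, E') 𝓘(ℝ, E') ∞ c'.symm x := fun x hx =>
    (contMDiffOn_extChartAt_symm p).contMDiffAt
      ((isOpen_extChartAt_target p).mem_nhds hx)
  have d_Φ : ∀ r ∈ Φ.source, ContMDiffAt 𝓘(ℝ, E') 𝓘(ℝ, E) ∞ Φ r := fun r hr =>
    hΦ.contMDiffAt (Φ.open_source.mem_nhds hr)
  have d_c : ∀ r ∈ c.source, ContMDiffAt 𝓘(ℝ, E) 𝓘(ℝ, E) ∞ c r := fun r hr =>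
    contMDiffAt_extChartAt' (by rwa [hc, extChartAt_source] at hr)
  have d_cs : ∀ x ∈ c.target, ContMDiffAt 𝓘(ℝ, E) 𝓘(ℝ, E) ∞ c.symm x := fun x hx =>
    (contMDiffOn_extChartAt_symm (Φ p)).contMDiffAt
      ((isOpen_extChartAt_target (Φ p)).mem_nhds hx)
  have d_F : ∀ x, x ∈ c'.target ∧ c'.symm x ∈ Φ.source ∧ Φ (c'.symm x) ∈ c.source →
      ContMDiffAt 𝓘(ℝ, E') 𝓘(ℝ, E) ∞ F x := fun x hx =>
    (d_c _ hx.2.2).comp x ((d_Φ _ hx.2.1).comp x (d_c' x hx.1))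
  -- the chart expressions correspond under `F`
  have hchart : η'.inChart p =ᶠ[𝓝 (c' p)]
      fun x => (η.inChart (Φ p) (F x)).compContinuousLinearMap (fderiv ℝ F x) := by
    filter_upwards [hnear, hnear.eventually_nhds] with x hx hx'
    have e1 : c.symm (F x) = Φ (c'.symm x) := c.left_inv hx.2.2
    have e2 : (fun y => c.symm (F y)) =ᶠ[𝓝 x] fun y => Φ (c'.symm y) := by
      filter_upwards [hx'] with y hy using c.left_inv hy.2.2
    have m1 : mfderiv 𝓘(ℝ, E') 𝓘(ℝ, E) (c.symm ∘ F) x = _ :=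
      mfderiv_comp x ((d_cs _ (c.map_source hx.2.2)).mdifferentiableAt (by simp))
        ((d_F x hx).mdifferentiableAt (by simp))
    have m2 : mfderiv 𝓘(ℝ, E') 𝓘(ℝ, E) (Φ ∘ c'.symm) x = _ :=
      mfderiv_comp x ((d_Φ _ hx.2.1).mdifferentiableAt (by simp))
        ((d_c' x hx.1).mdifferentiableAt (by simp))
    have m3 : mfderiv 𝓘(ℝ, E') 𝓘(ℝ, E) (c.symm ∘ F) x
      = mfderiv 𝓘(ℝ, E') 𝓘(ℝ, E) (Φ ∘ c'.symm) x := e2.mfderiv_eq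
    rw [m1, m2, mfderiv_eq_fderiv] at m3
    ext v
    have m4 : ∀ w : E', (mfderiv 𝓘(ℝ, E) 𝓘(ℝ, E) c.symm (F x) (fderiv ℝ F x w) : E)
        = mfderiv 𝓘(ℝ, E') 𝓘(ℝ, E) Φ (c'.symm x) (mfderiv 𝓘(ℝ, E') 𝓘(ℝ, E') c'.symm x w) :=
      fun w => DFunLike.congr_fun m3 w
    change η' (c'.symm x) (fun i => mfderiv 𝓘(ℝ, E') 𝓘(ℝ, E') c'.symm x (v i))
      = η (c.symm (F x)) (fun i => mfderiv 𝓘(ℝ, E) 𝓘(ℝ, E) c.symm (F x) (fderiv ℝ F x (v i)))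
    rw [← h _ hx.2.1, e1]
    exact congrArg (η (Φ (c'.symm x))) (funext fun i => (m4 (v i)).symm)
  have hF0 : F (c' p) = c (Φ p) := by simp only [F, hx0]
  have hnear0 := hnear.self_of_nhds
  have hdF : ContDiffAt ℝ ∞ F (c' p) := contMDiffAt_iff_contDiffAt.1 (d_F _ hnear0)
  have hd : extDeriv (η'.inChart p) (c' p)
      = (extDeriv (η.inChart (Φ p)) (c (Φ p))).compContinuousLinearMap (fderiv ℝ F (c' p)) := by
    rw [hchart.extDeriv_eq, extDeriv_pullback (r := ∞) (by rw [hF0]; exact hη) hdF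
      (by simpa using (ENat.LEInfty.out : (2 : ℕ∞ω) ≤ ∞)), hF0]
  -- the differential of `F` corresponds to that of `Φ`
  have n1 : mfderiv 𝓘(ℝ, E') 𝓘(ℝ, E) (F ∘ c') p = _ :=
    mfderiv_comp p ((d_F _ hnear0).mdifferentiableAt (by simp))
      ((contMDiffAt_extChartAt (n := ∞)).mdifferentiableAt (by simp))
  have n2 : mfderiv 𝓘(ℝ, E') 𝓘(ℝ, E) (c ∘ Φ) p = _ :=
    mfderiv_comp p ((contMDiffAt_extChartAt (n := ∞)).mdifferentiableAt (by simp))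
      ((d_Φ _ hp).mdifferentiableAt (by simp))
  have n3 : mfderiv 𝓘(ℝ, E') 𝓘(ℝ, E) (F ∘ c') p = mfderiv 𝓘(ℝ, E') 𝓘(ℝ, E) (c ∘ Φ) p := by
    apply Filter.EventuallyEq.mfderiv_eq
    filter_upwards [extChartAt_source_mem_nhds (I := 𝓘(ℝ, E')) p] with y hy
    change c (Φ (c'.symm (c' y))) = c (Φ y)
    rw [c'.left_inv hy]
  rw [n1, n2, mfderiv_eq_fderiv] at n3
  have n4 : ∀ w : TangentSpace 𝓘(ℝ, E') p,
      (fderiv ℝ F (c' p) (mfderiv 𝓘(ℝ, E') 𝓘(ℝ, E') c' p w) : E)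
      = mfderiv 𝓘(ℝ, E) 𝓘(ℝ, E) c (Φ p) (mfderiv 𝓘(ℝ, E') 𝓘(ℝ, E) Φ p w) :=
    fun w => DFunLike.congr_fun n3 w
  ext v
  change extDeriv (η.inChart (Φ p)) (c (Φ p))
      (fun i => mfderiv 𝓘(ℝ, E) 𝓘(ℝ, E) c (Φ p) (mfderiv 𝓘(ℝ, E') 𝓘(ℝ, E) Φ p (v i)))
    = extDeriv (η'.inChart p) (c' p) (fun i => mfderiv 𝓘(ℝ, E') 𝓘(ℝ, E') c' p (v i))
  rw [hd]
  exact congrArg (extDeriv (η.inChart (Φ p)) (c (Φ p))) (funext fun i => (n4 (v i)).symm)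

end Forms

section Group

variable {n : ℕ} (G : Subgroup (GLin n))
  {EG : Type*} [NormedAddCommGroup EG] [NormedSpace ℝ EG] [ChartedSpace EG G]

/-- The adjoint action of `g : G` on the Lie algebra `T₁G` of `G`. By definition of tangent spaces
in Mathlib, `T₁G` is the model space `EG`. -/
def Ad (g : G) : EG →L[ℝ] EG :=
  mfderiv 𝓘(ℝ, EG) 𝓘(ℝ, EG) (fun k : G => g * k * g⁻¹) 1

end Group

/-- A `G`-structure `(P, θ)` in the sense of a manifold with a proper, locally free and effective
right action of the closed group `G ⊆ GL(n, ℝ)`, with `dim P = n + dim G`, and a pointwise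
surjective tensorial 1-form `θ` with values in `ℝⁿ`. -/
structure GStructure {n : ℕ} (G : Subgroup (GLin n))
    (EG : Type*) [NormedAddCommGroup EG] [NormedSpace ℝ EG] [ChartedSpace EG G]
    (E : Type*) [NormedAddCommGroup E] [NormedSpace ℝ E]
    (P : Type*) [TopologicalSpace P] [ChartedSpace E P] where
  /-- the right action of `G` on `P` -/
  act : P → G → P
  act_one : ∀ p, act p 1 = p
  act_mul : ∀ p g k, act p (g * k) = act (act p g) k
  act_smooth : ContMDiff (𝓘(ℝ, E).prod 𝓘(ℝ, EG)) 𝓘(ℝ, E) ∞ (fun x : P × G => act x.1 x.2)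
  act_proper : IsProperMap (fun x : P × G => (x.1, act x.1 x.2))
  act_locallyFree : ∀ p, Function.Injective (mfderiv 𝓘(ℝ, EG) 𝓘(ℝ, E) (fun g : G => act p g) 1)
  act_effective : ∀ g, (∀ p, act p g = p) → g = 1
  dim_eq : Module.finrank ℝ E = n + Module.finrank ℝ EG
  /-- the tautological form -/
  taut : OneForm E P (Vec n)
  taut_smooth : taut.Smooth
  taut_surjective : ∀ p, Function.Surjective (taut p)
  taut_horizontal : ∀ p (α : EG),
    taut (act p 1) (mfderiv 𝓘(ℝ, EG) 𝓘(ℝ, E) (fun g : G => act p g) 1 α) = 0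
  taut_equivariant : ∀ p g (ξ : TangentSpace 𝓘(ℝ, E) p),
    taut (act p g) (mfderiv 𝓘(ℝ, E) 𝓘(ℝ, E) (fun q => act q g) p ξ) = (g⁻¹ : G).1.1 (taut p ξ)

/-- A `G`-structure with connection `(P, θ, ω)`. -/
structure GStructureConn {n : ℕ} (G : Subgroup (GLin n))
    (EG : Type*) [NormedAddCommGroup EG] [NormedSpace ℝ EG] [ChartedSpace EG G]
    (E : Type*) [NormedAddCommGroup E] [NormedSpace ℝ E]
    (P : Type*) [TopologicalSpace P] [ChartedSpace E P] extends GStructure G EG E P where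
  /-- the connection form -/
  conn : OneForm E P EG
  conn_smooth : conn.Smooth
  conn_vertical : ∀ p (α : EG),
    conn (act p 1) (mfderiv 𝓘(ℝ, EG) 𝓘(ℝ, E) (fun g : G => act p g) 1 α) = α
  conn_equivariant : ∀ p g (ξ : TangentSpace 𝓘(ℝ, E) p),
    conn (act p g) (mfderiv 𝓘(ℝ, E) 𝓘(ℝ, E) (fun q => act q g) p ξ) = Ad G g⁻¹ (conn p ξ)


section Main

variable {n : ℕ} {G : Subgroup (GLin n)}
  {EG : Type*} [NormedAddCommGroup EG] [NormedSpace ℝ EG] [ChartedSpace EG G]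
  {E : Type*} [NormedAddCommGroup E] [NormedSpace ℝ E]
  {P : Type*} [TopologicalSpace P] [ChartedSpace E P]
  {E' : Type*} [NormedAddCommGroup E'] [NormedSpace ℝ E']
  {P' : Type*} [TopologicalSpace P'] [ChartedSpace E' P']
  {E'' : Type*} [NormedAddCommGroup E''] [NormedSpace ℝ E'']
  {P'' : Type*} [TopologicalSpace P''] [ChartedSpace E'' P'']

/-- A local equivalence between two `G`-structures with connection: a diffeomorphism `Φ` between
open subsets with `Φ^*θ = θ'` and `Φ^*ω = ω'`. Since `ω` is inverse to the infinitesimal action,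
such a `Φ` intertwines the infinitesimal actions of the Lie algebra of `G`. -/
structure IsLocalEquivalence (S' : GStructureConn G EG E' P') (S : GStructureConn G EG E P)
    (Φ : OpenPartialHomeomorph P' P) : Prop where
  smooth : ContMDiffOn 𝓘(ℝ, E') 𝓘(ℝ, E) ∞ Φ Φ.source
  smooth_symm : ContMDiffOn 𝓘(ℝ, E) 𝓘(ℝ, E') ∞ Φ.symm Φ.target
  taut_eq : ∀ p ∈ Φ.source, ∀ ξ : TangentSpace 𝓘(ℝ, E') p,
    S.taut (Φ p) (mfderiv 𝓘(ℝ, E') 𝓘(ℝ, E) Φ p ξ) = S'.taut p ξ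
  conn_eq : ∀ p ∈ Φ.source, ∀ ξ : TangentSpace 𝓘(ℝ, E') p,
    S.conn (Φ p) (mfderiv 𝓘(ℝ, E') 𝓘(ℝ, E) Φ p ξ) = S'.conn p ξ

/-- A local equivalence which is moreover a `G`-equivariant diffeomorphism between `G`-saturated
open subsets. -/
structure IsEquivariantLocalEquivalence (S' : GStructureConn G EG E' P')
    (S : GStructureConn G EG E P) (Φ : OpenPartialHomeomorph P' P) : Prop
    extends IsLocalEquivalence S' S Φ where
  source_saturated : ∀ p ∈ Φ.source, ∀ g, S'.act p g ∈ Φ.source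
  target_saturated : ∀ p ∈ Φ.target, ∀ g, S.act p g ∈ Φ.target
  equivariant : ∀ p ∈ Φ.source, ∀ g, Φ (S'.act p g) = S.act (Φ p) g

namespace IsLocalEquivalence

theorem refl (S : GStructureConn G EG E P) :
    IsLocalEquivalence S S (OpenPartialHomeomorph.refl P) where
  smooth := contMDiff_id.contMDiffOn
  smooth_symm := contMDiff_id.contMDiffOn
  taut_eq p _ ξ := by
    have : mfderiv 𝓘(ℝ, E) 𝓘(ℝ, E) (OpenPartialHomeomorph.refl P) p = .id ℝ _ := mfderiv_id
    rw [this]; rfl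
  conn_eq p _ ξ := by
    have : mfderiv 𝓘(ℝ, E) 𝓘(ℝ, E) (OpenPartialHomeomorph.refl P) p = .id ℝ _ := mfderiv_id
    rw [this]; rfl

variable {S : GStructureConn G EG E P} {S' : GStructureConn G EG E' P'}
  {S'' : GStructureConn G EG E'' P''}

theorem mdifferentiableAt {Φ : OpenPartialHomeomorph P' P} (h : IsLocalEquivalence S' S Φ)
    {p : P'} (hp : p ∈ Φ.source) : MDifferentiableAt 𝓘(ℝ, E') 𝓘(ℝ, E) Φ p :=
  (h.smooth.contMDiffAt (Φ.open_source.mem_nhds hp)).mdifferentiableAt (by simp)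

theorem mdifferentiableAt_symm {Φ : OpenPartialHomeomorph P' P} (h : IsLocalEquivalence S' S Φ)
    {p : P} (hp : p ∈ Φ.target) : MDifferentiableAt 𝓘(ℝ, E) 𝓘(ℝ, E') Φ.symm p :=
  (h.smooth_symm.contMDiffAt (Φ.open_target.mem_nhds hp)).mdifferentiableAt (by simp)

theorem mfderiv_symm {Φ : OpenPartialHomeomorph P' P} (h : IsLocalEquivalence S' S Φ)
    {p : P} (hp : p ∈ Φ.target) (ξ : TangentSpace 𝓘(ℝ, E) p) :
    (mfderiv 𝓘(ℝ, E') 𝓘(ℝ, E) Φ (Φ.symm p) (mfderiv 𝓘(ℝ, E) 𝓘(ℝ, E') Φ.symm p ξ) : E) = ξ := by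
  have h1 := mfderiv_comp p (h.mdifferentiableAt (Φ.map_target hp)) (h.mdifferentiableAt_symm hp)
  have h2 : mfderiv 𝓘(ℝ, E) 𝓘(ℝ, E) (Φ ∘ Φ.symm) p = mfderiv 𝓘(ℝ, E) 𝓘(ℝ, E) id p :=
    Filter.EventuallyEq.mfderiv_eq (Φ.eventually_right_inverse hp)
  rw [h2, mfderiv_id] at h1
  exact (DFunLike.congr_fun h1 ξ).symm

theorem symm {Φ : OpenPartialHomeomorph P' P} (h : IsLocalEquivalence S' S Φ) :
    IsLocalEquivalence S S' Φ.symm where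
  smooth := h.smooth_symm
  smooth_symm := h.smooth
  taut_eq p hp ξ := by
    rw [← h.taut_eq _ (Φ.map_target hp)]
    have := h.mfderiv_symm hp ξ
    rw [Φ.right_inv hp]
    exact congrArg (S.taut p) this
  conn_eq p hp ξ := by
    rw [← h.conn_eq _ (Φ.map_target hp)]
    have := h.mfderiv_symm hp ξ
    rw [Φ.right_inv hp]
    exact congrArg (S.conn p) this

theorem trans {Φ : OpenPartialHomeomorph P'' P'} {Ψ : OpenPartialHomeomorph P' P}
    (h : IsLocalEquivalence S'' S' Φ) (k : IsLocalEquivalence S' S Ψ) :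
    IsLocalEquivalence S'' S (Φ.trans Ψ) where
  smooth := by
    rw [OpenPartialHomeomorph.trans_source]
    exact k.smooth.comp (h.smooth.mono inter_subset_left) inter_subset_right
  smooth_symm := by
    rw [OpenPartialHomeomorph.trans_target]
    exact h.smooth_symm.comp (k.smooth_symm.mono inter_subset_left) inter_subset_right
  taut_eq p hp ξ := by
    rw [OpenPartialHomeomorph.trans_source] at hp
    have h1 := mfderiv_comp p (k.mdifferentiableAt hp.2) (h.mdifferentiableAt hp.1)
    rw [OpenPartialHomeomorph.coe_trans, h1, ← h.taut_eq p hp.1, ← k.taut_eq _ hp.2]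
    rfl
  conn_eq p hp ξ := by
    rw [OpenPartialHomeomorph.trans_source] at hp
    have h1 := mfderiv_comp p (k.mdifferentiableAt hp.2) (h.mdifferentiableAt hp.1)
    rw [OpenPartialHomeomorph.coe_trans, h1, ← h.conn_eq p hp.1, ← k.conn_eq _ hp.2]
    rfl

end IsLocalEquivalence

namespace GStructureConn

variable (S : GStructureConn G EG E P)

theorem act_smooth_left (g : G) : ContMDiff 𝓘(ℝ, E) 𝓘(ℝ, E) ∞ (fun p => S.act p g) :=
  S.act_smooth.comp (contMDiff_id.prodMk contMDiff_const)

theorem act_inv_act (p : P) (g : G) : S.act (S.act p g⁻¹) g = p := by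
  rw [← S.act_mul, inv_mul_cancel, S.act_one]

theorem act_act_inv (p : P) (g : G) : S.act (S.act p g) g⁻¹ = p := by
  rw [← S.act_mul, mul_inv_cancel, S.act_one]

/-- Translation by a group element. -/
def transl (g : G) : OpenPartialHomeomorph P P :=
  Homeomorph.toOpenPartialHomeomorph
    { toFun := fun p => S.act p g
      invFun := fun p => S.act p g⁻¹
      left_inv := fun p => S.act_act_inv p g
      right_inv := fun p => S.act_inv_act p g
      continuous_toFun := (S.act_smooth_left g).continuous
      continuous_invFun := (S.act_smooth_left g⁻¹).continuous }

theorem mfderiv_act_inv (g : G) (p : P) (ξ : TangentSpace 𝓘(ℝ, E) p) :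
    (mfderiv 𝓘(ℝ, E) 𝓘(ℝ, E) (fun q => S.act q g) (S.act p g⁻¹)
      (mfderiv 𝓘(ℝ, E) 𝓘(ℝ, E) (fun q => S.act q g⁻¹) p ξ) : E) = ξ := by
  have h1 := mfderiv_comp p
    (((S.act_smooth_left g).mdifferentiable (by simp)) (S.act p g⁻¹))
    (((S.act_smooth_left g⁻¹).mdifferentiable (by simp)) p)
  have h2 : ((fun q => S.act q g) ∘ fun q => S.act q g⁻¹) = id := by
    funext q; exact S.act_inv_act q g
  rw [h2, mfderiv_id] at h1
  exact (DFunLike.congr_fun h1 ξ).symm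

/-- If `Φ` is a local self-equivalence, so is its conjugate by a translation. -/
theorem conj_isLocalEquivalence {Φ : OpenPartialHomeomorph P P} (h : IsLocalEquivalence S S Φ)
    (g : G) :
    IsLocalEquivalence S S ((S.transl g).symm.trans (Φ.trans (S.transl g))) where
  smooth := by
    have h1 : ContMDiff 𝓘(ℝ, E) 𝓘(ℝ, E) ∞ (S.transl g) := S.act_smooth_left g
    have h2 : ContMDiff 𝓘(ℝ, E) 𝓘(ℝ, E) ∞ (S.transl g).symm := S.act_smooth_left g⁻¹
    refine h1.comp_contMDiffOn (h.smooth.comp h2.contMDiffOn ?_)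
    intro q hq
    simp only [mfld_simps] at hq
    exact hq.2.1
  smooth_symm := by
    have h1 : ContMDiff 𝓘(ℝ, E) 𝓘(ℝ, E) ∞ (S.transl g) := S.act_smooth_left g
    have h2 : ContMDiff 𝓘(ℝ, E) 𝓘(ℝ, E) ∞ (S.transl g).symm := S.act_smooth_left g⁻¹
    refine h1.comp_contMDiffOn (h.smooth_symm.comp h2.contMDiffOn ?_)
    intro q hq
    simp only [mfld_simps] at hq
    exact hq.1.2
  taut_eq q hq ξ := by
    simp only [mfld_simps] at hq
    have hq' : S.act q g⁻¹ ∈ Φ.source := hq.2.1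
    have d1 := ((S.act_smooth_left g).mdifferentiable (by simp)) (Φ (S.act q g⁻¹))
    have d2 := h.mdifferentiableAt hq'
    have d3 := ((S.act_smooth_left g⁻¹).mdifferentiable (by simp)) q
    have d4 : MDifferentiableAt 𝓘(ℝ, E) 𝓘(ℝ, E) (Φ ∘ fun q => S.act q g⁻¹) q := d2.comp q d3
    have h1 := mfderiv_comp q d1 d4
    rw [mfderiv_comp q d2 d3] at h1
    have e1 := S.taut_equivariant (Φ (S.act q g⁻¹)) g
      (mfderiv 𝓘(ℝ, E) 𝓘(ℝ, E) Φ (S.act q g⁻¹)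
        (mfderiv 𝓘(ℝ, E) 𝓘(ℝ, E) (fun q => S.act q g⁻¹) q ξ))
    rw [h.taut_eq _ hq', ← S.taut_equivariant (S.act q g⁻¹) g] at e1
    refine (congrArg (S.taut (S.act (Φ (S.act q g⁻¹)) g)) (DFunLike.congr_fun h1 ξ)).trans
      (e1.trans ?_)
    have := S.mfderiv_act_inv g q ξ
    rw [S.act_inv_act]
    exact congrArg (S.taut q) this
  conn_eq q hq ξ := by
    simp only [mfld_simps] at hq
    have hq' : S.act q g⁻¹ ∈ Φ.source := hq.2.1
    have d1 := ((S.act_smooth_left g).mdifferentiable (by simp)) (Φ (S.act q g⁻¹))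
    have d2 := h.mdifferentiableAt hq'
    have d3 := ((S.act_smooth_left g⁻¹).mdifferentiable (by simp)) q
    have d4 : MDifferentiableAt 𝓘(ℝ, E) 𝓘(ℝ, E) (Φ ∘ fun q => S.act q g⁻¹) q := d2.comp q d3
    have h1 := mfderiv_comp q d1 d4
    rw [mfderiv_comp q d2 d3] at h1
    have e1 := S.conn_equivariant (Φ (S.act q g⁻¹)) g
      (mfderiv 𝓘(ℝ, E) 𝓘(ℝ, E) Φ (S.act q g⁻¹)
        (mfderiv 𝓘(ℝ, E) 𝓘(ℝ, E) (fun q => S.act q g⁻¹) q ξ))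
    rw [h.conn_eq _ hq', ← S.conn_equivariant (S.act q g⁻¹) g] at e1
    refine (congrArg (S.conn (S.act (Φ (S.act q g⁻¹)) g)) (DFunLike.congr_fun h1 ξ)).trans
      (e1.trans ?_)
    have := S.mfderiv_act_inv g q ξ
    rw [S.act_inv_act]
    exact congrArg (S.conn q) this

/-- Two points `p`, `q` of `P` are locally equivalent if some local self-equivalence maps `p` to
`q`. -/
def LocallyEquivalent (p q : P) : Prop :=
  ∃ Φ : OpenPartialHomeomorph P P, IsLocalEquivalence S S Φ ∧ p ∈ Φ.source ∧ Φ p = q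

/-- Local equivalence of points, as an equivalence relation on `P`. -/
def locEquivSetoid : Setoid P where
  r := S.LocallyEquivalent
  iseqv :=
    { refl := fun p => ⟨_, .refl S, mem_univ p, rfl⟩
      symm := by
        rintro p q ⟨Φ, hΦ, hp, rfl⟩
        exact ⟨Φ.symm, hΦ.symm, Φ.map_source hp, Φ.left_inv hp⟩
      trans := by
        rintro p q r ⟨Φ, hΦ, hp, rfl⟩ ⟨Ψ, hΨ, hq, rfl⟩
        exact ⟨Φ.trans Ψ, hΦ.trans hΨ, by simp [hp, hq], rfl⟩ }

theorem LocallyEquivalent.act {p q : P} (h : S.LocallyEquivalent p q) (g : G) :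
    S.LocallyEquivalent (S.act p g) (S.act q g) := by
  obtain ⟨Φ, hΦ, hp, rfl⟩ := h
  refine ⟨_, S.conj_isLocalEquivalence hΦ g, ?_, ?_⟩
  · simp only [mfld_simps]
    refine ⟨mem_univ _, ?_, mem_univ _⟩
    change S.act (S.act p g) g⁻¹ ∈ Φ.source
    rwa [S.act_act_inv]
  · change S.act (Φ (S.act (S.act p g) g⁻¹)) g = _
    rw [S.act_act_inv]

/-- `I` is an invariant function: it is smooth and preserved by all local self-equivalences. -/
def IsInvariantFunction (I : P → ℝ) : Prop :=
  ContMDiff 𝓘(ℝ, E) 𝓘(ℝ, ℝ) ∞ I ∧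
    ∀ Φ : OpenPartialHomeomorph P P, IsLocalEquivalence S S Φ → ∀ p ∈ Φ.source, I (Φ p) = I p

/-- The space of differentials at `p` of invariant functions. -/
def invariantDifferentials (p : P) : Submodule ℝ (TangentSpace 𝓘(ℝ, E) p →L[ℝ] ℝ) :=
  Submodule.span ℝ {a | ∃ I : P → ℝ, S.IsInvariantFunction I ∧ a = mfderiv 𝓘(ℝ, E) 𝓘(ℝ, ℝ) I p}

/-- `(P, θ, ω)` is fully regular (of rank `d`) if the dimension of the space of differentials of
invariant functions does not depend on the point (and is equal to `d`). -/
def FullyRegular : Prop :=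
  ∃ d : ℕ, ∀ p, Module.finrank ℝ (S.invariantDifferentials p) = d

/-- The classifying space `X = P/∼`, the quotient of `P` by local equivalence. -/
def ClassifyingSpace : Type _ := Quotient S.locEquivSetoid

instance : TopologicalSpace S.ClassifyingSpace :=
  inferInstanceAs (TopologicalSpace (Quotient S.locEquivSetoid))

/-- The classifying map `h : P → X`. -/
def classMap (p : P) : S.ClassifyingSpace := Quotient.mk S.locEquivSetoid p

/-- The action of `G` on the classifying space, `[p] g = [p g]`. -/
def actX (x : S.ClassifyingSpace) (g : G) : S.ClassifyingSpace :=
  Quotient.map (sa := S.locEquivSetoid) (sb := S.locEquivSetoid) (fun p => S.act p g)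
    (fun _ _ h => LocallyEquivalent.act S (p := _) (q := _) h g) x

/-- A function on an open subset `U` of the classifying space `X` is smooth if its pullback to `P`
by the classifying map is smooth. This is the sheaf of smooth functions of the manifold structure
on `X` for which the classifying map is a submersion. -/
def SmoothFunOn (U : Set S.ClassifyingSpace) (f : S.ClassifyingSpace → ℝ) : Prop :=
  ContMDiffOn 𝓘(ℝ, E) 𝓘(ℝ, ℝ) ∞ (f ∘ S.classMap) (S.classMap ⁻¹' U)

/-- A map from a manifold to the classifying space is smooth if it is continuous and pulls back
locally defined smooth functions to smooth functions. -/
def SmoothInto (φ : P' → S.ClassifyingSpace) : Prop :=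
  Continuous φ ∧ ∀ (U : Set S.ClassifyingSpace) (f : S.ClassifyingSpace → ℝ), IsOpen U →
    S.SmoothFunOn U f → ContMDiffOn 𝓘(ℝ, E') 𝓘(ℝ, ℝ) ∞ (f ∘ φ) (φ ⁻¹' U)

/-- The coframe `(θ, ω)`. -/
def coframe : OneForm E P (Vec n × EG) := fun p => (S.taut p).prod (S.conn p)

/-- The inverse of the coframe `(θ, ω)` at a point. -/
def coframeInv (p : P) : Vec n × EG →L[ℝ] TangentSpace 𝓘(ℝ, E) p := (S.coframe p).inverse

theorem isInvertible_coframe [FiniteDimensional ℝ E] [FiniteDimensional ℝ EG] (p : P) :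
    (S.coframe p).IsInvertible := by
  suffices H : (S.coframe (S.act p 1)).IsInvertible by rwa [S.act_one] at H
  let f : E →L[ℝ] Vec n × EG := S.coframe (S.act p 1)
  have hsurj : Function.Surjective f := by
    rintro ⟨u, α⟩
    obtain ⟨ξ, hξ⟩ := S.taut_surjective (S.act p 1) u
    let v : TangentSpace 𝓘(ℝ, E) (S.act p 1) :=
      mfderiv 𝓘(ℝ, EG) 𝓘(ℝ, E) (fun g : G => S.act p g) 1 (α - S.conn _ ξ)
    refine ⟨ξ + v, ?_⟩
    have h1 : S.taut (S.act p 1) (ξ + v) = u := by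
      rw [map_add, hξ, S.taut_horizontal p, add_zero]
    have h2 : S.conn (S.act p 1) (ξ + v) = α := by
      rw [map_add, S.conn_vertical p, add_sub_cancel]
    exact Prod.ext h1 h2
  have hdim : Module.finrank ℝ E = Module.finrank ℝ (Vec n × EG) := by
    rw [Module.finrank_prod, finrank_euclideanSpace_fin, S.dim_eq]
  have hinj : Function.Injective f :=
    (LinearMap.injective_iff_surjective_of_finrank_eq_finrank (f := f.toLinearMap) hdim).2 hsurj
  exact ⟨(LinearEquiv.ofBijective f.toLinearMap ⟨hinj, hsurj⟩).toContinuousLinearEquiv, rfl⟩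

/-- `A`-forms of degree `k` on the trivial vector bundle `A = X × (ℝⁿ ⊕ 𝔤)`, that is, smooth
sections of `Λᵏ A^*`. -/
structure AForm (k : ℕ) where
  toFun : S.ClassifyingSpace → (Vec n × EG) [⋀^Fin k]→L[ℝ] ℝ
  smooth : ContMDiff 𝓘(ℝ, E) 𝓘(ℝ, (Vec n × EG) [⋀^Fin k]→L[ℝ] ℝ) ∞ (toFun ∘ S.classMap)

/-- The pullback of a (not necessarily smooth) section `Ω` of `Λᵏ A^*` by a bundle map `(H, φ)`
from the tangent bundle of a manifold to `A = X × (ℝⁿ ⊕ 𝔤)`. -/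
def pullback (φ : P' → S.ClassifyingSpace) (H : OneForm E' P' (Vec n × EG)) {k : ℕ}
    (Ω : S.ClassifyingSpace → (Vec n × EG) [⋀^Fin k]→L[ℝ] ℝ) : DForm E' P' ℝ k := fun p =>
  (Ω (φ p)).compContinuousLinearMap (H p)

/-- The `(k+1)`-form `d (H^* Ω)` at `p`, transported to `ℝⁿ ⊕ 𝔤` by the coframe `H = (θ, ω)`. -/
def dAAt {k : ℕ} (Ω : S.AForm k) (p : P) : (Vec n × EG) [⋀^Fin (k + 1)]→L[ℝ] ℝ :=
  ((S.pullback S.classMap S.coframe Ω.toFun).d p).compContinuousLinearMap (S.coframeInv p)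

theorem differentiableAt_inChart_pullback [IsManifold 𝓘(ℝ, E) ∞ P] {k : ℕ} (Ω : S.AForm k)
    (p : P) :
    DifferentiableAt ℝ ((S.pullback S.classMap S.coframe Ω.toFun).inChart p)
      (extChartAt 𝓘(ℝ, E) p p) := by
  have ht : (extChartAt 𝓘(ℝ, E) p).target ∈ 𝓝 (extChartAt 𝓘(ℝ, E) p p) :=
    extChartAt_target_mem_nhds p
  have h1 : DifferentiableAt ℝ (S.coframe.inChart p) (extChartAt 𝓘(ℝ, E) p p) := by
    have t1 : DifferentiableAt ℝ (S.taut.inChart p) (extChartAt 𝓘(ℝ, E) p p) :=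
      ((S.taut_smooth p).contDiffAt ht).differentiableAt (by simp)
    have t2 : DifferentiableAt ℝ (S.conn.inChart p) (extChartAt 𝓘(ℝ, E) p p) :=
      ((S.conn_smooth p).contDiffAt ht).differentiableAt (by simp)
    have t3 := ((differentiableAt_const (ContinuousLinearMap.inl ℝ (Vec n) EG)).clm_comp t1).add
      ((differentiableAt_const (ContinuousLinearMap.inr ℝ (Vec n) EG)).clm_comp t2)
    have t4 : S.coframe.inChart p
        = (fun x => (ContinuousLinearMap.inl ℝ (Vec n) EG).comp (S.taut.inChart p x)) +
          fun x => (ContinuousLinearMap.inr ℝ (Vec n) EG).comp (S.conn.inChart p x) := by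
      funext x
      refine ContinuousLinearMap.ext fun v => Prod.ext ?_ ?_
      · change S.taut.inChart p x v = S.taut.inChart p x v + 0
        rw [add_zero]
      · change S.conn.inChart p x v = 0 + S.conn.inChart p x v
        rw [zero_add]
    rw [t4]
    exact t3
  have h2 : ContMDiffAt 𝓘(ℝ, E) 𝓘(ℝ, (Vec n × EG) [⋀^Fin k]→L[ℝ] ℝ) ∞
      (fun x => Ω.toFun (S.classMap ((extChartAt 𝓘(ℝ, E) p).symm x))) (extChartAt 𝓘(ℝ, E) p p) :=
    Ω.smooth.contMDiffAt.comp _ ((contMDiffOn_extChartAt_symm p).contMDiffAt ht)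
  have h3 := (contMDiffAt_iff_contDiffAt.1 h2).differentiableAt (by simp)
  exact h3.continuousAlternatingMapCompContinuousLinearMap h1

variable [FiniteDimensional ℝ E] [FiniteDimensional ℝ EG]

theorem dAAt_eq [IsManifold 𝓘(ℝ, E) ∞ P] {k : ℕ} (Ω : S.AForm k) {p q : P}
    (h : S.LocallyEquivalent p q) : S.dAAt Ω p = S.dAAt Ω q := by
  obtain ⟨Φ, hΦ, hp, rfl⟩ := h
  have hcof : ∀ r ∈ Φ.source, ∀ ξ : TangentSpace 𝓘(ℝ, E) r,
      S.coframe (Φ r) (mfderiv 𝓘(ℝ, E) 𝓘(ℝ, E) Φ r ξ) = S.coframe r ξ := fun r hr ξ =>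
    Prod.ext (hΦ.taut_eq r hr ξ) (hΦ.conn_eq r hr ξ)
  have hd := DForm.d_natural (S.pullback S.classMap S.coframe Ω.toFun)
    (S.pullback S.classMap S.coframe Ω.toFun) hΦ.smooth (fun r hr => by
      have hX : S.classMap (Φ r) = S.classMap r :=
        (Quotient.sound (s := S.locEquivSetoid)
          (show S.LocallyEquivalent r (Φ r) from ⟨Φ, hΦ, hr, rfl⟩)).symm
      ext v
      change Ω.toFun (S.classMap (Φ r)) _ = Ω.toFun (S.classMap r) _
      rw [hX]
      exact congrArg _ (funext fun i => hcof r hr (v i))) hp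
    (S.differentiableAt_inChart_pullback Ω (Φ p))
  have e1 : ∀ a, S.coframe p (S.coframeInv p a) = a := fun a =>
    DFunLike.congr_fun (S.isInvertible_coframe p).self_comp_inverse a
  have e2 : ∀ ξ, S.coframeInv (Φ p) (S.coframe (Φ p) ξ) = ξ := fun ξ =>
    DFunLike.congr_fun (S.isInvertible_coframe (Φ p)).inverse_comp_self ξ
  have e3 : ∀ a, (mfderiv 𝓘(ℝ, E) 𝓘(ℝ, E) Φ p (S.coframeInv p a) : TangentSpace 𝓘(ℝ, E) (Φ p))
      = S.coframeInv (Φ p) a := fun a => by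
    rw [← e2 (mfderiv 𝓘(ℝ, E) 𝓘(ℝ, E) Φ p (S.coframeInv p a)), hcof p hp, e1]
  ext v
  change (S.pullback S.classMap S.coframe Ω.toFun).d p (fun i => S.coframeInv p (v i))
    = (S.pullback S.classMap S.coframe Ω.toFun).d (Φ p) (fun i => S.coframeInv (Φ p) (v i))
  rw [← hd]
  exact congrArg ((S.pullback S.classMap S.coframe Ω.toFun).d (Φ p)) (funext fun i => e3 (v i))

/-- The differential `d_A` of the classifying Lie algebroid `A = X × (ℝⁿ ⊕ 𝔤)`, which encodes its
anchor and its bracket. It is characterized by `H^* d_A = d H^*`, where `H = (θ, ω) : TP → A`. -/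
def dA [IsManifold 𝓘(ℝ, E) ∞ P] {k : ℕ} (Ω : S.AForm k) :
    S.ClassifyingSpace → (Vec n × EG) [⋀^Fin (k + 1)]→L[ℝ] ℝ := fun x =>
  Quotient.lift (s := S.locEquivSetoid) (S.dAAt Ω) (fun _ _ h => S.dAAt_eq Ω h) x

theorem pullback_dA [IsManifold 𝓘(ℝ, E) ∞ P] {k : ℕ} (Ω : S.AForm k) :
    S.pullback S.classMap S.coframe (S.dA Ω) = (S.pullback S.classMap S.coframe Ω.toFun).d := by
  funext p
  have e1 : ∀ ξ, S.coframeInv p (S.coframe p ξ) = ξ := fun ξ =>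
    DFunLike.congr_fun (S.isInvertible_coframe p).inverse_comp_self ξ
  ext v
  change (S.pullback S.classMap S.coframe Ω.toFun).d p
    (fun i => S.coframeInv p (S.coframe p (v i))) = _
  simp only [e1]

/-- A `G`-realization of the classifying algebroid `A = X × (ℝⁿ ⊕ 𝔤)` of `S = (P, θ, ω)`: a
`G`-structure with connection `S' = (P', θ', ω')` together with a morphism of `G`-structure
algebroids with connection `(H', h') : TP' → A`. Here the `G`-action on `A` is
`(x, u, α) g = (x g, g⁻¹ u, Ad g⁻¹ α)`, the action morphism is `(x, α) ↦ (x, 0, α)`, and the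
tautological and connection forms of `A` are the projections to `ℝⁿ` and to `𝔤`. -/
structure Realization [IsManifold 𝓘(ℝ, E) ∞ P] (S : GStructureConn G EG E P)
    (S' : GStructureConn G EG E' P') where
  /-- the classifying map `h' : P' → X` -/
  h' : P' → S.ClassifyingSpace
  /-- the fibre component of the bundle map `H' : TP' → A` covering `h'` -/
  H' : OneForm E' P' (Vec n × EG)
  h'_smooth : S.SmoothInto (E' := E') h'
  H'_smooth : H'.Smooth
  /-- `H'` is a Lie algebroid morphism: `H'^* d_A = d H'^*` on `A`-forms. -/
  algebroid_morphism : ∀ (k : ℕ) (Ω : S.AForm k),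
    S.pullback h' H' (S.dA Ω) = (S.pullback h' H' Ω.toFun).d
  h'_equivariant : ∀ p g, h' (S'.act p g) = S.actX (h' p) g
  H'_equivariant : ∀ p g (ξ : TangentSpace 𝓘(ℝ, E') p),
    H' (S'.act p g) (mfderiv 𝓘(ℝ, E') 𝓘(ℝ, E') (fun q => S'.act q g) p ξ) =
      ((g⁻¹ : G).1.1 (H' p ξ).1, Ad G g⁻¹ (H' p ξ).2)
  H'_action : ∀ p (α : EG),
    H' (S'.act p 1) (mfderiv 𝓘(ℝ, EG) 𝓘(ℝ, E') (fun g : G => S'.act p g) 1 α) = (0, α)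
  H'_taut : ∀ p (ξ : TangentSpace 𝓘(ℝ, E') p), (H' p ξ).1 = S'.taut p ξ
  H'_conn : ∀ p (ξ : TangentSpace 𝓘(ℝ, E') p), (H' p ξ).2 = S'.conn p ξ

end GStructureConn

end Main

end GStr

end

/-! Dimension count makes `(θ, ω)` a coframe, and the axioms of a realization force `H' = (θ', ω')`.
A local equivalence is therefore a map pulling back the coframe `H` of `P` to the coframe `H'` of
`P'`. In charts this is the total differential equation `DΦ(x) = A(x, Φ(x))` with `A(x, y) = H(y)⁻¹
H'(x)`; its solutions are local diffeomorphisms, because `A` takes invertible values. Since `H'` is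
an algebroid morphism, both coframes satisfy the same structure equations: `dH` and the
differentials of invariant functions are expressed through the coframe with coefficients that live
on `X`. Hence the Frobenius condition for `A` holds at `(x, y)` once these coefficients agree at
`h'(x)` and `h(y)`.

They need not agree on a full neighbourhood, so the ordinary Frobenius theorem does not apply. The
constraint `h'(x) = h(y)` is replaced by finitely many equations `f i (h'(x)) = f i (h(y))`, where
the `f i` are invariant functions whose differentials at `p₀` form a basis of the invariant
differentials. Full regularity makes these differentials span at nearby points too, so every smooth
function on `X` is near `p₀` a Lipschitz function of the `f i` (`ControlsNear.exists_lipschitz`).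
Along a solution curve over a ray, the differences of the `f i` thus satisfy a linear differential
inequality with zero initial value, and they vanish. `exists_solution_total_differential_equation`
asks for compatibility only along such curves.

The solution preserves the `f i`. That it preserves classes follows from a second use of the same
theorem, with `P` as a realization of its own algebroid: two nearby points of `P` with equal `f i`
are locally equivalent (`FullyRegular.exists_isLocalEquivalence`).

For the equivariant statement, `(q, g) ↦ Φ(q g)` and `(q, g) ↦ Φ(q) g` pull back the coframe to the
same form on `P' × G`. They agree at `(p, g)` for `g` in the common stabilizer, hence near it.
Properness of the action yields a neighbourhood of `p` on which `Φ` commutes with every `g`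
returning a point to it. The same holds for `Φ⁻¹`, so `q g ↦ Φ(q) g` is well defined and injective
on a saturated neighbourhood. -/

noncomputable section

namespace GStr

/-! ### Total differential equations and Lipschitz dependence of functions -/

section Analysis

variable {E : Type*} [NormedAddCommGroup E] [NormedSpace ℝ E]
  {E' : Type*} [NormedAddCommGroup E'] [NormedSpace ℝ E']

/-- The Picard-Lindelöf theorem, with the solution confined to the given ball. -/
theorem exists_solution_mem_closedBall [CompleteSpace E] {f : ℝ → E → E} {y₀ : E} {a L K : NNReal}
    (hf : IsPicardLindelof f (⟨0, by simp⟩ : Icc (0 : ℝ) 1) y₀ a 0 L K) :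
    ∃ y : ℝ → E, y 0 = y₀ ∧ (∀ t, y t ∈ Metric.closedBall y₀ a) ∧
      ∀ t ∈ Icc (0 : ℝ) 1, HasDerivWithinAt y (f t (y t)) (Icc 0 1) t := by
  -- The fixed point lives in a space of curves confined to the ball; working with it directly keeps
  -- this confinement.
  obtain ⟨α, hα⟩ := ODE.FunSpace.exists_isFixedPt_next hf (Metric.mem_closedBall_self le_rfl)
  refine ⟨α.compProj, ?_, fun t => α.compProj_mem_closedBall hf.mul_max_le, fun t ht => ?_⟩
  · have := α.compProj_val (t := ⟨0, by simp⟩)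
    rw [this, ← hα, ODE.FunSpace.next_apply₀]
  · apply (ODE.hasDerivWithinAt_picard_Icc (t₀ := 0) (by simp) hf.continuousOn_uncurry
      α.continuous_compProj.continuousOn (fun _ _ => α.compProj_mem_closedBall hf.mul_max_le)
      y₀ ht).congr_of_mem _ ht
    intro t' ht'
    nth_rw 1 [← hα]
    rw [ODE.FunSpace.compProj_of_mem ht', ODE.FunSpace.next_apply]

theorem gronwallBound_zero_le {K ε t : ℝ} (hK : 1 ≤ K) (hε : 0 ≤ ε) (ht : t ∈ Icc (0 : ℝ) 1) :
    gronwallBound 0 K ε t ≤ ε * Real.exp K := by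
  rw [gronwallBound_of_K_ne_0 (by positivity)]
  have h1 : Real.exp (K * t) ≤ Real.exp K :=
    Real.exp_le_exp.2 (mul_le_of_le_one_right (by linarith) ht.2)
  have h2 : ε / K ≤ ε := div_le_self hε hK
  have h3 : 1 ≤ Real.exp (K * t) := Real.one_le_exp (by have := ht.1; positivity)
  calc 0 * Real.exp (K * t) + ε / K * (Real.exp (K * t) - 1)
      = ε / K * (Real.exp (K * t) - 1) := by ring
    _ ≤ ε * Real.exp K := by
      apply mul_le_mul h2 (by linarith) (by linarith) hε

/-- A twice continuously differentiable map is, together with its derivative, bounded and Lipschitz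
on some ball. -/
theorem exists_closedBall_bounds {F : Type*} [NormedAddCommGroup F] [NormedSpace ℝ F]
    {A : E → F} {z₀ : E} (hA : ContDiffAt ℝ 2 A z₀) {O : Set E} (hO : O ∈ 𝓝 z₀) :
    ∃ ρ > 0, ∃ N ≥ 1, Metric.closedBall z₀ ρ ⊆ O ∧
      (∀ z ∈ Metric.closedBall z₀ ρ, DifferentiableAt ℝ A z ∧ ‖A z‖ ≤ N ∧ ‖fderiv ℝ A z‖ ≤ N) ∧
      ∀ z ∈ Metric.closedBall z₀ ρ, ∀ z' ∈ Metric.closedBall z₀ ρ,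
        ‖fderiv ℝ A z - fderiv ℝ A z'‖ ≤ N * ‖z - z'‖ := by
  have h1 : ContDiffAt ℝ 1 (fderiv ℝ A) z₀ := hA.fderiv_right (m := 1) (by norm_num)
  obtain ⟨K, s, hs, hK⟩ := h1.exists_lipschitzOnWith
  have h2 : ∀ᶠ z in 𝓝 z₀, DifferentiableAt ℝ A z := by
    filter_upwards [hA.eventually (by simp)] with z hz using hz.differentiableAt (by simp)
  have h3 : ∀ᶠ z in 𝓝 z₀, ‖A z‖ < ‖A z₀‖ + 1 :=
    hA.continuousAt.norm.eventually_lt continuousAt_const (by simp)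
  have h4 : ∀ᶠ z in 𝓝 z₀, ‖fderiv ℝ A z‖ < ‖fderiv ℝ A z₀‖ + 1 :=
    h1.continuousAt.norm.eventually_lt continuousAt_const (by simp)
  have h5 : ∀ᶠ z in 𝓝 z₀, z ∈ s := hs
  have h6 : ∀ᶠ z in 𝓝 z₀, z ∈ O := hO
  obtain ⟨ρ, hρ, hB⟩ := Metric.nhds_basis_closedBall.eventually_iff.1
    (h2.and (h3.and (h4.and (h5.and h6))))
  -- The sum of the three bounds, each of them nonnegative, lets a single constant serve everywhere.
  refine ⟨ρ, hρ, (‖A z₀‖ + 1) + (‖fderiv ℝ A z₀‖ + 1) + K, ?_, fun z hz => (hB hz).2.2.2.2,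
    fun z hz => ⟨(hB hz).1, ?_, ?_⟩, fun z hz z' hz' => ?_⟩
  · have := norm_nonneg (A z₀); have := norm_nonneg (fderiv ℝ A z₀); have := K.2; linarith
  · have := (hB hz).2.1; have := norm_nonneg (fderiv ℝ A z₀); have := K.2; linarith
  · have := (hB hz).2.2.1; have := norm_nonneg (A z₀); have := K.2; linarith
  · refine (hK.norm_sub_le (hB hz).2.2.2.1 (hB hz').2.2.2.1).trans ?_
    have := norm_nonneg (A z₀); have := norm_nonneg (fderiv ℝ A z₀)
    gcongr
    linarith

/-- The total differential equation `DΦ(x) = A(x, Φ(x))` has a solution with `Φ(x₀) = y₀`, if the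
compatibility condition of the Frobenius theorem holds along those solution curves which lie over
the rays through `x₀`. -/
theorem exists_solution_total_differential_equation [CompleteSpace E]
    {A : E' × E → E' →L[ℝ] E} {x₀ : E'} {y₀ : E} (hA : ContDiffAt ℝ 2 A (x₀, y₀))
    {O : Set (E' × E)} (hO : O ∈ 𝓝 (x₀, y₀)) {Q : E' × E → Prop}
    (hQ : ∀ (v : E') (y : ℝ → E), y 0 = y₀ → (∀ t ∈ Icc (0 : ℝ) 1, (x₀ + t • v, y t) ∈ O) →
      (∀ t ∈ Icc (0 : ℝ) 1, HasDerivWithinAt y (A (x₀ + t • v, y t) v) (Icc 0 1) t) →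
      ∀ t ∈ Icc (0 : ℝ) 1, Q (x₀ + t • v, y t))
    (hcompat : ∀ z ∈ O, Q z → ∀ u w,
      fderiv ℝ A z (u, A z u) w = fderiv ℝ A z (w, A z w) u) :
    ∃ Φ : E' → E, Φ x₀ = y₀ ∧
      ∀ᶠ x in 𝓝 x₀, (x, Φ x) ∈ O ∧ Q (x, Φ x) ∧ HasFDerivAt Φ (A (x, Φ x)) x := by
  obtain ⟨ρ, hρ, N, hN, hBO, hB, hL⟩ := exists_closedBall_bounds hA hO
  -- With `‖h‖ ≤ 2 * r`, the comparison curve `w` below deviates from `y₀` by at most `ρ/4 + 2 * N *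
  -- r ≤ 3 * ρ / 4`, so it stays in the ball of radius `ρ`.
  obtain ⟨r, hr, hr1, hrρ⟩ : ∃ r > 0, r ≤ 1 ∧ N * r ≤ ρ / 4 := by
    refine ⟨min 1 (ρ / 4 / N), by positivity, min_le_left _ _, ?_⟩
    calc N * min 1 (ρ / 4 / N) ≤ N * (ρ / 4 / N) := by gcongr; exact min_le_right _ _
      _ = ρ / 4 := by field_simp
  have hrρ' : r ≤ ρ / 4 := le_trans (le_mul_of_one_le_left hr.le hN) hrρ
  have hmem : ∀ {x y}, ‖x - x₀‖ ≤ ρ → ‖y - y₀‖ ≤ ρ → (x, y) ∈ Metric.closedBall (x₀, y₀) ρ := by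
    intro x y hx hy
    rw [mem_closedBall_iff_norm]
    exact max_le hx hy
  have hlip : ∀ z ∈ Metric.closedBall (x₀, y₀) ρ, ∀ z' ∈ Metric.closedBall (x₀, y₀) ρ,
      ‖A z' - A z‖ ≤ N * ‖z' - z‖ := fun z hz z' hz' =>
    (convex_closedBall (x₀, y₀) ρ).norm_image_sub_le_of_norm_fderiv_le (fun x hx => (hB x hx).1)
      (fun x hx => (hB x hx).2.2) hz hz'
  have htay : ∀ z ∈ Metric.closedBall (x₀, y₀) ρ, ∀ z' ∈ Metric.closedBall (x₀, y₀) ρ,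
      ‖A z' - A z - fderiv ℝ A z (z' - z)‖ ≤ N * ‖z' - z‖ * ‖z' - z‖ := fun z hz z' hz' => by
    have hseg : segment ℝ z z' ⊆ Metric.closedBall (x₀, y₀) ρ :=
      (convex_closedBall (x₀, y₀) ρ).segment_subset hz hz'
    refine (convex_segment z z').norm_image_sub_le_of_norm_hasFDerivWithin_le'
      (f' := fderiv ℝ A) (fun x hx => (hB x (hseg hx)).1.hasFDerivAt.hasFDerivWithinAt)
      (fun x hx => ?_) (left_mem_segment _ _ _) (right_mem_segment _ _ _)
    refine (hL x (hseg hx) z hz).trans ?_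
    gcongr
    obtain ⟨a, b, ha, hb, hab, rfl⟩ := hx
    have : a • z + b • z' - z = b • (z' - z) := by
      have : a = 1 - b := by linarith
      rw [this]; module
    rw [this, norm_smul, Real.norm_of_nonneg hb]
    exact mul_le_of_le_one_left (norm_nonneg _) (by linarith)
  have hray : ∀ (v : E'), ‖v‖ ≤ r → ∀ t ∈ Icc (0 : ℝ) 1, ‖x₀ + t • v - x₀‖ ≤ r := by
    intro v hv t ht
    rw [add_sub_cancel_left, norm_smul, Real.norm_of_nonneg ht.1]
    exact (mul_le_of_le_one_left (norm_nonneg _) ht.2).trans hv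
  -- solutions over the rays
  have hsol : ∀ v : E', ∃ y : ℝ → E, ‖v‖ ≤ r → y 0 = y₀ ∧ (∀ t, ‖y t - y₀‖ ≤ ρ / 4) ∧
      ∀ t ∈ Icc (0 : ℝ) 1, HasDerivWithinAt y (A (x₀ + t • v, y t) v) (Icc 0 1) t := by
    intro v
    -- The choice of `y` runs over all `v`; for long `v` any curve will do.
    by_cases hv : ‖v‖ ≤ r
    swap
    · exact ⟨fun _ => y₀, fun h => absurd h hv⟩
    have hNr : 0 ≤ N * r := by positivity
    -- Speed at most `N * r` during unit time fits exactly into the ball of radius `N * r`.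
    have hPL : IsPicardLindelof (fun t y => A (x₀ + t • v, y) v) (⟨0, by simp⟩ : Icc (0 : ℝ) 1) y₀
        ⟨N * r, hNr⟩ 0 ⟨N * r, hNr⟩ ⟨N * r, hNr⟩ := by
      have hb : ∀ t ∈ Icc (0 : ℝ) 1, ∀ y ∈ Metric.closedBall y₀ (N * r),
          (x₀ + t • v, y) ∈ Metric.closedBall (x₀, y₀) ρ := fun t ht y hy =>
        hmem ((hray v hv t ht).trans (by linarith))
          ((mem_closedBall_iff_norm.1 hy).trans (by linarith))
      refine ⟨fun t ht => LipschitzOnWith.of_dist_le_mul fun y hy y' hy' => ?_, fun y hy => ?_,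
        fun t ht y hy => ?_, ?_⟩
      · rw [dist_eq_norm, dist_eq_norm, ← sub_apply]
        have h1 := hlip _ (hb t ht y' hy') _ (hb t ht y hy)
        have h2 : ‖(x₀ + t • v, y) - (x₀ + t • v, y')‖ = ‖y - y'‖ := by
          rw [Prod.mk_sub_mk, sub_self, Prod.norm_mk, norm_zero]
          exact max_eq_right (norm_nonneg _)
        rw [h2] at h1
        calc _ ≤ ‖A (x₀ + t • v, y) - A (x₀ + t • v, y')‖ * ‖v‖ :=
              ContinuousLinearMap.le_opNorm _ _
          _ ≤ (N * ‖y - y'‖) * r := by gcongr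
          _ = N * r * ‖y - y'‖ := by ring
      · intro t ht
        have h1 : ContinuousAt A (x₀ + t • v, y) := (hB _ (hb t ht y hy)).1.continuousAt
        have h2 : ContinuousAt (fun t : ℝ => (x₀ + t • v, y)) t := by fun_prop
        have h3 : ContinuousAt (fun t : ℝ => A (x₀ + t • v, y)) t := h1.comp_of_eq h2 rfl
        exact (h3.clm_apply continuousAt_const).continuousWithinAt
      · calc ‖A (x₀ + t • v, y) v‖ ≤ ‖A (x₀ + t • v, y)‖ * ‖v‖ :=
              ContinuousLinearMap.le_opNorm _ _
          _ ≤ N * r := by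
            gcongr
            exact (hB _ (hb t ht y hy)).2.1
      · simp
    obtain ⟨y, h1, h2, h3⟩ := exists_solution_mem_closedBall hPL
    exact ⟨y, fun _ => ⟨h1, fun t => (mem_closedBall_iff_norm.1 (h2 t)).trans hrρ, h3⟩⟩
  choose y hy using hsol
  have hy0 : ∀ v, ‖v‖ ≤ r → y v 0 = y₀ := fun v hv => (hy v hv).1
  have hyB : ∀ v, ‖v‖ ≤ r → ∀ t ∈ Icc (0 : ℝ) 1,
      (x₀ + t • v, y v t) ∈ Metric.closedBall (x₀, y₀) ρ := fun v hv t ht =>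
    hmem ((hray v hv t ht).trans (by linarith)) (((hy v hv).2.1 t).trans (by linarith))
  have hyQ : ∀ v, ‖v‖ ≤ r → ∀ t ∈ Icc (0 : ℝ) 1, Q (x₀ + t • v, y v t) := fun v hv =>
    hQ v (y v) (hy0 v hv) (fun t ht => hBO (hyB v hv t ht)) (hy v hv).2.2
  -- comparison of the solutions over two rays
  have hcmp : ∀ v h : E', ‖v‖ ≤ r → ‖v + h‖ ≤ r →
      ‖y (v + h) 1 - y v 1 - A (x₀ + v, y v 1) h‖ ≤ 2 * N ^ 3 * ‖h‖ ^ 2 * Real.exp N := by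
    intro v h hv hvh
    have hh : ‖h‖ ≤ 2 * r := by
      calc ‖h‖ = ‖(v + h) - v‖ := by rw [add_sub_cancel_left]
        _ ≤ ‖v + h‖ + ‖v‖ := norm_sub_le _ _
        _ ≤ 2 * r := by linarith
    let z : ℝ → E' × E := fun t => (x₀ + t • v, y v t)
    -- The first-order guess for the solution over the ray `v + h`: if `A (x, Φ x)` is to be the
    -- derivative of `Φ`, the endpoint over `t • (v + h)` differs from that over `t • v` by `t • A
    -- (z t) h`, up to second order.
    let w : ℝ → E := fun t => y v t + t • A (z t) h
    let e : ℝ → E := fun t => y (v + h) t - w t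
    let e' : ℝ → E := fun t => A (x₀ + t • (v + h), y (v + h) t) (v + h) -
      (A (z t) v + (t • fderiv ℝ A (z t) (v, A (z t) v) h + A (z t) h))
    have hzB : ∀ t ∈ Icc (0 : ℝ) 1, z t ∈ Metric.closedBall (x₀, y₀) ρ := hyB v hv
    have he : ∀ t ∈ Icc (0 : ℝ) 1, HasDerivWithinAt e (e' t) (Icc 0 1) t := by
      intro t ht
      have d1 := (hy (v + h) hvh).2.2 t ht
      have d2 := (hy v hv).2.2 t ht
      have d3 : HasDerivWithinAt (fun t : ℝ => x₀ + t • v) v (Icc 0 1) t := by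
        simpa using (((hasDerivAt_id t).smul_const v).const_add x₀).hasDerivWithinAt
      have d4 : HasDerivWithinAt z (v, A (z t) v) (Icc 0 1) t := d3.prodMk d2
      have d5 := (hB _ (hzB t ht)).1.hasFDerivAt.comp_hasDerivWithinAt t d4
      have d6 : HasDerivWithinAt (fun t => A (z t) h) (fderiv ℝ A (z t) (v, A (z t) v) h)
          (Icc 0 1) t := by
        simpa using d5.clm_apply (hasDerivWithinAt_const t (Icc 0 1) h)
      have d7 : HasDerivWithinAt (fun t => t • A (z t) h)
          (t • fderiv ℝ A (z t) (v, A (z t) v) h + A (z t) h) (Icc 0 1) t := by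
        simpa using (hasDerivWithinAt_id t (Icc 0 1)).fun_smul d6
      exact d1.sub (d2.add d7)
    have hbound : ∀ t ∈ Icc (0 : ℝ) 1, ‖e' t‖ ≤ N * ‖e t‖ + 2 * N ^ 3 * ‖h‖ ^ 2 := by
      intro t ht
      let δ : E' × E := (h, A (z t) h)
      let z1 : E' × E := (x₀ + t • (v + h), y (v + h) t)
      let z2 : E' × E := (x₀ + t • (v + h), w t)
      have hAz : ‖A (z t)‖ ≤ N := (hB _ (hzB t ht)).2.1
      have hAzh : ‖A (z t) h‖ ≤ N * ‖h‖ := (A (z t)).le_of_opNorm_le hAz h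
      have hδ : ‖δ‖ ≤ N * ‖h‖ :=
        max_le (le_mul_of_one_le_left (norm_nonneg _) hN) hAzh
      have htδ : ‖t • δ‖ ≤ N * ‖h‖ := by
        rw [norm_smul, Real.norm_of_nonneg ht.1]
        exact (mul_le_of_le_one_left (norm_nonneg _) ht.2).trans hδ
      have hz1 : z1 ∈ Metric.closedBall (x₀, y₀) ρ := hyB _ hvh t ht
      have hz2 : z2 ∈ Metric.closedBall (x₀, y₀) ρ := by
        refine hmem ((hray _ hvh t ht).trans (by linarith)) ?_
        have h1 : w t - y₀ = (y v t - y₀) + t • A (z t) h := by simp only [w]; abel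
        have h2 : ‖t • A (z t) h‖ ≤ N * (2 * r) := by
          rw [norm_smul, Real.norm_of_nonneg ht.1]
          refine (mul_le_of_le_one_left (norm_nonneg _) ht.2).trans (hAzh.trans ?_)
          gcongr
        rw [h1]
        refine (norm_add_le _ _).trans ?_
        have := (hy v hv).2.1 t
        linarith
      have e21 : z2 - z t = t • δ := by
        refine Prod.ext ?_ ?_
        · simp only [z2, z, δ, Prod.fst_sub, Prod.smul_fst]; module
        · simp only [z2, z, δ, w, Prod.snd_sub, Prod.smul_snd]; module
      have e12 : ‖z1 - z2‖ = ‖e t‖ := by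
        simp only [z1, z2, e, Prod.mk_sub_mk, sub_self, Prod.norm_mk, norm_zero]
        exact max_eq_right (norm_nonneg _)
      have b1 : ‖A z1 - A z2‖ ≤ N * ‖e t‖ := e12 ▸ hlip _ hz2 _ hz1
      have b2 : ‖A z2 - A (z t) - fderiv ℝ A (z t) (t • δ)‖ ≤ N * (N * ‖h‖) * (N * ‖h‖) := by
        have := htay _ (hzB t ht) _ hz2
        rw [e21] at this
        refine this.trans ?_
        gcongr
      have b3 : ‖fderiv ℝ A (z t) (t • δ)‖ ≤ N * (N * ‖h‖) := by
        refine (ContinuousLinearMap.le_opNorm _ _).trans ?_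
        gcongr
        exact (hB _ (hzB t ht)).2.2
      -- The only use of the Frobenius condition: it says that `t • A (z t) h` solves the
      -- variational equation up to a term quadratic in `h`.
      have hc : fderiv ℝ A (z t) δ v = fderiv ℝ A (z t) (v, A (z t) v) h :=
        hcompat (z t) (hBO (hzB t ht)) (hyQ v hv t ht) h v
      have key : e' t = (A z1 - A z2) (v + h)
          + (A z2 - A (z t) - fderiv ℝ A (z t) (t • δ)) (v + h)
          + fderiv ℝ A (z t) (t • δ) h := by
        simp only [e', sub_apply, map_add, map_smul,
          smul_apply, hc, z1]
        module
      rw [key]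
      have c1 : ‖(A z1 - A z2) (v + h)‖ ≤ N * ‖e t‖ * 1 :=
        (ContinuousLinearMap.le_opNorm _ _).trans
          (mul_le_mul b1 (hvh.trans hr1) (norm_nonneg _) (by positivity))
      have c2 : ‖(A z2 - A (z t) - fderiv ℝ A (z t) (t • δ)) (v + h)‖
          ≤ N * (N * ‖h‖) * (N * ‖h‖) * 1 :=
        (ContinuousLinearMap.le_opNorm _ _).trans
          (mul_le_mul b2 (hvh.trans hr1) (norm_nonneg _) (by positivity))
      have c3 : ‖fderiv ℝ A (z t) (t • δ) h‖ ≤ N * (N * ‖h‖) * ‖h‖ :=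
        ContinuousLinearMap.le_of_opNorm_le _ b3 _
      have c4 : N * (N * ‖h‖) * ‖h‖ ≤ N * (N * ‖h‖) * (N * ‖h‖) := by
        gcongr
        exact le_mul_of_one_le_left (norm_nonneg _) hN
      refine (norm_add₃_le).trans ?_
      have : N * (N * ‖h‖) * (N * ‖h‖) = N ^ 3 * ‖h‖ ^ 2 := by ring
      linarith
    have hfin := norm_le_gronwallBound_of_norm_deriv_right_le (f := e) (f' := e') (δ := 0)
      (K := N) (ε := 2 * N ^ 3 * ‖h‖ ^ 2) (a := 0) (b := 1)
      (fun t ht => (he t ht).continuousWithinAt)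
      (fun t ht => (he t (Ico_subset_Icc_self ht)).mono_of_mem_nhdsWithin
        (Icc_mem_nhdsGE_of_mem ht))
      (by simp [e, w, hy0 v hv, hy0 _ hvh])
      (fun t ht => hbound t (Ico_subset_Icc_self ht)) 1 (by simp)
    have h1 : e 1 = y (v + h) 1 - y v 1 - A (x₀ + v, y v 1) h := by
      simp only [e, w, z, one_smul]; abel
    rw [h1] at hfin
    refine hfin.trans ?_
    rw [sub_zero]
    exact gronwallBound_zero_le hN (by positivity) (by simp)
  refine ⟨fun x => y (x - x₀) 1, ?_, ?_⟩
  -- Over the ray of length zero the equation reads `y' = 0`.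
  · have h0 : ∀ t ∈ Icc (0 : ℝ) 1, HasDerivWithinAt (y 0) 0 (Icc 0 1) t := fun t ht => by
      simpa using (hy 0 (by simpa using hr.le)).2.2 t ht
    have h1 := constant_of_has_deriv_right_zero (f := y 0) (a := 0) (b := 1)
      (fun t ht => (h0 t ht).continuousWithinAt)
      (fun t ht => (h0 t (Ico_subset_Icc_self ht)).mono_of_mem_nhdsWithin
        (Icc_mem_nhdsGE_of_mem ht)) 1 (by simp)
    change y (x₀ - x₀) 1 = y₀
    rw [sub_self, h1, hy0 0 (by simpa using hr.le)]
  · filter_upwards [Metric.ball_mem_nhds x₀ hr] with x hx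
    have hv : ‖x - x₀‖ < r := mem_ball_iff_norm.1 hx
    have hx1 : x₀ + (1 : ℝ) • (x - x₀) = x := by rw [one_smul, add_sub_cancel]
    have hx2 : x₀ + (x - x₀) = x := add_sub_cancel _ _
    refine ⟨?_, ?_, ?_⟩
    · have := hBO (hyB _ hv.le 1 (by simp))
      rwa [hx1] at this
    · have := hyQ _ hv.le 1 (by simp)
      rwa [hx1] at this
    · rw [hasFDerivAt_iff_isLittleO_nhds_zero]
      refine (Asymptotics.IsBigO.of_bound (2 * N ^ 3 * Real.exp N) (g := fun h : E' => ‖h‖ ^ 2)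
        ?_).trans_isLittleO (Asymptotics.isLittleO_norm_pow_id one_lt_two)
      have hev : ∀ᶠ h : E' in 𝓝 0, ‖x - x₀ + h‖ < r := by
        have : ContinuousAt (fun h : E' => ‖x - x₀ + h‖) 0 := by fun_prop
        exact this.eventually_lt continuousAt_const (by simpa using hv)
      filter_upwards [hev] with h hh
      have := hcmp (x - x₀) h hv.le hh.le
      have e1 : x + h - x₀ = x - x₀ + h := by abel
      simp only [hx2, e1] at this ⊢
      rw [Real.norm_of_nonneg (by positivity)]
      linarith

/-- Solutions of a smooth total differential equation are smooth. -/
theorem contDiffOn_of_total_differential_equation {A : E' × E → E' →L[ℝ] E} {W : Set (E' × E)}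
    (hA : ContDiffOn ℝ ∞ A W) {Φ : E' → E} {U : Set E'} (hU : IsOpen U)
    (hW : ∀ x ∈ U, (x, Φ x) ∈ W) (hΦ : ∀ x ∈ U, HasFDerivAt Φ (A (x, Φ x)) x) :
    ContDiffOn ℝ ∞ Φ U := by
  refine contDiffOn_infty.2 fun n => ?_
  -- Bootstrapping: if `Φ` is `C^n`, so is its derivative `A (x, Φ x)`, and hence `Φ` is `C^(n+1)`.
  induction n with
  | zero =>
    exact contDiffOn_zero.2 fun x hx => (hΦ x hx).continuousAt.continuousWithinAt
  | succ n ih =>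
    push_cast
    refine (contDiffOn_succ_iff_fderiv_of_isOpen hU).2
      ⟨fun x hx => (hΦ x hx).differentiableAt.differentiableWithinAt, by simp, ?_⟩
    have h1 : ContDiffOn ℝ n (fun x => A (x, Φ x)) U :=
      (hA.of_le (by exact_mod_cast le_top)).comp (contDiffOn_id.prodMk ih) hW
    exact h1.congr fun x hx => (hΦ x hx).fderiv

/-- Two solutions of a total differential equation which agree at a point agree near it. -/
theorem eventuallyEq_of_total_differential_equation {V : Type*} [NormedAddCommGroup V]
    [NormedSpace ℝ V] {f₁ f₂ : E' → E} {x₀ : E'} {C : E → V →L[ℝ] E} {B : E' → E' →L[ℝ] V}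
    (hC : ContDiffAt ℝ 1 C (f₁ x₀)) {N : ℝ} (hB : ∀ᶠ x in 𝓝 x₀, ‖B x‖ ≤ N)
    (h₁ : ∀ᶠ x in 𝓝 x₀, HasFDerivAt f₁ ((C (f₁ x)).comp (B x)) x)
    (h₂ : ∀ᶠ x in 𝓝 x₀, HasFDerivAt f₂ ((C (f₂ x)).comp (B x)) x)
    (h₀ : f₁ x₀ = f₂ x₀) : f₁ =ᶠ[𝓝 x₀] f₂ := by
  obtain ⟨K, s, hs, hK⟩ := hC.exists_lipschitzOnWith
  have c₁ : ∀ᶠ x in 𝓝 x₀, f₁ x ∈ s := h₁.self_of_nhds.continuousAt.preimage_mem_nhds hs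
  have c₂ : ∀ᶠ x in 𝓝 x₀, f₂ x ∈ s :=
    h₂.self_of_nhds.continuousAt.preimage_mem_nhds (by rwa [← h₀])
  obtain ⟨r, hr, hb⟩ := Metric.nhds_basis_ball.eventually_iff.1
    (hB.and (h₁.and (h₂.and (c₁.and c₂))))
  filter_upwards [Metric.ball_mem_nhds x₀ hr] with x hx
  have hray : ∀ t ∈ Icc (0 : ℝ) 1, x₀ + t • (x - x₀) ∈ Metric.ball x₀ r := by
    intro t ht
    rw [mem_ball_iff_norm, add_sub_cancel_left, norm_smul, Real.norm_of_nonneg ht.1]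
    exact (mul_le_of_le_one_left (norm_nonneg _) ht.2).trans_lt (mem_ball_iff_norm.1 hx)
  have hd : ∀ t : ℝ, HasDerivAt (fun t : ℝ => x₀ + t • (x - x₀)) (x - x₀) t := fun t => by
    simpa using ((hasDerivAt_id t).smul_const (x - x₀)).const_add x₀
  have hder : ∀ t ∈ Icc (0 : ℝ) 1, HasDerivAt
      (fun t : ℝ => f₁ (x₀ + t • (x - x₀)) - f₂ (x₀ + t • (x - x₀)))
      (C (f₁ (x₀ + t • (x - x₀))) (B (x₀ + t • (x - x₀)) (x - x₀)) -
        C (f₂ (x₀ + t • (x - x₀))) (B (x₀ + t • (x - x₀)) (x - x₀))) t := fun t ht =>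
    ((hb (hray t ht)).2.1.comp_hasDerivAt t (hd t)).sub
      ((hb (hray t ht)).2.2.1.comp_hasDerivAt t (hd t))
  -- On a ray from `x₀` both functions solve one ordinary differential equation, Lipschitz in the
  -- unknown because `B` does not depend on it.
  have hz := eq_zero_of_abs_deriv_le_mul_abs_self_of_eq_zero_right (K := K * (N * r))
    (a := 0) (b := 1) (fun t ht => (hder t ht).continuousAt.continuousWithinAt)
    (fun t ht => (hder t (Ico_subset_Icc_self ht)).hasDerivWithinAt) (by simp [h₀])
    (fun t ht => ?_) 1 (by simp)
  · rw [one_smul, add_sub_cancel] at hz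
    exact sub_eq_zero.1 hz
  · have ht' := Ico_subset_Icc_self ht
    have hbt := hb (hray t ht')
    rw [← sub_apply]
    refine (ContinuousLinearMap.le_opNorm _ _).trans ?_
    have b1 := hK.norm_sub_le hbt.2.2.2.1 hbt.2.2.2.2
    have b2 : ‖B (x₀ + t • (x - x₀)) (x - x₀)‖ ≤ N * r := by
      refine (ContinuousLinearMap.le_opNorm _ _).trans ?_
      have := (mem_ball_iff_norm.1 hx).le
      have := hbt.1
      have := (norm_nonneg _).trans hbt.1
      gcongr
    calc _ ≤ (K * ‖f₁ (x₀ + t • (x - x₀)) - f₂ (x₀ + t • (x - x₀))‖) * (N * r) := by gcongr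
      _ = _ := by ring

/-- If near `x₀` the map `f` is a submersion and the kernel of `Df` is contained in that of `Dg`,
then near `x₀` the map `g` is a Lipschitz function of `f`. -/
theorem exists_lipschitz_of_ker_le [CompleteSpace E]
    {F₁ : Type*} [NormedAddCommGroup F₁] [NormedSpace ℝ F₁]
    {F₂ : Type*} [NormedAddCommGroup F₂] [NormedSpace ℝ F₂] {f : E → F₁} {g : E → F₂} {x₀ : E}
    (hf : ContDiffAt ℝ ∞ f x₀) (hg : ContDiffAt ℝ ∞ g x₀) {R : F₁ →L[ℝ] E}
    (hR : ∀ w, fderiv ℝ f x₀ (R w) = w)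
    (hker : ∀ᶠ x in 𝓝 x₀, ∀ ξ, fderiv ℝ f x ξ = 0 → fderiv ℝ g x ξ = 0) :
    ∃ K : ℝ, ∃ U ∈ 𝓝 x₀, ∀ x ∈ U, ∀ y ∈ U, ‖g x - g y‖ ≤ K * ‖f x - f y‖ := by
  set L := fderiv ℝ f x₀ with hL
  -- `T` is the straightening change of coordinates: its derivative at `x₀` is the identity and `L ∘
  -- T = f`, so in the coordinate `T` the submersion `f` is the linear map `L`.
  let T : E → E := fun x => R (f x) + (x - R (L x))
  have hT : ContDiffAt ℝ ∞ T x₀ := by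
    have h1 : ContDiffAt ℝ ∞ (fun x => R (f x)) x₀ := R.contDiff.contDiffAt.comp x₀ hf
    have h2 : ContDiffAt ℝ ∞ (fun x => x - R (L x)) x₀ :=
      contDiffAt_id.sub (R.contDiff.comp L.contDiff).contDiffAt
    exact h1.add h2
  have hT' : HasFDerivAt T ((ContinuousLinearEquiv.refl ℝ E : E →L[ℝ] E)) x₀ := by
    have h1 : HasFDerivAt (fun x => R (f x)) (R.comp L) x₀ :=
      R.hasFDerivAt.comp x₀ (hf.differentiableAt (by simp)).hasFDerivAt
    have h2 : HasFDerivAt (fun x => x - R (L x)) (ContinuousLinearMap.id ℝ E - R.comp L) x₀ :=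
      (hasFDerivAt_id x₀).sub (R.comp L).hasFDerivAt
    have h3 := h1.add h2
    rw [add_sub_cancel] at h3
    exact h3
  have hLT : ∀ x, L (T x) = f x := fun x => by
    simp only [T, map_add, map_sub, hR]
    abel
  let e := hT.toOpenPartialHomeomorph T hT' (by simp)
  have hex : ∀ x, e x = T x := fun _ => rfl
  have hx₀ : x₀ ∈ e.source := hT.mem_toOpenPartialHomeomorph_source hT' (by simp)
  have hsymm : ContDiffAt ℝ ∞ e.symm (T x₀) :=
    e.contDiffAt_symm (f₀' := ContinuousLinearEquiv.refl ℝ E) (e.map_source hx₀)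
      (by rw [← hex, e.left_inv hx₀]; exact hT') (by rw [← hex, e.left_inv hx₀]; exact hT)
  have hsx : e.symm (T x₀) = x₀ := e.left_inv hx₀
  let k : E → F₂ := fun u => g (e.symm u)
  have hk : ContDiffAt ℝ ∞ k (T x₀) :=
    ContDiffAt.comp (T x₀) (by rw [hsx]; exact hg) hsymm
  -- the derivative of `k` factors through `L`
  have hev : ∀ᶠ u in 𝓝 (T x₀), DifferentiableAt ℝ k u ∧
      ∀ δ, ‖fderiv ℝ k u δ‖ ≤ (‖fderiv ℝ k (T x₀)‖ + 1) * ‖R‖ * ‖L δ‖ := by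
    have a1 : ∀ᶠ u in 𝓝 (T x₀), ContDiffAt ℝ 1 e.symm u :=
      (hsymm.of_le (m := 1) (by simp)).eventually (by simp)
    have a2 : ∀ᶠ u in 𝓝 (T x₀), ContDiffAt ℝ 1 f (e.symm u) :=
      hsymm.continuousAt.eventually
        (by rw [hsx]; exact (hf.of_le (m := 1) (by simp)).eventually (by simp))
    have a3 : ∀ᶠ u in 𝓝 (T x₀), ContDiffAt ℝ 1 g (e.symm u) :=
      hsymm.continuousAt.eventually
        (by rw [hsx]; exact (hg.of_le (m := 1) (by simp)).eventually (by simp))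
    have a4 : ∀ᶠ u in 𝓝 (T x₀), ∀ ξ, fderiv ℝ f (e.symm u) ξ = 0 →
        fderiv ℝ g (e.symm u) ξ = 0 :=
      hsymm.continuousAt.eventually (by rw [hsx]; exact hker)
    have a5 : ∀ᶠ u in 𝓝 (T x₀), u ∈ e.target := e.open_target.mem_nhds (e.map_source hx₀)
    have a6 : ∀ᶠ u in 𝓝 (T x₀), ‖fderiv ℝ k u‖ < ‖fderiv ℝ k (T x₀)‖ + 1 :=
      (hk.fderiv_right (m := 0) (by simp)).continuousAt.norm.eventually_lt continuousAt_const
        (by simp)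
    filter_upwards [a1, a2, a3, a4, a5, a6] with u b1 b2 b3 b4 b5 b6
    have ds := (b1.differentiableAt (by simp)).hasFDerivAt
    have df := (b2.differentiableAt (by simp)).hasFDerivAt
    have dg := (b3.differentiableAt (by simp)).hasFDerivAt
    have hfs : (fun u => f (e.symm u)) =ᶠ[𝓝 u] L := by
      filter_upwards [e.open_target.mem_nhds b5] with u' hu'
      rw [← hLT, ← hex, e.right_inv hu']
    have c1 : (fderiv ℝ f (e.symm u)).comp (fderiv ℝ e.symm u) = L :=
      (df.comp u ds).unique (L.hasFDerivAt.congr_of_eventuallyEq hfs)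
    have c2 : HasFDerivAt k ((fderiv ℝ g (e.symm u)).comp (fderiv ℝ e.symm u)) u := dg.comp u ds
    refine ⟨c2.differentiableAt, fun δ => ?_⟩
    -- The vector `δ - R (L δ)` lies in the kernel of `L`, which is the kernel of `f` in the new
    -- coordinates; the derivative of `k` therefore sees only `R (L δ)`.
    have c3 : fderiv ℝ k u (δ - R (L δ)) = 0 := by
      rw [c2.fderiv]
      refine b4 _ ?_
      have := DFunLike.congr_fun c1 (δ - R (L δ))
      refine this.trans ?_
      rw [map_sub, hR, sub_self]
    rw [map_sub, sub_eq_zero] at c3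
    rw [c3]
    refine (ContinuousLinearMap.le_opNorm _ _).trans ?_
    rw [mul_assoc]
    gcongr
    exact R.le_opNorm _
  obtain ⟨r, hr, hb⟩ := Metric.nhds_basis_ball.eventually_iff.1 hev
  refine ⟨(‖fderiv ℝ k (T x₀)‖ + 1) * ‖R‖, e.source ∩ T ⁻¹' Metric.ball (T x₀) r,
    inter_mem (e.open_source.mem_nhds hx₀)
      (hT.continuousAt.preimage_mem_nhds (Metric.ball_mem_nhds _ hr)), ?_⟩
  rintro x ⟨hx1, hx2⟩ y ⟨hy1, hy2⟩
  -- Convexity of the ball in the straightened coordinates allows integration of the derivative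
  -- bound along the segment.
  have hseg : ∀ t ∈ Icc (0 : ℝ) 1, T y + t • (T x - T y) ∈ Metric.ball (T x₀) r := fun t ht =>
    (convex_ball (T x₀) r).add_smul_sub_mem hy2 hx2 ht
  have hder : ∀ t ∈ Icc (0 : ℝ) 1, HasDerivWithinAt (fun t : ℝ => k (T y + t • (T x - T y)))
      (fderiv ℝ k (T y + t • (T x - T y)) (T x - T y)) (Icc 0 1) t := fun t ht => by
    have h1 : HasDerivAt (fun t : ℝ => T y + t • (T x - T y)) (T x - T y) t := by
      simpa using ((hasDerivAt_id t).smul_const (T x - T y)).const_add (T y)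
    exact ((hb (hseg t ht)).1.hasFDerivAt.comp_hasDerivAt t h1).hasDerivWithinAt
  have := norm_image_sub_le_of_norm_deriv_le_segment_01' hder
    (fun t ht => (hb (hseg t (Ico_subset_Icc_self ht))).2 (T x - T y))
  simp only [one_smul, zero_smul, add_zero, add_sub_cancel, map_sub, hLT] at this
  have ex : k (T x) = g x := congrArg g (e.left_inv hx1)
  have ey : k (T y) = g y := congrArg g (e.left_inv hy1)
  rwa [ex, ey] at this

/-- A smooth map with invertible derivatives is a diffeomorphism near each point. -/
theorem exists_openPartialHomeomorph_of_fderiv [CompleteSpace E'] {Φ : E' → E} {U : Set E'}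
    (hU : IsOpen U) (hΦ : ContDiffOn ℝ ∞ Φ U) (hinv : ∀ x ∈ U, (fderiv ℝ Φ x).IsInvertible)
    {x₀ : E'} (hx₀ : x₀ ∈ U) :
    ∃ e : OpenPartialHomeomorph E' E, x₀ ∈ e.source ∧ e.source ⊆ U ∧ (∀ x, e x = Φ x) ∧
      ContDiffOn ℝ ∞ e.symm e.target := by
  have hat : ∀ x ∈ U, ContDiffAt ℝ ∞ Φ x := fun x hx => hΦ.contDiffAt (hU.mem_nhds hx)
  have hd : ∀ x ∈ U, HasFDerivAt Φ (fderiv ℝ Φ x) x := fun x hx =>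
    ((hat x hx).differentiableAt (by simp)).hasFDerivAt
  obtain ⟨M, hM⟩ := hinv x₀ hx₀
  let e := (hat x₀ hx₀).toOpenPartialHomeomorph Φ (hM ▸ hd x₀ hx₀) (by simp)
  have hxe : x₀ ∈ e.source :=
    (hat x₀ hx₀).mem_toOpenPartialHomeomorph_source (hM ▸ hd x₀ hx₀) (by simp)
  refine ⟨e.restrOpen U hU, by simp [hxe, hx₀], by simp, fun x => rfl, fun y hy => ?_⟩
  have hy1 := (e.restrOpen U hU).map_target hy
  rw [e.restrOpen_source] at hy1
  obtain ⟨M', hM'⟩ := hinv _ hy1.2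
  exact (((e.restrOpen U hU).contDiffAt_symm (f₀' := M') hy (hM' ▸ hd _ hy1.2)
    (hat _ hy1.2))).contDiffWithinAt

end Analysis

/-! ### Functions and exterior derivatives in charts -/

section Charts

variable {E : Type*} [NormedAddCommGroup E] [NormedSpace ℝ E]
  {P : Type*} [TopologicalSpace P] [ChartedSpace E P]
  {W : Type*} [NormedAddCommGroup W] [NormedSpace ℝ W]

/-- A function is smooth if its expressions in all charts are. -/
theorem contMDiff_of_contDiffOn_charts {g : P → W}
    (hg : ∀ p₀ : P, ContDiffOn ℝ ∞ (g ∘ (extChartAt 𝓘(ℝ, E) p₀).symm)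
      (extChartAt 𝓘(ℝ, E) p₀).target) :
    ContMDiff 𝓘(ℝ, E) 𝓘(ℝ, W) ∞ g := fun p => by
  have h1 : ContMDiffAt 𝓘(ℝ, E) 𝓘(ℝ, W) ∞ (g ∘ (extChartAt 𝓘(ℝ, E) p).symm)
      (extChartAt 𝓘(ℝ, E) p p) :=
    contMDiffAt_iff_contDiffAt.2 ((hg p).contDiffAt (extChartAt_target_mem_nhds p))
  refine (h1.comp p contMDiffAt_extChartAt).congr_of_eventuallyEq ?_
  filter_upwards [extChartAt_source_mem_nhds (I := 𝓘(ℝ, E)) p] with q hq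
  exact congrArg g ((extChartAt 𝓘(ℝ, E) p).left_inv hq).symm

variable [IsManifold 𝓘(ℝ, E) ∞ P]

theorem contMDiffAt_extChartAt_symm (p₀ : P) {x : E} (hx : x ∈ (extChartAt 𝓘(ℝ, E) p₀).target) :
    ContMDiffAt 𝓘(ℝ, E) 𝓘(ℝ, E) ∞ (extChartAt 𝓘(ℝ, E) p₀).symm x :=
  (contMDiffOn_extChartAt_symm p₀).contMDiffAt ((isOpen_extChartAt_target p₀).mem_nhds hx)

theorem isInvertible_chartInv (p₀ : P) {x : E} (hx : x ∈ (extChartAt 𝓘(ℝ, E) p₀).target) :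
    (chartInv p₀ x).IsInvertible := by
  have h := isInvertible_mfderivWithin_extChartAt_symm (I := 𝓘(ℝ, E)) (x := p₀) hx
  have h2 : range 𝓘(ℝ, E) = univ := by simp
  rw [h2, mfderivWithin_univ] at h
  exact h

theorem fderiv_comp_extChartAt_symm {g : P → W} (p₀ : P) {x : E}
    (hx : x ∈ (extChartAt 𝓘(ℝ, E) p₀).target)
    (hg : MDifferentiableAt 𝓘(ℝ, E) 𝓘(ℝ, W) g ((extChartAt 𝓘(ℝ, E) p₀).symm x)) (v : E) :
    fderiv ℝ (g ∘ (extChartAt 𝓘(ℝ, E) p₀).symm) x v =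
      mfderiv 𝓘(ℝ, E) 𝓘(ℝ, W) g ((extChartAt 𝓘(ℝ, E) p₀).symm x) (chartInv p₀ x v) := by
  have h := mfderiv_comp x hg ((contMDiffAt_extChartAt_symm p₀ hx).mdifferentiableAt (by simp))
  rw [mfderiv_eq_fderiv] at h
  exact DFunLike.congr_fun h v

theorem contDiffOn_comp_extChartAt_symm {g : P → W} (hg : ContMDiff 𝓘(ℝ, E) 𝓘(ℝ, W) ∞ g)
    (p₀ : P) :
    ContDiffOn ℝ ∞ (g ∘ (extChartAt 𝓘(ℝ, E) p₀).symm) (extChartAt 𝓘(ℝ, E) p₀).target := fun x hx =>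
  (contMDiffAt_iff_contDiffAt.1
    (hg.contMDiffAt.comp x (contMDiffAt_extChartAt_symm p₀ hx))).contDiffWithinAt

/-- The exterior derivative can be computed in any chart. -/
theorem DForm.extDeriv_inChart {k : ℕ} (η : DForm E P W k) (p₀ : P) {x : E}
    (hx : x ∈ (extChartAt 𝓘(ℝ, E) p₀).target)
    (hη : ∀ r : P, DifferentiableAt ℝ (η.inChart r) (extChartAt 𝓘(ℝ, E) r r)) :
    extDeriv (η.inChart p₀) x =
      (η.d ((extChartAt 𝓘(ℝ, E) p₀).symm x)).compContinuousLinearMap (chartInv p₀ x) := by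
  have e1 : ((chartAt E p₀).symm : E → P) = (extChartAt 𝓘(ℝ, E) p₀).symm := by
    simp [extChartAt]
  have e2 : (chartAt E p₀).symm.source = (extChartAt 𝓘(ℝ, E) p₀).target := by
    simp [extChartAt]
  -- Naturality is applied to the inverse chart, with its domain `E` regarded as a manifold. What
  -- remains is that the charts of `E` are the identity.
  have h := DForm.d_natural (P' := E) (E' := E) η (η.inChart p₀) (Φ := (chartAt E p₀).symm)
    (by rw [e1, e2]; exact contMDiffOn_extChartAt_symm p₀)
    (fun r _ => by rw [e1]; rfl) (p := x) (by rw [e2]; exact hx) (hη _)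
  rw [e1] at h
  refine Eq.trans ?_ h.symm
  have e3 : DForm.inChart (P := E) (η.inChart p₀) x = η.inChart p₀ := by
    funext y
    have e4 : ((extChartAt 𝓘(ℝ, E) x).symm : E → E) = id := by
      rw [extChartAt_model_space_eq_id]; rfl
    have e5 : (chartInv x y : E →L[ℝ] E) = ContinuousLinearMap.id ℝ E := by
      unfold chartInv
      rw [e4]
      exact mfderiv_id
    ext v
    change η.inChart p₀ ((extChartAt 𝓘(ℝ, E) x).symm y) (fun i => (chartInv x y : E →L[ℝ] E) (v i))
      = η.inChart p₀ y v
    rw [e5, e4]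
    rfl
  have e6 : mfderiv 𝓘(ℝ, E) 𝓘(ℝ, E) (extChartAt 𝓘(ℝ, E) x) x = ContinuousLinearMap.id ℝ E := by
    rw [extChartAt_model_space_eq_id]; exact mfderiv_id
  have e7 : extChartAt 𝓘(ℝ, E) x x = x := rfl
  unfold DForm.d
  rw [e3, e6, e7]
  rfl

end Charts

/-! ### The classifying algebroid, realizations and structure equations -/

section Structure

variable {n : ℕ} {G : Subgroup (GLin n)}
  {EG : Type*} [NormedAddCommGroup EG] [NormedSpace ℝ EG] [ChartedSpace EG G]
  {E : Type*} [NormedAddCommGroup E] [NormedSpace ℝ E]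
  {P : Type*} [TopologicalSpace P] [ChartedSpace E P]
  {E' : Type*} [NormedAddCommGroup E'] [NormedSpace ℝ E']
  {P' : Type*} [TopologicalSpace P'] [ChartedSpace E' P']

namespace GStructureConn

variable (S : GStructureConn G EG E P)

theorem coframe_smooth [IsManifold 𝓘(ℝ, E) ∞ P] : S.coframe.Smooth := fun p₀ => by
  have h : S.coframe.inChart p₀
      = fun x => (S.taut.inChart p₀ x).prod (S.conn.inChart p₀ x) := rfl
  rw [h]
  exact (ContinuousLinearMap.prodₗᵢ (𝕜 := ℝ) (E := E) (F := Vec n) (G := EG)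
    ℝ).contDiff.comp_contDiffOn ((S.taut_smooth p₀).prodMk (S.conn_smooth p₀))

theorem isInvertible_coframe_inChart [IsManifold 𝓘(ℝ, E) ∞ P] [FiniteDimensional ℝ E]
    [FiniteDimensional ℝ EG] (p₀ : P) {x : E} (hx : x ∈ (extChartAt 𝓘(ℝ, E) p₀).target) :
    (S.coframe.inChart p₀ x).IsInvertible := by
  obtain ⟨L, hL⟩ := isInvertible_chartInv p₀ hx
  obtain ⟨M, hM⟩ := S.isInvertible_coframe ((extChartAt 𝓘(ℝ, E) p₀).symm x)
  refine ⟨L.trans M, ?_⟩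
  unfold OneForm.inChart
  rw [← hL, ← hM]
  rfl

/-- A local equivalence from `p` to a point of `U` carries a whole neighbourhood of `p` into `U`, so
saturations of open sets are open. -/
theorem isOpenMap_classMap : IsOpenMap S.classMap := by
  intro U hU
  refine isOpen_coinduced.2 (isOpen_iff_mem_nhds.2 ?_)
  rintro p ⟨q, hq, hqp⟩
  obtain ⟨Φ, hΦ, hp, rfl⟩ : S.LocallyEquivalent p q := Quotient.exact hqp.symm
  filter_upwards [Φ.open_source.mem_nhds hp, (Φ.continuousAt hp).preimage_mem_nhds
    (hU.mem_nhds hq)] with r hr hrU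
  exact ⟨Φ r, hrU, (Quotient.sound (s := S.locEquivSetoid)
    (show S.LocallyEquivalent r (Φ r) from ⟨Φ, hΦ, hr, rfl⟩)).symm⟩

theorem classMap_eq_iff {p q : P} : S.classMap p = S.classMap q ↔ S.LocallyEquivalent p q :=
  ⟨fun h => Quotient.exact h, fun h => Quotient.sound h⟩

/-- A function on the classifying space is smooth if its pullback to `P` is. -/
def SmoothOnClasses {W : Type*} [NormedAddCommGroup W] [NormedSpace ℝ W]
    (f : S.ClassifyingSpace → W) : Prop :=
  ContMDiff 𝓘(ℝ, E) 𝓘(ℝ, W) ∞ (f ∘ S.classMap)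

/-- A smooth function on the classifying space, as a form of degree zero on the algebroid. -/
def zeroForm {f : S.ClassifyingSpace → ℝ} (hf : S.SmoothOnClasses f) : S.AForm 0 where
  toFun x := ContinuousAlternatingMap.constOfIsEmpty ℝ (Vec n × EG) (Fin 0) (f x)
  smooth := ((ContinuousAlternatingMap.constOfIsEmptyLIE ℝ (Vec n × EG) ℝ
    (Fin 0)).contDiff.contMDiff).comp hf

/-- A constant form of degree one on the algebroid. -/
def constForm (l : Vec n × EG →L[ℝ] ℝ) : S.AForm 1 where
  toFun _ := ContinuousAlternatingMap.ofSubsingleton ℝ (Vec n × EG) ℝ (0 : Fin 1) l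
  smooth := contMDiff_const

variable {S} {S' : GStructureConn G EG E' P'} [FiniteDimensional ℝ E] [FiniteDimensional ℝ EG]
  [IsManifold 𝓘(ℝ, E) ∞ P]

namespace Realization

variable (S) in
/-- The tautological realization of the classifying algebroid of `S` by `S` itself. -/
def refl : S.Realization S where
  h' := S.classMap
  H' := S.coframe
  h'_smooth := ⟨continuous_quotient_mk', fun _ _ _ hf => hf⟩
  H'_smooth := S.coframe_smooth
  algebroid_morphism _ Ω := S.pullback_dA Ω
  h'_equivariant _ _ := rfl
  H'_equivariant p g ξ := Prod.ext (S.taut_equivariant p g ξ) (S.conn_equivariant p g ξ)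
  H'_action p α := Prod.ext (S.taut_horizontal p α) (S.conn_vertical p α)
  H'_taut _ _ := rfl
  H'_conn _ _ := rfl

variable (R : S.Realization S')

/-- The conditions on tautological and connection forms determine both components of `H'`, so the
structure equations of a realization are statements about the coframe of `S'`. -/
theorem H'_eq_coframe : R.H' = S'.coframe := by
  funext p
  exact ContinuousLinearMap.ext fun ξ => Prod.ext (R.H'_taut p ξ) (R.H'_conn p ξ)

theorem smooth_comp_h' {f : S.ClassifyingSpace → ℝ} (hf : S.SmoothOnClasses f) :
    ContMDiff 𝓘(ℝ, E') 𝓘(ℝ, ℝ) ∞ (f ∘ R.h') :=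
  contMDiffOn_univ.1 (R.h'_smooth.2 univ f isOpen_univ hf.contMDiffOn)

variable [IsManifold 𝓘(ℝ, E') ∞ P']

/-- The structure equation for a function on the classifying space. -/
theorem fderiv_comp_h' {f : S.ClassifyingSpace → ℝ} (hf : S.SmoothOnClasses f) (p₀ : P') {x : E'}
    (hx : x ∈ (extChartAt 𝓘(ℝ, E') p₀).target) (v : E') :
    fderiv ℝ (f ∘ R.h' ∘ (extChartAt 𝓘(ℝ, E') p₀).symm) x v =
      S.dA (S.zeroForm hf) (R.h' ((extChartAt 𝓘(ℝ, E') p₀).symm x))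
        (fun _ => R.H'.inChart p₀ x v) := by
  have hchart : ∀ r, (S.pullback R.h' R.H' (S.zeroForm hf).toFun).inChart r = fun x =>
      ContinuousAlternatingMap.constOfIsEmpty ℝ E' (Fin 0)
        ((f ∘ R.h' ∘ (extChartAt 𝓘(ℝ, E') r).symm) x) := fun r => by
    funext y
    ext w
    rfl
  have hs : ∀ r, ContDiffOn ℝ ∞ (f ∘ R.h' ∘ (extChartAt 𝓘(ℝ, E') r).symm)
      (extChartAt 𝓘(ℝ, E') r).target := contDiffOn_comp_extChartAt_symm (R.smooth_comp_h' hf)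
  have h := DForm.extDeriv_inChart (S.pullback R.h' R.H' (S.zeroForm hf).toFun) p₀ hx
    (fun r => by
      rw [hchart]
      exact (ContinuousAlternatingMap.constOfIsEmptyLIE ℝ E' ℝ
        (Fin 0)).differentiableAt.comp _
          (((hs r).contDiffAt (extChartAt_target_mem_nhds r)).differentiableAt (by simp)))
  rw [hchart, extDeriv_constOfIsEmpty, ← R.algebroid_morphism] at h
  exact DFunLike.congr_fun h (fun _ => v)

/-- The structure equation for the coframe. -/
theorem fderiv_coframe (l : Vec n × EG →L[ℝ] ℝ) (p₀ : P') {x : E'}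
    (hx : x ∈ (extChartAt 𝓘(ℝ, E') p₀).target) (u v : E') :
    l (fderiv ℝ (R.H'.inChart p₀) x u v) - l (fderiv ℝ (R.H'.inChart p₀) x v u) =
      S.dA (S.constForm l) (R.h' ((extChartAt 𝓘(ℝ, E') p₀).symm x))
        ![R.H'.inChart p₀ x u, R.H'.inChart p₀ x v] := by
  have hchart : ∀ r, (S.pullback R.h' R.H' (S.constForm l).toFun).inChart r = fun x =>
      ContinuousAlternatingMap.ofSubsingletonLIE (𝕜 := ℝ) (E := E') (F := ℝ) (0 : Fin 1)
        (l.comp (R.H'.inChart r x)) := fun r => by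
    funext y
    ext w
    rfl
  have hd : ∀ r, ∀ y ∈ (extChartAt 𝓘(ℝ, E') r).target,
      DifferentiableAt ℝ (R.H'.inChart r) y := fun r y hy =>
    ((R.H'_smooth r).contDiffAt ((isOpen_extChartAt_target r).mem_nhds hy)).differentiableAt
      (by simp)
  have hd' : ∀ r, ∀ y ∈ (extChartAt 𝓘(ℝ, E') r).target,
      HasFDerivAt ((S.pullback R.h' R.H' (S.constForm l).toFun).inChart r)
      ((ContinuousAlternatingMap.ofSubsingletonLIE (𝕜 := ℝ) (E := E') (F := ℝ)
        (0 : Fin 1)).toContinuousLinearEquiv.toContinuousLinearMap.comp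
        ((ContinuousLinearMap.compL ℝ E' (Vec n × EG) ℝ l).comp
          (fderiv ℝ (R.H'.inChart r) y))) y := fun r y hy => by
    rw [hchart]
    exact (ContinuousAlternatingMap.ofSubsingletonLIE (𝕜 := ℝ) (E := E') (F := ℝ)
        (0 : Fin 1)).toContinuousLinearEquiv.hasFDerivAt.comp y
      ((ContinuousLinearMap.compL ℝ E' (Vec n × EG) ℝ l).hasFDerivAt.comp y
        (hd r y hy).hasFDerivAt)
  have h := DForm.extDeriv_inChart (S.pullback R.h' R.H' (S.constForm l).toFun) p₀ hx
    (fun r => (hd' r _ (mem_extChartAt_target r)).differentiableAt)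
  rw [← R.algebroid_morphism] at h
  have h2 := DFunLike.congr_fun h ![u, v]
  unfold extDeriv at h2
  rw [(hd' p₀ x hx).fderiv, ContinuousAlternatingMap.alternatizeUncurryFin_apply,
    Fin.sum_univ_two] at h2
  -- The alternating sum has two terms: differentiate along `u` and evaluate on `v`, minus the same
  -- with the roles exchanged.
  have e0 : Fin.removeNth (0 : Fin 2) ![u, v] = fun _ => v := by
    funext i; fin_cases i; rfl
  have e1 : Fin.removeNth (1 : Fin 2) ![u, v] = fun _ => u := by
    funext i; fin_cases i; rfl
  rw [e0, e1] at h2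
  simp only [Matrix.cons_val_zero, Matrix.cons_val_one] at h2
  have e2 : (S.pullback R.h' R.H' (S.dA (S.constForm l))
      ((extChartAt 𝓘(ℝ, E') p₀).symm x)).compContinuousLinearMap (chartInv p₀ x) ![u, v]
      = S.dA (S.constForm l) (R.h' ((extChartAt 𝓘(ℝ, E') p₀).symm x))
        ![R.H'.inChart p₀ x u, R.H'.inChart p₀ x v] := by
    refine congrArg (S.dA (S.constForm l) (R.h' ((extChartAt 𝓘(ℝ, E') p₀).symm x))) ?_
    funext i
    fin_cases i <;> rfl
  rw [← e2, ← h2]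
  simp [sub_eq_add_neg]

end Realization

end GStructureConn

end Structure

/-! ### Invariant functions near a point of a fully regular structure -/

/-- Linearly independent functionals on a finite-dimensional space form a surjective map. -/
theorem exists_rightInverse_of_linearIndependent {E : Type*} [NormedAddCommGroup E]
    [NormedSpace ℝ E] {d : ℕ} {φ : Fin d → E →L[ℝ] ℝ} (hφ : LinearIndependent ℝ φ) :
    ∃ R : (Fin d → ℝ) →L[ℝ] E, ∀ w, (fun i => φ i (R w)) = w := by
  let T : E →ₗ[ℝ] (Fin d → ℝ) := LinearMap.pi fun i => (φ i : E →ₗ[ℝ] ℝ)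
  have hT : LinearMap.range T = ⊤ := by
    -- A functional vanishing on a proper range would be a linear relation among the `φ i`.
    by_contra hne
    obtain ⟨f, hf0, hf⟩ := Submodule.exists_le_ker_of_lt_top _ (lt_top_iff_ne_top.2 hne)
    refine hf0 (LinearMap.ext fun w => ?_)
    have hexp : ∀ w : Fin d → ℝ, f w = ∑ i, f (Pi.single i 1) * w i := fun w => by
      conv_lhs => rw [LinearMap.pi_apply_eq_sum_univ f w]
      refine Finset.sum_congr rfl fun i _ => ?_
      rw [smul_eq_mul, mul_comm]
      congr 2
      funext j
      simp [Pi.single_apply, eq_comm]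
    have hz : ∑ i, f (Pi.single i 1) • φ i = 0 := ContinuousLinearMap.ext fun ξ => by
      have h1 : f (T ξ) = 0 := hf ⟨ξ, rfl⟩
      rw [hexp] at h1
      simpa [T] using h1
    have hc := Fintype.linearIndependent_iff.1 hφ _ hz
    rw [hexp]
    simp [hc]
  obtain ⟨R, hR⟩ := T.exists_rightInverse_of_surjective hT
  exact ⟨R.toContinuousLinearMap, fun w => DFunLike.congr_fun hR w⟩

section Structure

variable {n : ℕ} {G : Subgroup (GLin n)}
  {EG : Type*} [NormedAddCommGroup EG] [NormedSpace ℝ EG] [ChartedSpace EG G]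
  {E : Type*} [NormedAddCommGroup E] [NormedSpace ℝ E]
  {P : Type*} [TopologicalSpace P] [ChartedSpace E P]

namespace GStructureConn

variable (S : GStructureConn G EG E P)

section Smooth

variable [FiniteDimensional ℝ E] [FiniteDimensional ℝ EG] [IsManifold 𝓘(ℝ, E) ∞ P]

theorem contDiffOn_inverse_coframe_inChart (p₀ : P) :
    ContDiffOn ℝ ∞ (fun x => (S.coframe.inChart p₀ x).inverse)
      (extChartAt 𝓘(ℝ, E) p₀).target := fun x hx =>
  ((S.isInvertible_coframe_inChart p₀ hx).contDiffAt_map_inverse.comp x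
    ((S.coframe_smooth p₀).contDiffAt
      ((isOpen_extChartAt_target p₀).mem_nhds hx))).contDiffWithinAt

theorem coframe_inChart_inverse_apply (p₀ : P) {x : E}
    (hx : x ∈ (extChartAt 𝓘(ℝ, E) p₀).target) (v : Vec n × EG) :
    S.coframe.inChart p₀ x ((S.coframe.inChart p₀ x).inverse v) = v :=
  DFunLike.congr_fun (S.isInvertible_coframe_inChart p₀ hx).self_comp_inverse v

/-- The derivative of a smooth function on the classifying space along the algebroid. -/
def anchorDeriv {f : S.ClassifyingSpace → ℝ} (hf : S.SmoothOnClasses f) (x : S.ClassifyingSpace) :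
    Vec n × EG →L[ℝ] ℝ :=
  (ContinuousAlternatingMap.ofSubsingleton ℝ (Vec n × EG) ℝ (0 : Fin 1)).symm
    (S.dA (S.zeroForm hf) x)

/-- By the structure equation for the tautological realization, the pullback to a chart of `P` is
the derivative of `f` composed with the inverse coframe. Smoothness makes the anchor coefficients
themselves subject to control by the basic invariants. -/
theorem smooth_anchorDeriv {f : S.ClassifyingSpace → ℝ} (hf : S.SmoothOnClasses f) :
    S.SmoothOnClasses (S.anchorDeriv hf) := by
  refine contMDiff_of_contDiffOn_charts fun p₀ => ?_
  have h1 : ContDiffOn ℝ ∞ (fderiv ℝ (f ∘ S.classMap ∘ (extChartAt 𝓘(ℝ, E) p₀).symm))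
      (extChartAt 𝓘(ℝ, E) p₀).target :=
    (contDiffOn_comp_extChartAt_symm hf p₀).fderiv_of_isOpen
      (isOpen_extChartAt_target p₀) (by simp)
  refine (h1.clm_comp (S.contDiffOn_inverse_coframe_inChart p₀)).congr fun x hx => ?_
  refine ContinuousLinearMap.ext fun v => ?_
  have h2 := (Realization.refl S).fderiv_comp_h' hf p₀ hx ((S.coframe.inChart p₀ x).inverse v)
  refine Eq.trans ?_ h2.symm
  change S.dA (S.zeroForm hf) (S.classMap ((extChartAt 𝓘(ℝ, E) p₀).symm x)) (fun _ => v) =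
    S.dA (S.zeroForm hf) (S.classMap ((extChartAt 𝓘(ℝ, E) p₀).symm x))
      (fun _ => S.coframe.inChart p₀ x ((S.coframe.inChart p₀ x).inverse v))
  rw [S.coframe_inChart_inverse_apply p₀ hx]

/-- The structure functions of the coframe are the antisymmetrized derivatives of the coframe
evaluated on its dual frame. -/
theorem smooth_dA_constForm (l : Vec n × EG →L[ℝ] ℝ) (v : Fin 2 → Vec n × EG) :
    S.SmoothOnClasses (fun x => S.dA (S.constForm l) x v) := by
  refine contMDiff_of_contDiffOn_charts fun p₀ => ?_
  have h1 : ContDiffOn ℝ ∞ (fderiv ℝ (S.coframe.inChart p₀)) (extChartAt 𝓘(ℝ, E) p₀).target :=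
    (S.coframe_smooth p₀).fderiv_of_isOpen (isOpen_extChartAt_target p₀) (by simp)
  have h2 : ∀ a, ContDiffOn ℝ ∞ (fun x => (S.coframe.inChart p₀ x).inverse a)
      (extChartAt 𝓘(ℝ, E) p₀).target := fun a =>
    (S.contDiffOn_inverse_coframe_inChart p₀).clm_apply contDiffOn_const
  have h3 : ∀ a b, ContDiffOn ℝ ∞ (fun x => l (fderiv ℝ (S.coframe.inChart p₀) x
      ((S.coframe.inChart p₀ x).inverse a) ((S.coframe.inChart p₀ x).inverse b)))
      (extChartAt 𝓘(ℝ, E) p₀).target := fun a b =>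
    l.contDiff.comp_contDiffOn ((h1.clm_apply (h2 a)).clm_apply (h2 b))
  refine ((h3 (v 0) (v 1)).sub (h3 (v 1) (v 0))).congr fun x hx => ?_
  have h4 := (Realization.refl S).fderiv_coframe l p₀ hx
    ((S.coframe.inChart p₀ x).inverse (v 0)) ((S.coframe.inChart p₀ x).inverse (v 1))
  refine Eq.trans ?_ h4.symm
  change S.dA (S.constForm l) (S.classMap ((extChartAt 𝓘(ℝ, E) p₀).symm x)) v =
    S.dA (S.constForm l) (S.classMap ((extChartAt 𝓘(ℝ, E) p₀).symm x))
      ![S.coframe.inChart p₀ x ((S.coframe.inChart p₀ x).inverse (v 0)),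
        S.coframe.inChart p₀ x ((S.coframe.inChart p₀ x).inverse (v 1))]
  rw [S.coframe_inChart_inverse_apply p₀ hx, S.coframe_inChart_inverse_apply p₀ hx]
  congr 1
  funext i
  fin_cases i <;> rfl

end Smooth

/-- The differentials of the functions `f i` at `p₀` are independent, and near `p₀` the
differentials of all smooth functions on the classifying space depend on them. -/
def ControlsNear {d : ℕ} (f : Fin d → S.ClassifyingSpace → ℝ) (p₀ : P) : Prop :=
  (∃ R : (Fin d → ℝ) →L[ℝ] E, ∀ w, fderiv ℝ
    (fun x i => f i (S.classMap ((extChartAt 𝓘(ℝ, E) p₀).symm x))) (extChartAt 𝓘(ℝ, E) p₀ p₀) (R w)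
      = w) ∧
  ∀ᶠ x in 𝓝 (extChartAt 𝓘(ℝ, E) p₀ p₀), ∀ g : S.ClassifyingSpace → ℝ, S.SmoothOnClasses g →
    ∀ ξ, fderiv ℝ (fun x i => f i (S.classMap ((extChartAt 𝓘(ℝ, E) p₀).symm x))) x ξ = 0 →
      fderiv ℝ (g ∘ S.classMap ∘ (extChartAt 𝓘(ℝ, E) p₀).symm) x ξ = 0

variable {S}

theorem SmoothOnClasses.contDiffAt [IsManifold 𝓘(ℝ, E) ∞ P]
    {W : Type*} [NormedAddCommGroup W] [NormedSpace ℝ W]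
    {f : S.ClassifyingSpace → W} (hf : S.SmoothOnClasses f)
    (p₀ : P) {x : E} (hx : x ∈ (extChartAt 𝓘(ℝ, E) p₀).target) :
    ContDiffAt ℝ ∞ (fun x => f (S.classMap ((extChartAt 𝓘(ℝ, E) p₀).symm x))) x :=
  (contDiffOn_comp_extChartAt_symm hf p₀).contDiffAt ((isOpen_extChartAt_target p₀).mem_nhds hx)

theorem SmoothOnClasses.isInvariantFunction {f : S.ClassifyingSpace → ℝ}
    (hf : S.SmoothOnClasses f) : S.IsInvariantFunction (f ∘ S.classMap) :=
  ⟨hf, fun Φ hΦ _ hp => congrArg f (S.classMap_eq_iff.2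
    ⟨Φ.symm, hΦ.symm, Φ.map_source hp, Φ.left_inv hp⟩)⟩

/-- Together with the preceding lemma this identifies invariant functions on `P` with smooth
functions on `X`. -/
theorem IsInvariantFunction.exists_smoothOnClasses {I : P → ℝ} (hI : S.IsInvariantFunction I) :
    ∃ f : S.ClassifyingSpace → ℝ, S.SmoothOnClasses f ∧ f ∘ S.classMap = I := by
  refine ⟨Quotient.lift (s := S.locEquivSetoid) I ?_, hI.1, rfl⟩
  rintro p q ⟨Φ, hΦ, hp, rfl⟩
  exact (hI.2 Φ hΦ p hp).symm

variable [FiniteDimensional ℝ E] [IsManifold 𝓘(ℝ, E) ∞ P]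

/-- Take invariants whose differentials at `p₀` form a basis of the invariant differentials.
Independence is an open condition; as the dimension is constant, they remain a basis nearby, and a
vector killed by all of them is killed by every invariant differential. -/
theorem FullyRegular.exists_controlsNear (hS : S.FullyRegular) (p₀ : P) :
    ∃ (d : ℕ) (f : Fin d → S.ClassifyingSpace → ℝ), (∀ i, S.SmoothOnClasses (f i)) ∧
      S.ControlsNear f p₀ := by
  obtain ⟨d, hd⟩ := hS
  have hfin : ∀ p : P, FiniteDimensional ℝ (TangentSpace 𝓘(ℝ, E) p →L[ℝ] ℝ) := fun p =>
    inferInstanceAs (FiniteDimensional ℝ (E →L[ℝ] ℝ))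
  obtain ⟨φ, hφ, -, hli⟩ := Submodule.exists_fun_fin_finrank_span_eq ℝ
    {a : TangentSpace 𝓘(ℝ, E) p₀ →L[ℝ] ℝ |
      ∃ I : P → ℝ, S.IsInvariantFunction I ∧ a = mfderiv 𝓘(ℝ, E) 𝓘(ℝ, ℝ) I p₀}
  choose I hI hIφ using hφ
  choose f hf hfI using fun i => (hI i).exists_smoothOnClasses
  have ht := mem_extChartAt_target (I := 𝓘(ℝ, E)) p₀
  have hF : ∀ x ∈ (extChartAt 𝓘(ℝ, E) p₀).target, HasFDerivAt
      (fun x i => f i (S.classMap ((extChartAt 𝓘(ℝ, E) p₀).symm x))) (ContinuousLinearMap.pi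
        fun i => fderiv ℝ (f i ∘ S.classMap ∘ (extChartAt 𝓘(ℝ, E) p₀).symm) x) x := fun x hx =>
    hasFDerivAt_pi.2 fun i => (((hf i).contDiffAt p₀ hx).differentiableAt (by simp)).hasFDerivAt
  have hmd : ∀ g : S.ClassifyingSpace → ℝ, S.SmoothOnClasses g →
      ∀ x ∈ (extChartAt 𝓘(ℝ, E) p₀).target, ∀ ξ,
      fderiv ℝ (g ∘ S.classMap ∘ (extChartAt 𝓘(ℝ, E) p₀).symm) x ξ =
        mfderiv 𝓘(ℝ, E) 𝓘(ℝ, ℝ) (g ∘ S.classMap) ((extChartAt 𝓘(ℝ, E) p₀).symm x)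
          (chartInv p₀ x ξ) := fun g hg x hx ξ =>
    fderiv_comp_extChartAt_symm p₀ hx (hg.mdifferentiable (by simp) _) ξ
  let Θ : ∀ r : P, Fin _ → TangentSpace 𝓘(ℝ, E) r →L[ℝ] ℝ := fun r i =>
    mfderiv 𝓘(ℝ, E) 𝓘(ℝ, ℝ) (f i ∘ S.classMap) r
  have hR : ∃ R : (Fin _ → ℝ) →L[ℝ] E, ∀ w, fderiv ℝ
      (fun x i => f i (S.classMap ((extChartAt 𝓘(ℝ, E) p₀).symm x)))
        (extChartAt 𝓘(ℝ, E) p₀ p₀) (R w) = w := by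
    have h1 : LinearIndependent ℝ
        (Θ ((extChartAt 𝓘(ℝ, E) p₀).symm (extChartAt 𝓘(ℝ, E) p₀ p₀))) := by
      rw [extChartAt_to_inv]
      have : Θ p₀ = φ := funext fun i => by
        rw [hIφ, ← hfI]
      rwa [this]
    have h2 : LinearIndependent ℝ fun i =>
        fderiv ℝ (f i ∘ S.classMap ∘ (extChartAt 𝓘(ℝ, E) p₀).symm) (extChartAt 𝓘(ℝ, E) p₀ p₀) := by
      refine Fintype.linearIndependent_iff.2 fun c hc => Fintype.linearIndependent_iff.1 h1 c ?_
      refine ContinuousLinearMap.ext fun η => ?_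
      obtain ⟨L, hL⟩ := isInvertible_chartInv p₀ ht
      have h3 := DFunLike.congr_fun hc (L.symm η)
      have h4 : chartInv p₀ (extChartAt 𝓘(ℝ, E) p₀ p₀) (L.symm η) = η := by
        rw [← hL]; exact L.apply_symm_apply η
      simp only [sum_apply, smul_apply, hmd _ (hf _) _ ht, h4] at h3
      simp only [sum_apply, smul_apply]
      exact h3
    obtain ⟨R, hR⟩ := exists_rightInverse_of_linearIndependent h2
    exact ⟨R, fun w => by rw [(hF _ ht).fderiv]; exact hR w⟩
  refine ⟨_, f, hf, hR, ?_⟩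
  obtain ⟨R, hR⟩ := hR
  -- The composite with `R` is the identity at the centre and the units are open, so the
  -- differentials of the `f i` stay independent nearby.
  have hunit : ∀ᶠ x in 𝓝 (extChartAt 𝓘(ℝ, E) p₀ p₀), IsUnit ((fderiv ℝ
      (fun x i => f i (S.classMap ((extChartAt 𝓘(ℝ, E) p₀).symm x))) x).comp R) := by
    have h1 : ContDiffAt ℝ ∞ (fun x i => f i (S.classMap ((extChartAt 𝓘(ℝ, E) p₀).symm x)))
      (extChartAt 𝓘(ℝ, E) p₀ p₀) := contDiffAt_pi.2 fun i => (hf i).contDiffAt p₀ ht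
    have h2 : ContinuousAt (fun x => (fderiv ℝ
        (fun x i => f i (S.classMap ((extChartAt 𝓘(ℝ, E) p₀).symm x))) x).comp R)
        (extChartAt 𝓘(ℝ, E) p₀ p₀) :=
      ((h1.fderiv_right (m := 0) (by simp)).continuousAt).clm_comp continuousAt_const
    refine h2.preimage_mem_nhds (Units.isOpen.mem_nhds ?_)
    have h3 : (fderiv ℝ (fun x i => f i (S.classMap ((extChartAt 𝓘(ℝ, E) p₀).symm x)))
        (extChartAt 𝓘(ℝ, E) p₀ p₀)).comp R = 1 := ContinuousLinearMap.ext hR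
    exact h3 ▸ isUnit_one
  filter_upwards [hunit, (isOpen_extChartAt_target p₀).mem_nhds ht] with x hx hxt g hg ξ hξ
  set r := (extChartAt 𝓘(ℝ, E) p₀).symm x
  have hsurj : ∀ w : Fin _ → ℝ, ∃ v, ∀ i,
      Θ r i v = w i := fun w => by
    obtain ⟨T, hT⟩ := hx
    have h1 := DFunLike.congr_fun T.mul_inv w
    rw [hT, (hF x hxt).fderiv] at h1
    refine ⟨chartInv p₀ x (R ((T⁻¹ : ((Fin _ → ℝ) →L[ℝ] Fin _ → ℝ)ˣ).1 w)), fun i => ?_⟩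
    exact (hmd _ (hf i) x hxt _).symm.trans (congrFun h1 i)
  have hli' : LinearIndependent ℝ (Θ r) := by
    refine Fintype.linearIndependent_iff.2 fun c hc i => ?_
    obtain ⟨v, hv⟩ := hsurj (Pi.single i 1)
    have h1 := DFunLike.congr_fun hc v
    simpa [sum_apply, hv, Pi.single_apply] using h1
  -- Here full regularity enters: the span of independent differentials has the dimension found at
  -- `p₀`, which is also the dimension of the space of invariant differentials at `r`.
  have hspan : Submodule.span ℝ (range (Θ r))
      = S.invariantDifferentials r := by
    refine Submodule.eq_of_le_of_finrank_eq ?_ ?_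
    · refine Submodule.span_mono ?_
      rintro _ ⟨i, rfl⟩
      exact ⟨_, (hf i).isInvariantFunction, rfl⟩
    · rw [finrank_span_eq_card hli', hd r, Fintype.card_fin]
      exact hd p₀
  have hvan : ∀ a : TangentSpace 𝓘(ℝ, E) r →L[ℝ] ℝ, a ∈ Submodule.span ℝ (range (Θ r)) →
      a (chartInv p₀ x ξ) = 0 := fun a ha => by
    induction ha using Submodule.span_induction with
    | mem a ha =>
      obtain ⟨i, rfl⟩ := ha
      rw [(hF x hxt).fderiv] at hξ
      exact (hmd _ (hf i) x hxt ξ).symm.trans (congrFun hξ i)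
    | zero => rfl
    | add a b _ _ h1 h2 => rw [add_apply, h1, h2, add_zero]
    | smul c a _ h1 => rw [smul_apply, h1, smul_zero]
  refine (hmd g hg x hxt ξ).trans (hvan _ ?_)
  rw [hspan]
  exact Submodule.subset_span ⟨_, hg.isInvariantFunction, rfl⟩

/-- Near `p₀`, all smooth functions on the classifying space are Lipschitz functions of the
controlling functions. -/
theorem ControlsNear.exists_lipschitz {d : ℕ} {f : Fin d → S.ClassifyingSpace → ℝ} {p₀ : P}
    (hf : ∀ i, S.SmoothOnClasses (f i)) (h : S.ControlsNear f p₀)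
    {W : Type*} [NormedAddCommGroup W] [NormedSpace ℝ W] {g : S.ClassifyingSpace → W}
    (hg : S.SmoothOnClasses g) :
    ∃ K : ℝ, ∀ᶠ U in (𝓝 p₀).smallSets, ∀ p ∈ U, ∀ q ∈ U,
      ‖g (S.classMap p) - g (S.classMap q)‖ ≤
        K * ‖(fun i => f i (S.classMap p)) - fun i => f i (S.classMap q)‖ := by
  obtain ⟨⟨R, hR⟩, hker⟩ := h
  have ht := mem_extChartAt_target (I := 𝓘(ℝ, E)) p₀
  obtain ⟨K, U, hU, hK⟩ := exists_lipschitz_of_ker_le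
    (f := fun x i => f i (S.classMap ((extChartAt 𝓘(ℝ, E) p₀).symm x)))
    (g := fun x => g (S.classMap ((extChartAt 𝓘(ℝ, E) p₀).symm x)))
    (contDiffAt_pi.2 fun i => (hf i).contDiffAt p₀ ht) (hg.contDiffAt p₀ ht) hR (by
      filter_upwards [hker, (isOpen_extChartAt_target p₀).mem_nhds ht] with x hx hxt ξ hξ
      -- Control is stated for real functions; continuous functionals reduce the vector-valued case
      -- to it.
      refine SeparatingDual.eq_zero_of_forall_dual_eq_zero (R := ℝ) fun l => ?_
      have hl : S.SmoothOnClasses (l ∘ g) := l.contDiff.contMDiff.comp hg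
      have h1 := hx _ hl ξ hξ
      have h2 := l.hasFDerivAt.comp x
        (((hg.contDiffAt p₀ hxt).differentiableAt (by simp)).hasFDerivAt)
      have h3 : fderiv ℝ ((l ∘ g) ∘ S.classMap ∘ (extChartAt 𝓘(ℝ, E) p₀).symm) x = _ := h2.fderiv
      rw [h3] at h1
      exact h1)
  -- The bound holds on all small sets, so finitely many functions can later share one
  -- neighbourhood.
  refine ⟨K, eventually_smallSets.2 ⟨(extChartAt 𝓘(ℝ, E) p₀).source ∩
    (extChartAt 𝓘(ℝ, E) p₀) ⁻¹' U, inter_mem (extChartAt_source_mem_nhds p₀)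
      ((continuousAt_extChartAt p₀).preimage_mem_nhds hU), fun U' hU' p hp q hq => ?_⟩⟩
  have h1 := hK _ (hU' hp).2 _ (hU' hq).2
  simp only [(extChartAt 𝓘(ℝ, E) p₀).left_inv (hU' hp).1,
    (extChartAt 𝓘(ℝ, E) p₀).left_inv (hU' hq).1] at h1
  exact h1

end GStructureConn

end Structure

/-! ### Cartan's construction of local equivalences -/

theorem injective_of_isInvertible {E F : Type*} [NormedAddCommGroup E]
    [NormedSpace ℝ E] [NormedAddCommGroup F] [NormedSpace ℝ F] {L : E →L[ℝ] F}
    (h : L.IsInvertible) : Function.Injective L := by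
  obtain ⟨M, rfl⟩ := h
  exact M.injective

/-- The compatibility condition of the total differential equation `H(y) ∘ Dy(x) = H'(x)` at a
point where the antisymmetrized derivatives of `H` and `H'` correspond to each other. -/
theorem fderiv_symmetric_of_structure_eq {E E' V : Type*} [NormedAddCommGroup E] [NormedSpace ℝ E]
    [NormedAddCommGroup E'] [NormedSpace ℝ E'] [NormedAddCommGroup V] [NormedSpace ℝ V]
    {H : E → E →L[ℝ] V} {H' : E' → E' →L[ℝ] V} {A : E' × E → E' →L[ℝ] E} {z : E' × E}
    (hA : DifferentiableAt ℝ A z) (hH : DifferentiableAt ℝ H z.2) (hH' : DifferentiableAt ℝ H' z.1)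
    (hinj : Function.Injective (H z.2))
    (hAH : ∀ᶠ z in 𝓝 z, ∀ w, H z.2 (A z w) = H' z.1 w) {u w : E'}
    (hd : fderiv ℝ H' z.1 u w - fderiv ℝ H' z.1 w u =
      fderiv ℝ H z.2 (A z u) (A z w) - fderiv ℝ H z.2 (A z w) (A z u)) :
    fderiv ℝ A z (u, A z u) w = fderiv ℝ A z (w, A z w) u := by
  -- This is the derivative of the identity `H(y) A(x, y) w = H'(x) w` in the direction `δ`. Taking
  -- `δ` to be `(u, A z u)` and antisymmetrizing leaves only the derivatives of `H` and `H'`.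
  have key : ∀ (w : E') (δ : E' × E),
      fderiv ℝ H z.2 δ.2 (A z w) + H z.2 (fderiv ℝ A z δ w) = fderiv ℝ H' z.1 δ.1 w := by
    intro w δ
    have d1 : HasFDerivAt (fun z : E' × E => H z.2)
        ((fderiv ℝ H z.2).comp (ContinuousLinearMap.snd ℝ E' E)) z :=
      hH.hasFDerivAt.comp z hasFDerivAt_snd
    have d2 : HasFDerivAt (fun z : E' × E => H' z.1)
        ((fderiv ℝ H' z.1).comp (ContinuousLinearMap.fst ℝ E' E)) z :=
      hH'.hasFDerivAt.comp z hasFDerivAt_fst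
    have d3 := d1.clm_apply (hA.hasFDerivAt.clm_apply (hasFDerivAt_const w z))
    have d4 := d2.clm_apply (hasFDerivAt_const w z)
    have d5 := d3.unique (d4.congr_of_eventuallyEq (hAH.mono fun z hz => hz w))
    have d6 := DFunLike.congr_fun d5 δ
    simp at d6
    rw [add_comm]
    exact d6
  have k1 := key w (u, A z u)
  have k2 := key u (w, A z w)
  refine hinj ?_
  have k3 : H z.2 (fderiv ℝ A z (u, A z u) w)
      = fderiv ℝ H' z.1 u w - fderiv ℝ H z.2 (A z u) (A z w) := eq_sub_of_add_eq' k1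
  have k4 : H z.2 (fderiv ℝ A z (w, A z w) u)
      = fderiv ℝ H' z.1 w u - fderiv ℝ H z.2 (A z w) (A z u) := eq_sub_of_add_eq' k2
  rw [k3, k4, sub_eq_sub_iff_sub_eq_sub]
  exact hd

section Structure

variable {n : ℕ} {G : Subgroup (GLin n)}
  {EG : Type*} [NormedAddCommGroup EG] [NormedSpace ℝ EG] [ChartedSpace EG G]
  {E : Type*} [NormedAddCommGroup E] [NormedSpace ℝ E]
  {P : Type*} [TopologicalSpace P] [ChartedSpace E P]
  {E' : Type*} [NormedAddCommGroup E'] [NormedSpace ℝ E']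
  {P' : Type*} [TopologicalSpace P'] [ChartedSpace E' P']

namespace GStructureConn

variable {S : GStructureConn G EG E P} {S' : GStructureConn G EG E' P'}

/-- A diffeomorphism between open sets of the model spaces which intertwines the coframes defines
a local equivalence. -/
theorem exists_isLocalEquivalence_of_chart [IsManifold 𝓘(ℝ, E) ∞ P] [IsManifold 𝓘(ℝ, E') ∞ P']
    (p' : P') (p : P) (e : OpenPartialHomeomorph E' E)
    (hes : e.source ⊆ (extChartAt 𝓘(ℝ, E') p').target)
    (het : e.target ⊆ (extChartAt 𝓘(ℝ, E) p).target)
    (he : ContDiffOn ℝ ∞ e e.source) (he' : ContDiffOn ℝ ∞ e.symm e.target)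
    (hH : ∀ x ∈ e.source, ∀ v,
      S.coframe.inChart p (e x) (fderiv ℝ e x v) = S'.coframe.inChart p' x v) :
    ∃ Φ : OpenPartialHomeomorph P' P, IsLocalEquivalence S' S Φ ∧
      (∀ r, r ∈ Φ.source ↔ r ∈ (extChartAt 𝓘(ℝ, E') p').source ∧
        extChartAt 𝓘(ℝ, E') p' r ∈ e.source) ∧
      ∀ r, Φ r = (extChartAt 𝓘(ℝ, E) p).symm (e (extChartAt 𝓘(ℝ, E') p' r)) := by
  have c1 : ((chartAt E' p') : P' → E') = extChartAt 𝓘(ℝ, E') p' := by simp [extChartAt]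
  have c2 : ((chartAt E p).symm : E → P) = (extChartAt 𝓘(ℝ, E) p).symm := by simp [extChartAt]
  have c3 : (chartAt E' p').source = (extChartAt 𝓘(ℝ, E') p').source := by simp [extChartAt]
  have c4 : (chartAt E p).target = (extChartAt 𝓘(ℝ, E) p).target := by simp [extChartAt]
  let Φ : OpenPartialHomeomorph P' P := (chartAt E' p').trans (e.trans (chartAt E p).symm)
  have hsrc : ∀ r, r ∈ Φ.source ↔ r ∈ (extChartAt 𝓘(ℝ, E') p').source ∧
      extChartAt 𝓘(ℝ, E') p' r ∈ e.source := fun r => by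
    simp only [Φ, OpenPartialHomeomorph.trans_source, mem_inter_iff, mem_preimage, c1, c3,
      OpenPartialHomeomorph.symm_source, c4]
    exact ⟨fun h => ⟨h.1, h.2.1⟩, fun h => ⟨h.1, h.2, het (e.map_source h.2)⟩⟩
  have hΦ : ∀ r, Φ r = (extChartAt 𝓘(ℝ, E) p).symm (e (extChartAt 𝓘(ℝ, E') p' r)) := fun r => by
    simp only [Φ, OpenPartialHomeomorph.coe_trans, Function.comp_apply, c1, c2]
  have hsm : ContMDiffOn 𝓘(ℝ, E') 𝓘(ℝ, E) ∞ Φ Φ.source := by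
    refine ContMDiffOn.comp (t := (e.trans (chartAt E p).symm).source)
      (ContMDiffOn.comp (t := (chartAt E p).target) contMDiffOn_chart_symm
        (he.contMDiffOn.mono ?_) ?_) (contMDiffOn_chart.mono ?_) ?_
    · exact fun x hx => hx.1
    · exact fun x hx => hx.2
    · exact fun x hx => hx.1
    · exact fun x hx => hx.2
  have hsm' : ContMDiffOn 𝓘(ℝ, E) 𝓘(ℝ, E') ∞ Φ.symm Φ.target := by
    refine ContMDiffOn.comp (t := (chartAt E' p').target) contMDiffOn_chart_symm
      (ContMDiffOn.comp (t := e.target) he'.contMDiffOn (contMDiffOn_chart.mono ?_) ?_) ?_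
    · exact fun x hx => hx.1.1
    · exact fun x hx => hx.1.2
    · exact fun x hx => hx.2
  have hcof : ∀ r ∈ Φ.source, ∀ ξ : TangentSpace 𝓘(ℝ, E') r,
      S.coframe (Φ r) (mfderiv 𝓘(ℝ, E') 𝓘(ℝ, E) Φ r ξ) = S'.coframe r ξ := by
    intro r hr
    obtain ⟨hr1, hr2⟩ := (hsrc r).1 hr
    obtain ⟨x, hx, rfl⟩ : ∃ x ∈ e.source, (extChartAt 𝓘(ℝ, E') p').symm x = r :=
      ⟨_, hr2, (extChartAt 𝓘(ℝ, E') p').left_inv hr1⟩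
    intro ξ
    obtain ⟨L, hL⟩ := isInvertible_chartInv p' (hes hx)
    obtain ⟨v, rfl⟩ : ∃ v, chartInv p' x v = ξ :=
      ⟨L.symm ξ, by rw [← hL]; exact L.apply_symm_apply ξ⟩
    have hfun : Φ ∘ (extChartAt 𝓘(ℝ, E') p').symm =ᶠ[𝓝 x] (extChartAt 𝓘(ℝ, E) p).symm ∘ e := by
      filter_upwards [e.open_source.mem_nhds hx] with y hy
      simp only [Function.comp_apply, hΦ, (extChartAt 𝓘(ℝ, E') p').right_inv (hes hy)]
    have m1 := mfderiv_comp x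
      ((hsm.contMDiffAt (Φ.open_source.mem_nhds hr)).mdifferentiableAt (by simp))
      ((contMDiffAt_extChartAt_symm p' (hes hx)).mdifferentiableAt (by simp))
    have m2 := mfderiv_comp (I := 𝓘(ℝ, E')) x
      ((contMDiffAt_extChartAt_symm p (het (e.map_source hx))).mdifferentiableAt (by simp))
      ((he.contDiffAt (e.open_source.mem_nhds hx)).differentiableAt
        (by simp)).mdifferentiableAt
    rw [hfun.mfderiv_eq, m2, mfderiv_eq_fderiv] at m1
    have m3 : (mfderiv 𝓘(ℝ, E') 𝓘(ℝ, E) Φ ((extChartAt 𝓘(ℝ, E') p').symm x)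
        (chartInv p' x v) : E) = chartInv p (e x) (fderiv ℝ e x v) :=
      (DFunLike.congr_fun m1 v).symm
    have m4 : Φ ((extChartAt 𝓘(ℝ, E') p').symm x) = (extChartAt 𝓘(ℝ, E) p).symm (e x) := by
      rw [hΦ, (extChartAt 𝓘(ℝ, E') p').right_inv (hes hx)]
    rw [m4]
    exact (congrArg (S.coframe ((extChartAt 𝓘(ℝ, E) p).symm (e x))) m3).trans (hH x hx v)
  exact ⟨Φ, ⟨hsm, hsm', fun r hr ξ => congrArg Prod.fst (hcof r hr ξ),
    fun r hr ξ => congrArg Prod.snd (hcof r hr ξ)⟩, hsrc, hΦ⟩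

variable [FiniteDimensional ℝ E] [FiniteDimensional ℝ EG]
  [IsManifold 𝓘(ℝ, E) ∞ P] [FiniteDimensional ℝ E'] [IsManifold 𝓘(ℝ, E') ∞ P']

variable (n EG) in
/-- The coordinates with respect to a basis of `ℝⁿ ⊕ 𝔤`. -/
def coordForm (c : Fin (Module.finrank ℝ (Vec n × EG))) : Vec n × EG →L[ℝ] ℝ :=
  ((Module.finBasis ℝ (Vec n × EG)).coord c).toContinuousLinearMap

/-- Cartan's theorem on the existence of local equivalences: a realization of the classifying
algebroid is locally equivalent to `S`, by an equivalence mapping a given point `p'` to a given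
point `p`, if the values at `p'` and at `p` of functions `f i` agree, which determine the structure
functions. -/
theorem Realization.exists_isLocalEquivalence (R : S.Realization S') {d : ℕ}
    {f : Fin d → S.ClassifyingSpace → ℝ} (hf : ∀ i, S.SmoothOnClasses (f i)) {U : Set P}
    (hU : IsOpen U) {K : ℝ} (hK : 0 ≤ K)
    (hF : ∀ i, ∀ p ∈ U, ∀ q ∈ U,
      ‖S.anchorDeriv (hf i) (S.classMap p) - S.anchorDeriv (hf i) (S.classMap q)‖ ≤
        K * ‖(fun i => f i (S.classMap p)) - fun i => f i (S.classMap q)‖)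
    (hC : ∀ c, ∀ p ∈ U, ∀ q ∈ U, (∀ i, f i (S.classMap p) = f i (S.classMap q)) →
      S.dA (S.constForm (coordForm n EG c)) (S.classMap p)
        = S.dA (S.constForm (coordForm n EG c)) (S.classMap q))
    {p' : P'} {p : P} (hp : p ∈ U) (hp' : R.h' p' ∈ S.classMap '' U)
    (hfp : ∀ i, f i (R.h' p') = f i (S.classMap p)) :
    ∃ Φ : OpenPartialHomeomorph P' P, IsLocalEquivalence S' S Φ ∧ p' ∈ Φ.source ∧ Φ p' = p ∧
      ∀ r ∈ Φ.source, R.h' r ∈ S.classMap '' U ∧ Φ r ∈ U ∧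
        ∀ i, f i (R.h' r) = f i (S.classMap (Φ r)) := by
  set c' := extChartAt 𝓘(ℝ, E') p' with hc'
  set c := extChartAt 𝓘(ℝ, E) p with hc
  have ht' : IsOpen c'.target := isOpen_extChartAt_target p'
  have ht : IsOpen c.target := isOpen_extChartAt_target p
  let H' := S'.coframe.inChart p'
  let H := S.coframe.inChart p
  have hH' : ContDiffOn ℝ ∞ H' c'.target := S'.coframe_smooth p'
  have hH : ContDiffOn ℝ ∞ H c.target := S.coframe_smooth p
  have hHinv : ∀ y ∈ c.target, (H y).IsInvertible := fun y hy =>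
    S.isInvertible_coframe_inChart p hy
  let A : E' × E → E' →L[ℝ] E := fun z => (H z.2).inverse.comp (H' z.1)
  have hA : ContDiffOn ℝ ∞ A (c'.target ×ˢ c.target) :=
    ((S.contDiffOn_inverse_coframe_inChart p).comp contDiffOn_snd fun z hz => hz.2).clm_comp
      (hH'.comp contDiffOn_fst fun z hz => hz.1)
  have hAH : ∀ z ∈ c'.target ×ˢ c.target, ∀ w, H z.2 (A z w) = H' z.1 w := fun z hz w =>
    S.coframe_inChart_inverse_apply p hz.2 _
  -- The classes of both points are represented in `U`, where the bounds `hF` and `hC` are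
  -- available.
  let O : Set (E' × E) := {z | (z.1 ∈ c'.target ∧ R.h' (c'.symm z.1) ∈ S.classMap '' U) ∧
    (z.2 ∈ c.target ∧ c.symm z.2 ∈ U)}
  have hOt : ∀ z ∈ O, z ∈ c'.target ×ˢ c.target := fun z hz => ⟨hz.1.1, hz.2.1⟩
  have hx₀ : c'.symm (c' p') = p' := extChartAt_to_inv p'
  have hy₀ : c.symm (c p) = p := extChartAt_to_inv p
  have hUX : IsOpen (S.classMap '' U) := S.isOpenMap_classMap U hU
  have hO : O ∈ 𝓝 (c' p', c p) := by
    refine prod_mem_nhds (s := {x | x ∈ c'.target ∧ R.h' (c'.symm x) ∈ S.classMap '' U})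
      (t := {y | y ∈ c.target ∧ c.symm y ∈ U}) ?_ ?_
    · refine inter_mem (extChartAt_target_mem_nhds p') ?_
      have h1 : ContinuousAt (fun x => R.h' (c'.symm x)) (c' p') :=
        R.h'_smooth.1.continuousAt.comp (continuousAt_extChartAt_symm p')
      exact h1.preimage_mem_nhds (hUX.mem_nhds (by rw [hx₀]; exact hp'))
    · refine inter_mem (extChartAt_target_mem_nhds p) ?_
      exact (continuousAt_extChartAt_symm p).preimage_mem_nhds
        (hU.mem_nhds (by rw [← hc, hy₀]; exact hp))
  -- `Q` stands for the constraint `h'(x) = h(y)`, which cannot be differentiated directly on the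
  -- quotient.
  let Q : E' × E → Prop := fun z => ∀ i, f i (R.h' (c'.symm z.1)) = f i (S.classMap (c.symm z.2))
  have hQ : ∀ (v : E') (y : ℝ → E), y 0 = c p →
      (∀ t ∈ Icc (0 : ℝ) 1, (c' p' + t • v, y t) ∈ O) →
      (∀ t ∈ Icc (0 : ℝ) 1, HasDerivWithinAt y (A (c' p' + t • v, y t) v) (Icc 0 1) t) →
      ∀ t ∈ Icc (0 : ℝ) 1, Q (c' p' + t • v, y t) := by
    intro v y hy0 hyO hy
    let x : ℝ → E' := fun t => c' p' + t • v
    have hx : ∀ t, HasDerivAt x v t := fun t => by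
      have h : HasDerivAt (fun t : ℝ => c' p' + t • v) v t := by
        simpa using ((hasDerivAt_id t).smul_const v).const_add (c' p')
      exact h
    let e : ℝ → Fin d → ℝ := fun t i =>
      f i (R.h' (c'.symm (x t))) - f i (S.classMap (c.symm (y t)))
    -- Along the solution curve both coframes take the same value `H' (x t) v`, so the derivative of
    -- the difference involves only the difference of the anchor coefficients. This is bounded by a
    -- multiple of `e` itself.
    let e' : ℝ → Fin d → ℝ := fun t i =>
      (S.anchorDeriv (hf i) (R.h' (c'.symm (x t))) -
        S.anchorDeriv (hf i) (S.classMap (c.symm (y t)))) (H' (x t) v)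
    have he : ∀ t ∈ Icc (0 : ℝ) 1, HasDerivWithinAt e (e' t) (Icc 0 1) t := by
      intro t ht
      refine hasDerivWithinAt_pi.2 fun i => ?_
      have h1 : ContDiffOn ℝ ∞ (f i ∘ R.h' ∘ c'.symm) c'.target :=
        contDiffOn_comp_extChartAt_symm (R.smooth_comp_h' (hf i)) p'
      have h2 := ((h1.contDiffAt (ht'.mem_nhds (hyO t ht).1.1)).differentiableAt
        (by simp)).hasFDerivAt.comp_hasDerivAt t (hx t)
      rw [R.fderiv_comp_h' (hf i) p' (hyO t ht).1.1, R.H'_eq_coframe] at h2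
      have h3 := (((hf i).contDiffAt p (hyO t ht).2.1).differentiableAt
        (by simp)).hasFDerivAt.comp_hasDerivWithinAt t (hy t ht)
      have h4 := (Realization.refl S).fderiv_comp_h' (hf i) p (hyO t ht).2.1
        (A (c' p' + t • v, y t) v)
      have h5 : (Realization.refl S).H'.inChart p (y t) (A (c' p' + t • v, y t) v) = H' (x t) v :=
        hAH _ (hOt _ (hyO t ht)) v
      simp only [h5] at h4
      have h6 := h2.hasDerivWithinAt.sub (h3.congr_deriv h4)
      exact h6
    obtain ⟨B, hB⟩ := isCompact_Icc.exists_bound_of_continuousOn (f := fun t => H' (x t) v)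
      (s := Icc (0 : ℝ) 1) (fun t ht =>
        (((hH'.contDiffAt (ht'.mem_nhds (hyO t ht).1.1)).continuousAt.comp_of_eq
          (hx t).continuousAt rfl).clm_apply continuousAt_const).continuousWithinAt)
    have hzero := eq_zero_of_abs_deriv_le_mul_abs_self_of_eq_zero_right (f := e) (f' := e')
      (K := K * B) (a := 0) (b := 1) (fun t ht => (he t ht).continuousWithinAt)
      (fun t ht => (he t (Ico_subset_Icc_self ht)).mono_of_mem_nhdsWithin
        (Icc_mem_nhdsGE_of_mem ht))
      (by
        funext i
        simp only [e, x, zero_smul, add_zero, hy0, hx₀, hy₀, hfp, sub_self]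
        rfl)
      (fun t ht => by
        have ht1 := Ico_subset_Icc_self ht
        have hB0 : 0 ≤ B := (norm_nonneg _).trans (hB t ht1)
        refine (pi_norm_le_iff_of_nonneg (by positivity)).2 fun i => ?_
        obtain ⟨q, hq, hqx⟩ := (hyO t ht1).1.2
        have h1 := hF i q hq (c.symm (y t)) (hyO t ht1).2.2
        rw [hqx] at h1
        refine (ContinuousLinearMap.le_opNorm _ _).trans ?_
        refine (mul_le_mul h1 (hB t ht1) (norm_nonneg _) (by positivity)).trans (le_of_eq ?_)
        change K * ‖e t‖ * B = K * B * ‖e t‖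
        ring)
    intro t ht i
    exact sub_eq_zero.1 (congrFun (hzero t ht) i)
  have hcompat : ∀ z ∈ O, Q z → ∀ u w,
      fderiv ℝ A z (u, A z u) w = fderiv ℝ A z (w, A z w) u := by
    intro z hz hzQ u w
    have hz' := (ht'.prod ht).mem_nhds (hOt z hz)
    refine fderiv_symmetric_of_structure_eq
      ((hA.contDiffAt hz').differentiableAt (by simp))
      ((hH.contDiffAt (ht.mem_nhds hz.2.1)).differentiableAt (by simp))
      ((hH'.contDiffAt (ht'.mem_nhds hz.1.1)).differentiableAt (by simp))
      (injective_of_isInvertible (hHinv _ hz.2.1))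
      (by filter_upwards [hz'] with z hz using hAH z hz) ?_
    -- Componentwise, both sides are the structure functions evaluated on the same two vectors of
    -- `ℝⁿ ⊕ 𝔤`, and `Q` makes the structure functions agree.
    refine (Module.finBasis ℝ (Vec n × EG)).ext_elem fun i => ?_
    have h1 := R.fderiv_coframe (coordForm n EG i) p' hz.1.1 u w
    have h2 := (Realization.refl S).fderiv_coframe (coordForm n EG i) p hz.2.1 (A z u) (A z w)
    rw [R.H'_eq_coframe] at h1
    obtain ⟨q, hq, hqx⟩ := hz.1.2
    have h3 := hC i q hq (c.symm z.2) hz.2.2 (by rw [hqx]; exact hzQ)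
    rw [← hc', ← hqx, h3] at h1
    have h4 : ∀ a, (Realization.refl S).H'.inChart p z.2 (A z a) = S'.coframe.inChart p' z.1 a :=
      fun a => hAH z (hOt z hz) a
    rw [h4, h4] at h2
    have h5 := h1.trans h2.symm
    rw [← map_sub, ← map_sub] at h5
    exact h5
  obtain ⟨Ψ, hΨ0, hΨ⟩ := exists_solution_total_differential_equation
    ((hA.contDiffAt ((ht'.prod ht).mem_nhds (hOt _ (mem_of_mem_nhds hO)))).of_le
      ENat.LEInfty.out) hO hQ hcompat
  obtain ⟨T, hT, hTo, hxT⟩ := eventually_nhds_iff.1 hΨ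
  have hΨs : ContDiffOn ℝ ∞ Ψ T := contDiffOn_of_total_differential_equation hA hTo
    (fun x hx => hOt _ (hT x hx).1) fun x hx => (hT x hx).2.2
  obtain ⟨e, hxe, heT, heΨ, hes⟩ := exists_openPartialHomeomorph_of_fderiv hTo hΨs
    (fun x hx => by
      rw [(hT x hx).2.2.fderiv]
      exact (hHinv _ (hT x hx).1.2.1).inverse.comp
        (S'.isInvertible_coframe_inChart p' (hT x hx).1.1.1)) hxT
  have heΨ' : (e : E' → E) = Ψ := funext heΨ
  obtain ⟨Φ, hΦ, hΦs, hΦe⟩ := exists_isLocalEquivalence_of_chart (S := S) (S' := S') p' p e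
    (fun x hx => (hT x (heT hx)).1.1.1)
    (fun y hy => by
      have h1 := e.map_target hy
      have h2 := (hT _ (heT h1)).1.2.1
      rwa [← heΨ, e.right_inv hy] at h2)
    (by rw [heΨ']; exact hΨs.mono heT) hes
    (fun x hx v => by
      rw [heΨ', (hT x (heT hx)).2.2.fderiv]
      exact hAH _ (hOt _ (hT x (heT hx)).1) v)
  refine ⟨Φ, hΦ, (hΦs p').2 ⟨mem_extChartAt_source p', hxe⟩, ?_, fun r hr => ?_⟩
  · rw [hΦe, heΨ, ← hc', hΨ0, ← hc, hy₀]
  · obtain ⟨hr1, hr2⟩ := (hΦs r).1 hr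
    have h1 := hT _ (heT hr2)
    have h2 : c'.symm (c' r) = r := c'.left_inv hr1
    rw [hΦe, heΨ]
    refine ⟨?_, h1.1.2.2, fun i => ?_⟩
    · have := h1.1.1.2
      rwa [← hc', h2] at this
    · have := h1.2.1 i
      simp only [← hc', h2] at this
      exact this

end GStructureConn

end Structure

/-! ### Local equivalence for fully regular structures -/

section Structure

variable {n : ℕ} {G : Subgroup (GLin n)}
  {EG : Type*} [NormedAddCommGroup EG] [NormedSpace ℝ EG] [ChartedSpace EG G]
  {E : Type*} [NormedAddCommGroup E] [NormedSpace ℝ E]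
  {P : Type*} [TopologicalSpace P] [ChartedSpace E P]
  {E' : Type*} [NormedAddCommGroup E'] [NormedSpace ℝ E']
  {P' : Type*} [TopologicalSpace P'] [ChartedSpace E' P']

namespace GStructureConn

variable {S : GStructureConn G EG E P} {S' : GStructureConn G EG E' P'}
  [FiniteDimensional ℝ E] [FiniteDimensional ℝ EG]
  [IsManifold 𝓘(ℝ, E) ∞ P] [FiniteDimensional ℝ E'] [IsManifold 𝓘(ℝ, E') ∞ P']

/-- A realization of the classifying algebroid of a fully regular `G`-structure with connection
`S` is locally equivalent to `S`. -/
theorem FullyRegular.exists_isLocalEquivalence (hS : S.FullyRegular) (R : S.Realization S')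
    {p' : P'} {p : P} (hp : R.h' p' = S.classMap p) :
    ∃ Φ : OpenPartialHomeomorph P' P, IsLocalEquivalence S' S Φ ∧ p' ∈ Φ.source ∧ Φ p' = p ∧
      ∀ r ∈ Φ.source, S.classMap (Φ r) = R.h' r := by
  obtain ⟨d, f, hf, hcn⟩ := hS.exists_controlsNear p
  choose K hK using fun i => hcn.exists_lipschitz hf (S.smooth_anchorDeriv (hf i))
  choose L hL using fun (cv : Fin (Module.finrank ℝ (Vec n × EG)) ×
    (Fin 2 → Fin (Module.finrank ℝ (Vec n × EG)))) => hcn.exists_lipschitz hf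
      (S.smooth_dA_constForm (coordForm n EG cv.1)
        fun i => Module.finBasis ℝ (Vec n × EG) (cv.2 i))
  obtain ⟨U₀, hU₀, hU⟩ := eventually_smallSets.1
    ((eventually_all.2 hK).and (eventually_all.2 hL))
  obtain ⟨U, hUU₀, hUo, hpU⟩ := mem_nhds_iff.1 hU₀
  obtain ⟨hF, hC⟩ := hU U hUU₀
  have hF' : ∀ i, ∀ p ∈ U, ∀ q ∈ U,
      ‖S.anchorDeriv (hf i) (S.classMap p) - S.anchorDeriv (hf i) (S.classMap q)‖ ≤
        -- A common nonnegative constant for all `i`, also when there are no invariants.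
        (∑ i, |K i|) * ‖(fun i => f i (S.classMap p)) - fun i => f i (S.classMap q)‖ :=
    fun i p hp q hq => (hF i p hp q hq).trans (mul_le_mul_of_nonneg_right
      ((le_abs_self _).trans (Finset.single_le_sum (f := fun i => |K i|)
        (fun _ _ => abs_nonneg _) (Finset.mem_univ i))) (norm_nonneg _))
  have hC' : ∀ c, ∀ p ∈ U, ∀ q ∈ U, (∀ i, f i (S.classMap p) = f i (S.classMap q)) →
      S.dA (S.constForm (coordForm n EG c)) (S.classMap p)
        = S.dA (S.constForm (coordForm n EG c)) (S.classMap q) := by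
    intro c p hp q hq hpq
    refine ContinuousAlternatingMap.toContinuousMultilinearMap_injective
      (ContinuousMultilinearMap.toMultilinearMap_injective
        (Module.Basis.ext_multilinear (fun _ => Module.finBasis ℝ (Vec n × EG)) fun v => ?_))
    -- A Lipschitz function of the `f i` takes equal values where the `f i` do.
    have h1 := hC (c, v) p hp q hq
    rw [funext hpq, sub_self, norm_zero, mul_zero] at h1
    exact sub_eq_zero.1 (norm_le_zero_iff.1 h1)
  have hK0 : 0 ≤ ∑ i, |K i| := Finset.sum_nonneg fun _ _ => abs_nonneg _
  obtain ⟨Φ, hΦ, hpΦ, hΦp, hr⟩ := R.exists_isLocalEquivalence hf hUo hK0 hF' hC' hpU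
    ⟨p, hpU, hp.symm⟩ fun i => by rw [hp]
  refine ⟨Φ, hΦ, hpΦ, hΦp, fun r hrs => ?_⟩
  obtain ⟨⟨q, hq, hqr⟩, h1, h2⟩ := hr r hrs
  -- Only the values of the `f i` are known to agree at `q` and `Φ r`. The same construction within
  -- `P` yields a local self-equivalence from `q` to `Φ r`, so their classes agree.
  obtain ⟨Ψ, hΨ, hqΨ, hΨq, -⟩ := (Realization.refl S).exists_isLocalEquivalence hf hUo hK0 hF' hC'
    (p' := q) (p := Φ r) h1 ⟨q, hq, rfl⟩ (fun i => by rw [← h2 i, ← hqr]; rfl)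
  rw [← hqr]
  exact (S.classMap_eq_iff.2 ⟨Ψ, hΨ, hqΨ, hΨq⟩).symm

end GStructureConn

end Structure

/-! ### Uniqueness of maps with given pullback of the coframe, and local equivariance -/

section Structure

variable {n : ℕ} {G : Subgroup (GLin n)}
  {EG : Type*} [NormedAddCommGroup EG] [NormedSpace ℝ EG] [ChartedSpace EG G]
  {E : Type*} [NormedAddCommGroup E] [NormedSpace ℝ E]
  {P : Type*} [TopologicalSpace P] [ChartedSpace E P]
  {E' : Type*} [NormedAddCommGroup E'] [NormedSpace ℝ E']
  {P' : Type*} [TopologicalSpace P'] [ChartedSpace E' P']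

namespace GStructureConn

variable (S : GStructureConn G EG E P)

/-- All tangent spaces are copies of `E`; typing `ζ` in `E` avoids transport between base points
that are only propositionally equal. -/
theorem coframe_congr {p q : P} (h : p = q) (ζ : E) :
    (S.coframe p : E →L[ℝ] Vec n × EG) ζ = (S.coframe q : E →L[ℝ] Vec n × EG) ζ := by
  rw [h]

/-- This turns a prescribed pullback of the coframe into a total differential equation in a chart.
-/
theorem coframe_mfderiv_eq_inChart [IsManifold 𝓘(ℝ, E) ∞ P] {M : Type*} [NormedAddCommGroup M]
    [NormedSpace ℝ M] {f : M → P} {m : M} (hf : ContMDiffAt 𝓘(ℝ, M) 𝓘(ℝ, E) ∞ f m) {p : P}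
    (hm : f m ∈ (extChartAt 𝓘(ℝ, E) p).source) (w : M) :
    S.coframe (f m) (mfderiv 𝓘(ℝ, M) 𝓘(ℝ, E) f m w) =
      S.coframe.inChart p (extChartAt 𝓘(ℝ, E) p (f m))
        (fderiv ℝ (extChartAt 𝓘(ℝ, E) p ∘ f) m w) := by
  set c := extChartAt 𝓘(ℝ, E) p with hc
  have hcf : ContMDiffAt 𝓘(ℝ, M) 𝓘(ℝ, E) ∞ (c ∘ f) m :=
    (contMDiffAt_extChartAt' (by rwa [hc, extChartAt_source] at hm)).comp m hf
  have h1 := mfderiv_comp (g := c.symm) (f := c ∘ f) m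
    ((contMDiffAt_extChartAt_symm p (c.map_source hm)).mdifferentiableAt (by simp))
    (hcf.mdifferentiableAt (by simp))
  have h2 : c.symm ∘ (c ∘ f) =ᶠ[𝓝 m] f := by
    filter_upwards [hf.continuousAt.preimage_mem_nhds
      ((isOpen_extChartAt_source p).mem_nhds hm)] with y hy using c.left_inv hy
  rw [h2.mfderiv_eq, mfderiv_eq_fderiv] at h1
  have h3 : (mfderiv 𝓘(ℝ, M) 𝓘(ℝ, E) f m w : E)
      = chartInv p (c (f m)) (fderiv ℝ (c ∘ f) m w) := DFunLike.congr_fun h1 w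
  exact (S.coframe_congr (c.left_inv hm).symm _).trans
    (congrArg (S.coframe (c.symm (c (f m)))) h3)

/-- Two maps which pull back the coframe to the same form and agree at a point agree near it. -/
theorem eventuallyEq_of_coframe_mfderiv_eq [FiniteDimensional ℝ E] [FiniteDimensional ℝ EG]
    [IsManifold 𝓘(ℝ, E) ∞ P] {M : Type*} [NormedAddCommGroup M]
    [NormedSpace ℝ M] {f₁ f₂ : M → P} {m₀ : M}
    (h₁ : ∀ᶠ m in 𝓝 m₀, ContMDiffAt 𝓘(ℝ, M) 𝓘(ℝ, E) ∞ f₁ m)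
    (h₂ : ∀ᶠ m in 𝓝 m₀, ContMDiffAt 𝓘(ℝ, M) 𝓘(ℝ, E) ∞ f₂ m)
    (h : ∀ᶠ m in 𝓝 m₀, ∀ w, S.coframe (f₁ m) (mfderiv 𝓘(ℝ, M) 𝓘(ℝ, E) f₁ m w) =
      S.coframe (f₂ m) (mfderiv 𝓘(ℝ, M) 𝓘(ℝ, E) f₂ m w))
    (h₀ : f₁ m₀ = f₂ m₀) : f₁ =ᶠ[𝓝 m₀] f₂ := by
  set p := f₁ m₀ with hp
  set c := extChartAt 𝓘(ℝ, E) p with hc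
  have hcs : c.source ∈ 𝓝 p := extChartAt_source_mem_nhds p
  have s₁ : ∀ᶠ m in 𝓝 m₀, f₁ m ∈ c.source :=
    h₁.self_of_nhds.continuousAt.preimage_mem_nhds hcs
  have s₂ : ∀ᶠ m in 𝓝 m₀, f₂ m ∈ c.source :=
    h₂.self_of_nhds.continuousAt.preimage_mem_nhds (by rwa [← h₀])
  have hcf : ∀ f : M → P, ∀ m, ContMDiffAt 𝓘(ℝ, M) 𝓘(ℝ, E) ∞ f m → f m ∈ c.source →
      ContDiffAt ℝ ∞ (c ∘ f) m := fun f m hf hm => contMDiffAt_iff_contDiffAt.1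
    ((contMDiffAt_extChartAt' (by rwa [hc, extChartAt_source] at hm)).comp m hf)
  let H := S.coframe.inChart p
  -- `B` is the common pullback of the coframe; in the chart both maps solve `Df = H(f)⁻¹ B`.
  let B : M → M →L[ℝ] Vec n × EG := fun m => (H (c (f₁ m))).comp (fderiv ℝ (c ∘ f₁) m)
  have hBc : ContinuousAt B m₀ := by
    have t1 := hcf f₁ m₀ h₁.self_of_nhds s₁.self_of_nhds
    have t2 : ContinuousAt H (c (f₁ m₀)) :=
      ((S.coframe_smooth p).contDiffAt ((isOpen_extChartAt_target p).mem_nhds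
        (c.map_source s₁.self_of_nhds))).continuousAt
    have t3 : ContinuousAt (fun m => H (c (f₁ m))) m₀ := t2.comp_of_eq t1.continuousAt rfl
    exact t3.clm_comp (t1.fderiv_right (m := 0) (by simp)).continuousAt
  have hB : ∀ᶠ m in 𝓝 m₀, ‖B m‖ ≤ ‖B m₀‖ + 1 :=
    (hBc.norm.eventually_lt continuousAt_const (lt_add_one _)).mono fun _ h => h.le
  have key : ∀ (f : M → P) m, ContMDiffAt 𝓘(ℝ, M) 𝓘(ℝ, E) ∞ f m → f m ∈ c.source →
      (∀ w, S.coframe (f m) (mfderiv 𝓘(ℝ, M) 𝓘(ℝ, E) f m w) = B m w) →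
      HasFDerivAt (c ∘ f) ((H ((c ∘ f) m)).inverse.comp (B m)) m := by
    intro f m hf hm hw
    have t1 := ((hcf f m hf hm).differentiableAt (by simp)).hasFDerivAt
    refine t1.congr_fderiv (ContinuousLinearMap.ext fun w => ?_)
    have t2 := S.coframe_mfderiv_eq_inChart hf hm w
    rw [hw w] at t2
    have t3 : (H (c (f m))).inverse (H (c (f m)) (fderiv ℝ (c ∘ f) m w))
        = fderiv ℝ (c ∘ f) m w := DFunLike.congr_fun
      (S.isInvertible_coframe_inChart p (c.map_source hm)).inverse_comp_self _
    rw [← t3]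
    exact congrArg (H (c (f m))).inverse t2.symm
  have hBeq : ∀ᶠ m in 𝓝 m₀, ∀ w,
      S.coframe (f₁ m) (mfderiv 𝓘(ℝ, M) 𝓘(ℝ, E) f₁ m w) = B m w := by
    filter_upwards [h₁, s₁] with m a b w using S.coframe_mfderiv_eq_inChart a b w
  have hfin := eventuallyEq_of_total_differential_equation (f₁ := c ∘ f₁) (f₂ := c ∘ f₂)
    (C := fun y => (H y).inverse) (B := B)
    (((S.contDiffOn_inverse_coframe_inChart p).contDiffAt
      ((isOpen_extChartAt_target p).mem_nhds (c.map_source s₁.self_of_nhds))).of_le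
        (by exact_mod_cast le_top)) hB
    (by filter_upwards [h₁, s₁, hBeq] with m a b d using key f₁ m a b d)
    (by filter_upwards [h₂, s₂, hBeq, h] with m a b d e using key f₂ m a b
          fun w => (e w).symm.trans (d w))
    (by simp only [Function.comp_apply, ← hp, h₀])
  filter_upwards [hfin, s₁, s₂] with m a b d using c.injOn b d a

theorem coframe_mfderiv_act_left (q : P) (k : G) (ξ : TangentSpace 𝓘(ℝ, E) q) :
    S.coframe (S.act q k) (mfderiv 𝓘(ℝ, E) 𝓘(ℝ, E) (fun q => S.act q k) q ξ) =
      ((k⁻¹ : G).1.1 (S.taut q ξ), Ad G k⁻¹ (S.conn q ξ)) :=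
  Prod.ext (S.taut_equivariant q k ξ) (S.conn_equivariant q k ξ)

theorem act_smooth_right (q : P) : ContMDiff 𝓘(ℝ, EG) 𝓘(ℝ, E) ∞ (fun g : G => S.act q g) :=
  S.act_smooth.comp (contMDiff_const.prodMk contMDiff_id)

variable [LieGroup 𝓘(ℝ, EG) ∞ G]

/-- The coframe restricts to the Maurer-Cartan form on the orbits. -/
theorem coframe_mfderiv_act_right (q : P) (k : G) (η : TangentSpace 𝓘(ℝ, EG) k) :
    S.coframe (S.act q k) (mfderiv 𝓘(ℝ, EG) 𝓘(ℝ, E) (fun g : G => S.act q g) k η) =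
      (0, (mfderiv 𝓘(ℝ, EG) 𝓘(ℝ, EG) (fun g : G => k⁻¹ * g) k η : EG)) := by
  -- Writing `q g = (q k)(k⁻¹ g)` moves the derivative to the identity, where the infinitesimal
  -- generators are.
  have h1 : (fun g : G => S.act q g) =
      (fun g : G => S.act (S.act q k) g) ∘ fun g : G => k⁻¹ * g := by
    funext g
    simp only [Function.comp_apply, ← S.act_mul, mul_inv_cancel_left]
  have h2 := mfderiv_comp k (I' := 𝓘(ℝ, EG))
    (((S.act_smooth_right (S.act q k)).mdifferentiable (by simp)) (k⁻¹ * k))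
    ((contMDiff_mul_left (I := 𝓘(ℝ, EG)) (n := ∞) (a := k⁻¹)).mdifferentiable (by simp) k)
  rw [← h1, inv_mul_cancel] at h2
  have h3 := DFunLike.congr_fun h2 η
  refine (S.coframe_congr (S.act_one (S.act q k)).symm _).trans ?_
  refine (congrArg (S.coframe (S.act (S.act q k) 1)) h3).trans ?_
  exact Prod.ext (S.taut_horizontal _ _) (S.conn_vertical _ _)

end GStructureConn

variable {S : GStructureConn G EG E P} {S' : GStructureConn G EG E' P'}
  [FiniteDimensional ℝ E] [FiniteDimensional ℝ EG] [IsManifold 𝓘(ℝ, E) ∞ P]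
  [IsManifold 𝓘(ℝ, E') ∞ P'] [LieGroup 𝓘(ℝ, EG) ∞ G]

/-- A local equivalence commutes with the action of group elements close to a common element of the
stabilizers. -/
theorem IsLocalEquivalence.eventually_equivariant {Φ : OpenPartialHomeomorph P' P}
    (hΦ : IsLocalEquivalence S' S Φ) {p : P'} (hp : p ∈ Φ.source) {g : G} (hg' : S'.act p g = p)
    (hg : S.act (Φ p) g = Φ p) :
    ∀ᶠ z : P' × G in 𝓝 (p, g), Φ (S'.act z.1 z.2) = S.act (Φ z.1) z.2 := by
  let F₁ : P' × G → P := fun z => Φ (S'.act z.1 z.2)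
  let F₂ : P' × G → P := fun z => S.act (Φ z.1) z.2
  have hΦat : ∀ r ∈ Φ.source, ContMDiffAt 𝓘(ℝ, E') 𝓘(ℝ, E) ∞ Φ r := fun r hr =>
    hΦ.smooth.contMDiffAt (Φ.open_source.mem_nhds hr)
  have hev₁ : ∀ᶠ z : P' × G in 𝓝 (p, g), z.1 ∈ Φ.source :=
    continuousAt_fst.preimage_mem_nhds (Φ.open_source.mem_nhds hp)
  have hev₂ : ∀ᶠ z : P' × G in 𝓝 (p, g), S'.act z.1 z.2 ∈ Φ.source :=
    S'.act_smooth.continuous.continuousAt.preimage_mem_nhds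
      (Φ.open_source.mem_nhds (by rwa [hg']))
  have hev := hev₁.and hev₂
  have hF₁ : ∀ z : P' × G, S'.act z.1 z.2 ∈ Φ.source →
      ContMDiffAt (𝓘(ℝ, E').prod 𝓘(ℝ, EG)) 𝓘(ℝ, E) ∞ F₁ z := fun z hz =>
    (hΦat _ hz).comp z S'.act_smooth.contMDiffAt
  have hF₂ : ∀ z : P' × G, z.1 ∈ Φ.source →
      ContMDiffAt (𝓘(ℝ, E').prod 𝓘(ℝ, EG)) 𝓘(ℝ, E) ∞ F₂ z := fun z hz =>
    S.act_smooth.contMDiffAt.comp z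
      (((hΦat _ hz).comp z contMDiffAt_fst).prodMk contMDiffAt_snd)
  -- Splitting a tangent vector into its `P'` and `G` parts, both pullbacks are `(k⁻¹ θ', Ad k⁻¹
  -- ω')` plus the Maurer-Cartan form in the second component.
  have hcof : ∀ z : P' × G, z.1 ∈ Φ.source → S'.act z.1 z.2 ∈ Φ.source →
      ∀ ζ : TangentSpace (𝓘(ℝ, E').prod 𝓘(ℝ, EG)) z,
      S.coframe (F₁ z) (mfderiv (𝓘(ℝ, E').prod 𝓘(ℝ, EG)) 𝓘(ℝ, E) F₁ z ζ) =
        S.coframe (F₂ z) (mfderiv (𝓘(ℝ, E').prod 𝓘(ℝ, EG)) 𝓘(ℝ, E) F₂ z ζ) := by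
    rintro ⟨q, k⟩ hq hqk ζ
    have a1 := mfderiv_comp (I' := 𝓘(ℝ, E')) (q, k)
      ((hΦat _ hqk).mdifferentiableAt (by simp))
      (S'.act_smooth.mdifferentiable (by simp) (q, k))
    have a2 : S.coframe (F₁ (q, k)) (mfderiv (𝓘(ℝ, E').prod 𝓘(ℝ, EG)) 𝓘(ℝ, E) F₁ (q, k) ζ) =
        S'.coframe (S'.act q k) (mfderiv (𝓘(ℝ, E').prod 𝓘(ℝ, EG)) 𝓘(ℝ, E')
          (fun x : P' × G => S'.act x.1 x.2) (q, k) ζ) := by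
      refine (congrArg (S.coframe (F₁ (q, k))) (DFunLike.congr_fun a1 ζ)).trans ?_
      exact Prod.ext (hΦ.taut_eq _ hqk _) (hΦ.conn_eq _ hqk _)
    have a3 := mfderiv_prod_eq_add_apply (v := ζ) (S'.act_smooth.mdifferentiable (by simp) (q, k))
    have a4 := (congrArg (S'.coframe (S'.act q k)) a3).trans (map_add (S'.coframe (S'.act q k))
      (mfderiv 𝓘(ℝ, E') 𝓘(ℝ, E') (fun q => S'.act q k) q ζ.1)
      (mfderiv 𝓘(ℝ, EG) 𝓘(ℝ, E') (fun g : G => S'.act q g) k ζ.2))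
    have a5 := a4.trans (congrArg₂ (· + ·) (S'.coframe_mfderiv_act_left q k ζ.1)
      (S'.coframe_mfderiv_act_right q k ζ.2))
    have b3 := mfderiv_prod_eq_add_apply (v := ζ) ((hF₂ (q, k) hq).mdifferentiableAt (by simp))
    have b4 := (congrArg (S.coframe (F₂ (q, k))) b3).trans (map_add (S.coframe (S.act (Φ q) k))
      (mfderiv 𝓘(ℝ, E') 𝓘(ℝ, E) (fun q => S.act (Φ q) k) q ζ.1)
      (mfderiv 𝓘(ℝ, EG) 𝓘(ℝ, E) (fun g : G => S.act (Φ q) g) k ζ.2))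
    have b5 := mfderiv_comp q ((S.act_smooth_left k).mdifferentiable (by simp) (Φ q))
      ((hΦat _ hq).mdifferentiableAt (by simp))
    have b6 : S.coframe (S.act (Φ q) k)
        (mfderiv 𝓘(ℝ, E') 𝓘(ℝ, E) (fun q => S.act (Φ q) k) q ζ.1) =
        ((k⁻¹ : G).1.1 (S'.taut q ζ.1), Ad G k⁻¹ (S'.conn q ζ.1)) := by
      refine (congrArg (S.coframe (S.act (Φ q) k)) (DFunLike.congr_fun b5 ζ.1)).trans ?_
      refine (S.coframe_mfderiv_act_left (Φ q) k _).trans (Prod.ext ?_ ?_)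
      · exact congrArg ((k⁻¹ : G).1.1) (hΦ.taut_eq q hq ζ.1)
      · exact congrArg (Ad G k⁻¹) (hΦ.conn_eq q hq ζ.1)
    exact a2.trans (a5.trans
      (b4.trans (congrArg₂ (· + ·) b6 (S.coframe_mfderiv_act_right (Φ q) k ζ.2))).symm)
  -- pass to a chart of `P' × G`
  set c' := extChartAt 𝓘(ℝ, E') p with hc'
  set cG := extChartAt 𝓘(ℝ, EG) g with hcG
  let ψ : E' × EG → P' × G := fun m => (c'.symm m.1, cG.symm m.2)
  have hψ0 : ψ (c' p, cG g) = (p, g) := Prod.ext (extChartAt_to_inv p) (extChartAt_to_inv g)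
  have hψt : ∀ m : E' × EG, m ∈ c'.target ×ˢ cG.target →
      ContMDiffAt 𝓘(ℝ, E' × EG) (𝓘(ℝ, E').prod 𝓘(ℝ, EG)) ∞ ψ m := fun m hm =>
    ((contMDiffAt_extChartAt_symm p hm.1).comp m contDiff_fst.contMDiff.contMDiffAt).prodMk
      ((contMDiffAt_extChartAt_symm g hm.2).comp m contDiff_snd.contMDiff.contMDiffAt)
  have hmt : ∀ᶠ m in 𝓝 (c' p, cG g), m ∈ c'.target ×ˢ cG.target :=
    prod_mem_nhds (extChartAt_target_mem_nhds p) (extChartAt_target_mem_nhds g)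
  have hmev : ∀ᶠ m in 𝓝 (c' p, cG g), (ψ m).1 ∈ Φ.source ∧
      S'.act (ψ m).1 (ψ m).2 ∈ Φ.source := by
    have h1 : ContinuousAt ψ (c' p, cG g) := (hψt _ hmt.self_of_nhds).continuousAt
    exact h1.eventually (by rw [hψ0]; exact hev)
  have hfin := S.eventuallyEq_of_coframe_mfderiv_eq (f₁ := F₁ ∘ ψ) (f₂ := F₂ ∘ ψ)
    (m₀ := (c' p, cG g))
    (by filter_upwards [hmt, hmev] with m a b using (hF₁ _ b.2).comp m (hψt m a))
    (by filter_upwards [hmt, hmev] with m a b using (hF₂ _ b.1).comp m (hψt m a))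
    (by
      filter_upwards [hmt, hmev] with m a b w
      have h1 := mfderiv_comp m ((hF₁ _ b.2).mdifferentiableAt (by simp))
        ((hψt m a).mdifferentiableAt (by simp))
      have h2 := mfderiv_comp m ((hF₂ _ b.1).mdifferentiableAt (by simp))
        ((hψt m a).mdifferentiableAt (by simp))
      rw [h1, h2]
      exact hcof (ψ m) b.1 b.2 _)
    (by
      simp only [Function.comp_apply, hψ0, F₁, F₂]
      rw [hg', hg])
  have hch : ContinuousAt (fun z : P' × G => (c' z.1, cG z.2)) (p, g) :=
    ((continuousAt_extChartAt p).comp_of_eq continuousAt_fst rfl).prodMk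
      ((continuousAt_extChartAt g).comp_of_eq continuousAt_snd rfl)
  filter_upwards [hch.eventually hfin, continuousAt_fst.preimage_mem_nhds
    (extChartAt_source_mem_nhds (I := 𝓘(ℝ, E')) p), continuousAt_snd.preimage_mem_nhds
    (extChartAt_source_mem_nhds (I := 𝓘(ℝ, EG)) g)] with z h1 h2 h3
  have h4 : ψ (c' z.1, cG z.2) = z := Prod.ext (c'.left_inv h2) (cG.left_inv h3)
  simp only [Function.comp_apply, h4] at h1
  exact h1

end Structure

/-! ### Extension to saturated neighbourhoods -/

section Structure

variable {n : ℕ} {G : Subgroup (GLin n)}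
  {EG : Type*} [NormedAddCommGroup EG] [NormedSpace ℝ EG] [ChartedSpace EG G]
  {E : Type*} [NormedAddCommGroup E] [NormedSpace ℝ E]
  {P : Type*} [TopologicalSpace P] [ChartedSpace E P]
  {E' : Type*} [NormedAddCommGroup E'] [NormedSpace ℝ E']
  {P' : Type*} [TopologicalSpace P'] [ChartedSpace E' P']

variable {S : GStructureConn G EG E P} {S' : GStructureConn G EG E' P'}

/-- If the stabilizer of `p` is contained in that of `Φ p`, then `Φ` commutes with those group
elements which map some point near `p` to a point near `p`. -/
theorem IsLocalEquivalence.exists_nhds_equivariant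
    [FiniteDimensional ℝ E] [FiniteDimensional ℝ EG] [IsManifold 𝓘(ℝ, E) ∞ P]
    [IsManifold 𝓘(ℝ, E') ∞ P'] [LieGroup 𝓘(ℝ, EG) ∞ G] {Φ : OpenPartialHomeomorph P' P}
    (hΦ : IsLocalEquivalence S' S Φ) {p : P'} (hp : p ∈ Φ.source)
    (hstab : ∀ g : G, S'.act p g = p → S.act (Φ p) g = Φ p) :
    ∃ W : Set P', IsOpen W ∧ p ∈ W ∧ ∀ q ∈ W, ∀ g : G, S'.act q g ∈ W →
      Φ (S'.act q g) = S.act (Φ q) g := by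
  have h1 : ∀ᶠ y in 𝓝 (p, p), ∀ z ∈ (fun x : P' × G => (x.1, S'.act x.1 x.2)) ⁻¹' {y},
      Φ (S'.act z.1 z.2) = S.act (Φ z.1) z.2 := by
    -- The fibre over `(p, p)` is the stabilizer of `p`. Equivariance holds near each of its points,
    -- and since the map is closed, on the preimage of a neighbourhood of `(p, p)`.
    refine S'.act_proper.isClosedMap.eventually_nhds_fiber (p, p) ?_
    rintro ⟨q, g⟩ hz
    obtain ⟨rfl, hg⟩ := Prod.mk.inj hz
    exact hΦ.eventually_equivariant hp hg (hstab g hg)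
  rw [nhds_prod_eq] at h1
  obtain ⟨s, hs, hs'⟩ := mem_prod_same_iff.1 h1
  obtain ⟨W, hWs, hW, hpW⟩ := mem_nhds_iff.1 hs
  exact ⟨W, hW, hpW, fun q hq g hg => hs' (mk_mem_prod (hWs hq) (hWs hg)) (q, g) rfl⟩

/-- A local equivalence which respects the orbit relation on an open set extends to the saturation
of this set. -/
theorem IsLocalEquivalence.exists_equivariant_extension {Φ : OpenPartialHomeomorph P' P}
    (hΦ : IsLocalEquivalence S' S Φ) {V : Set P'} (hV : IsOpen V) (hVs : V ⊆ Φ.source)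
    (hiff : ∀ q ∈ V, ∀ q' ∈ V, ∀ g : G, S'.act q g = q' ↔ S.act (Φ q) g = Φ q') :
    ∃ Ψ : OpenPartialHomeomorph P' P, IsEquivariantLocalEquivalence S' S Ψ ∧
      (∀ r, r ∈ Ψ.source ↔ ∃ q ∈ V, ∃ g : G, S'.act q g = r) ∧
      ∀ q ∈ V, ∀ g : G, Ψ (S'.act q g) = S.act (Φ q) g := by
  classical
  -- One direction makes the extension well defined, the other makes it injective.
  have hiff' : ∀ q₁ ∈ V, ∀ q₂ ∈ V, ∀ g₁ g₂ : G,
      S'.act q₁ g₁ = S'.act q₂ g₂ ↔ S.act (Φ q₁) g₁ = S.act (Φ q₂) g₂ := by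
    intro q₁ h₁ q₂ h₂ g₁ g₂
    have e' : S'.act q₁ g₁ = S'.act q₂ g₂ ↔ S'.act q₁ (g₁ * g₂⁻¹) = q₂ := by
      rw [S'.act_mul]
      exact ⟨fun h => by rw [h, S'.act_act_inv], fun h => by rw [← h, S'.act_inv_act]⟩
    have e : S.act (Φ q₁) g₁ = S.act (Φ q₂) g₂ ↔ S.act (Φ q₁) (g₁ * g₂⁻¹) = Φ q₂ := by
      rw [S.act_mul]
      exact ⟨fun h => by rw [h, S.act_act_inv], fun h => by rw [← h, S.act_inv_act]⟩
    rw [e', e, hiff q₁ h₁ q₂ h₂]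
  let D : Set P' := {r | ∃ z : P' × G, z.1 ∈ V ∧ S'.act z.1 z.2 = r}
  let T : Set P := {s | ∃ z : P' × G, z.1 ∈ V ∧ S.act (Φ z.1) z.2 = s}
  -- The values off the saturations `D` and `T` play no role.
  let F : P' → P := fun r => if h : r ∈ D then S.act (Φ h.choose.1) h.choose.2 else Φ r
  let F' : P → P' := fun s => if h : s ∈ T then S'.act h.choose.1 h.choose.2 else Φ.symm s
  have hF : ∀ q ∈ V, ∀ g : G, F (S'.act q g) = S.act (Φ q) g := by
    intro q hq g
    have h : S'.act q g ∈ D := ⟨(q, g), hq, rfl⟩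
    have h1 : F (S'.act q g) = S.act (Φ h.choose.1) h.choose.2 := dif_pos h
    rw [h1]
    exact (hiff' _ h.choose_spec.1 _ hq _ _).1 h.choose_spec.2
  have hF' : ∀ q ∈ V, ∀ g : G, F' (S.act (Φ q) g) = S'.act q g := by
    intro q hq g
    have h : S.act (Φ q) g ∈ T := ⟨(q, g), hq, rfl⟩
    have h1 : F' (S.act (Φ q) g) = S'.act h.choose.1 h.choose.2 := dif_pos h
    rw [h1]
    exact (hiff' _ h.choose_spec.1 _ hq _ _).2 h.choose_spec.2
  have hDnhds : ∀ q ∈ V, ∀ g : G, ∀ᶠ r in 𝓝 (S'.act q g), S'.act r g⁻¹ ∈ V := fun q hq g =>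
    (S'.act_smooth_left g⁻¹).continuous.continuousAt.preimage_mem_nhds
      (hV.mem_nhds (by rwa [S'.act_act_inv]))
  have hTnhds : ∀ q ∈ V, ∀ g : G, ∀ᶠ s in 𝓝 (S.act (Φ q) g), S.act s g⁻¹ ∈ Φ '' V :=
    fun q hq g => (S.act_smooth_left g⁻¹).continuous.continuousAt.preimage_mem_nhds
      ((Φ.isOpen_image_of_subset_source hV hVs).mem_nhds
        (by rw [S.act_act_inv]; exact ⟨q, hq, rfl⟩))
  -- Near a point of the orbit of `q`, the extension is `Φ` conjugated by one fixed translation,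
  -- whence its smoothness.
  have hFev : ∀ q ∈ V, ∀ g : G, F =ᶠ[𝓝 (S'.act q g)] fun r => S.act (Φ (S'.act r g⁻¹)) g := by
    intro q hq g
    filter_upwards [hDnhds q hq g] with r hr
    rw [← hF _ hr, S'.act_inv_act]
  have hF'ev : ∀ q ∈ V, ∀ g : G,
      F' =ᶠ[𝓝 (S.act (Φ q) g)] fun s => S'.act (Φ.symm (S.act s g⁻¹)) g := by
    intro q hq g
    filter_upwards [hTnhds q hq g] with s hs
    obtain ⟨q', hq', hqs⟩ := hs
    rw [← hqs, Φ.left_inv (hVs hq'), ← hF' q' hq', hqs, S.act_inv_act]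
  have hsm : ∀ q ∈ V, ∀ g : G, ContMDiffAt 𝓘(ℝ, E') 𝓘(ℝ, E) ∞ F (S'.act q g) := by
    intro q hq g
    refine ContMDiffAt.congr_of_eventuallyEq ?_ (hFev q hq g)
    have h1 : ContMDiffAt 𝓘(ℝ, E') 𝓘(ℝ, E) ∞ Φ (S'.act (S'.act q g) g⁻¹) :=
      hΦ.smooth.contMDiffAt (Φ.open_source.mem_nhds (by rw [S'.act_act_inv]; exact hVs hq))
    have h2 : ContMDiffAt 𝓘(ℝ, E') 𝓘(ℝ, E) ∞ (Φ ∘ fun r => S'.act r g⁻¹) (S'.act q g) :=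
      ContMDiffAt.comp (S'.act q g) h1 (S'.act_smooth_left g⁻¹).contMDiffAt
    exact (S.act_smooth_left g).contMDiffAt.comp _ h2
  have hsm' : ∀ q ∈ V, ∀ g : G, ContMDiffAt 𝓘(ℝ, E) 𝓘(ℝ, E') ∞ F' (S.act (Φ q) g) := by
    intro q hq g
    refine ContMDiffAt.congr_of_eventuallyEq ?_ (hF'ev q hq g)
    have h1 : ContMDiffAt 𝓘(ℝ, E) 𝓘(ℝ, E') ∞ Φ.symm (S.act (S.act (Φ q) g) g⁻¹) :=
      hΦ.smooth_symm.contMDiffAt (Φ.open_target.mem_nhds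
        (by rw [S.act_act_inv]; exact Φ.map_source (hVs hq)))
    have h2 : ContMDiffAt 𝓘(ℝ, E) 𝓘(ℝ, E') ∞ (Φ.symm ∘ fun s => S.act s g⁻¹) (S.act (Φ q) g) :=
      ContMDiffAt.comp (S.act (Φ q) g) h1 (S.act_smooth_left g⁻¹).contMDiffAt
    exact (S'.act_smooth_left g).contMDiffAt.comp _ h2
  let Ψ : OpenPartialHomeomorph P' P :=
    { toFun := F
      invFun := F'
      source := D
      target := T
      map_source' := by
        rintro _ ⟨z, hz, rfl⟩
        exact ⟨z, hz, (hF _ hz _).symm⟩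
      map_target' := by
        rintro _ ⟨z, hz, rfl⟩
        exact ⟨z, hz, (hF' _ hz _).symm⟩
      left_inv' := by
        rintro _ ⟨z, hz, rfl⟩
        rw [hF _ hz, hF' _ hz]
      right_inv' := by
        rintro _ ⟨z, hz, rfl⟩
        rw [hF' _ hz, hF _ hz]
      open_source := isOpen_iff_mem_nhds.2 (by
        rintro _ ⟨z, hz, rfl⟩
        filter_upwards [hDnhds _ hz z.2] with r hr
        exact ⟨(_, z.2), hr, S'.act_inv_act _ _⟩)
      open_target := isOpen_iff_mem_nhds.2 (by
        rintro _ ⟨z, hz, rfl⟩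
        filter_upwards [hTnhds _ hz z.2] with s hs
        obtain ⟨q, hq, hqs⟩ := hs
        exact ⟨(q, z.2), hq, by rw [hqs, S.act_inv_act]⟩)
      continuousOn_toFun := by
        rintro _ ⟨z, hz, rfl⟩
        exact (hsm _ hz _).continuousAt.continuousWithinAt
      continuousOn_invFun := by
        rintro _ ⟨z, hz, rfl⟩
        exact (hsm' _ hz _).continuousAt.continuousWithinAt }
  -- the derivative of `F`
  have hder : ∀ q ∈ V, ∀ (g : G) (ξ : TangentSpace 𝓘(ℝ, E') (S'.act q g)),
      ∃ ζ : TangentSpace 𝓘(ℝ, E') q,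
        (mfderiv 𝓘(ℝ, E') 𝓘(ℝ, E') (fun r => S'.act r g) q ζ : E') = ξ ∧
        (mfderiv 𝓘(ℝ, E') 𝓘(ℝ, E) F (S'.act q g) ξ : E) =
          mfderiv 𝓘(ℝ, E) 𝓘(ℝ, E) (fun r => S.act r g) (Φ q)
            (mfderiv 𝓘(ℝ, E') 𝓘(ℝ, E) Φ q ζ) := by
    intro q hq g ξ
    have hq' : S'.act (S'.act q g) g⁻¹ = q := S'.act_act_inv q g
    have d1 := (S.act_smooth_left g).mdifferentiable (by simp)
    have d2 := hΦ.mdifferentiableAt (hVs hq)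
    have d3 := ((S'.act_smooth_left g⁻¹).mdifferentiable (by simp)) (S'.act q g)
    have h1 := mfderiv_comp_of_eq d2 d3 hq'
    have d4 : MDifferentiableAt 𝓘(ℝ, E') 𝓘(ℝ, E) (Φ ∘ fun r => S'.act r g⁻¹) (S'.act q g) :=
      d2.comp_of_eq _ d3 hq'
    have h2 := mfderiv_comp_of_eq (I' := 𝓘(ℝ, E)) (d1 (Φ q)) d4 (by simp [hq'])
    have h3 := (hFev q hq g).mfderiv_eq (I := 𝓘(ℝ, E')) (I' := 𝓘(ℝ, E))
    refine ⟨mfderiv 𝓘(ℝ, E') 𝓘(ℝ, E') (fun r => S'.act r g⁻¹) (S'.act q g) ξ, ?_, ?_⟩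
    · have h4 := S'.mfderiv_act_inv g (S'.act q g) ξ
      rw [hq'] at h4
      exact h4
    · rw [h3]
      refine (DFunLike.congr_fun h2 ξ).trans ?_
      -- The base points agree only propositionally; generalizing over `x` permits the substitution.
      have h5 : ∀ x, x = q → ∀ (ν : E'), (mfderiv 𝓘(ℝ, E) 𝓘(ℝ, E) (fun r => S.act r g) (Φ x)
          (mfderiv 𝓘(ℝ, E') 𝓘(ℝ, E) Φ x ν) : E) =
          mfderiv 𝓘(ℝ, E) 𝓘(ℝ, E) (fun r => S.act r g) (Φ q)
            (mfderiv 𝓘(ℝ, E') 𝓘(ℝ, E) Φ q ν) := by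
        rintro x rfl ν
        rfl
      exact (congrArg (mfderiv 𝓘(ℝ, E) 𝓘(ℝ, E) (fun r => S.act r g)
        (Φ (S'.act (S'.act q g) g⁻¹))) (DFunLike.congr_fun h1 ξ)).trans (h5 _ hq' _)
  refine ⟨Ψ, ?_, fun r => ⟨?_, ?_⟩, hF⟩
  · refine
      { smooth := ?_
        smooth_symm := ?_
        taut_eq := ?_
        conn_eq := ?_
        source_saturated := ?_
        target_saturated := ?_
        equivariant := ?_ }
    · rintro _ ⟨z, hz, rfl⟩
      exact (hsm _ hz _).contMDiffWithinAt
    · rintro _ ⟨z, hz, rfl⟩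
      exact (hsm' _ hz _).contMDiffWithinAt
    · rintro _ ⟨⟨q, g⟩, hq, rfl⟩ ξ
      obtain ⟨ζ, hζ, hζ'⟩ := hder q hq g ξ
      have h1 := S'.taut_equivariant q g ζ
      have h2 := S.taut_equivariant (Φ q) g (mfderiv 𝓘(ℝ, E') 𝓘(ℝ, E) Φ q ζ)
      rw [hΦ.taut_eq q (hVs hq), ← h1] at h2
      have h3 : Ψ (S'.act q g) = S.act (Φ q) g := hF q hq g
      change S.taut (Ψ (S'.act q g)) _ = S'.taut (S'.act q g) ξ
      rw [h3]
      exact (congrArg (S.taut (S.act (Φ q) g)) hζ').trans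
        (h2.trans (congrArg (S'.taut (S'.act q g)) hζ))
    · rintro _ ⟨⟨q, g⟩, hq, rfl⟩ ξ
      obtain ⟨ζ, hζ, hζ'⟩ := hder q hq g ξ
      have h1 := S'.conn_equivariant q g ζ
      have h2 := S.conn_equivariant (Φ q) g (mfderiv 𝓘(ℝ, E') 𝓘(ℝ, E) Φ q ζ)
      rw [hΦ.conn_eq q (hVs hq), ← h1] at h2
      have h3 : Ψ (S'.act q g) = S.act (Φ q) g := hF q hq g
      change S.conn (Ψ (S'.act q g)) _ = S'.conn (S'.act q g) ξ
      rw [h3]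
      exact (congrArg (S.conn (S.act (Φ q) g)) hζ').trans
        (h2.trans (congrArg (S'.conn (S'.act q g)) hζ))
    · rintro _ ⟨⟨q, k⟩, hq, rfl⟩ g
      exact ⟨(q, k * g), hq, S'.act_mul q k g⟩
    · rintro _ ⟨⟨q, k⟩, hq, rfl⟩ g
      exact ⟨(q, k * g), hq, S.act_mul (Φ q) k g⟩
    · rintro _ ⟨⟨q, k⟩, hq, rfl⟩ g
      change F (S'.act (S'.act q k) g) = S.act (F (S'.act q k)) g
      rw [← S'.act_mul, hF q hq, hF q hq, S.act_mul]
  · rintro ⟨⟨q, g⟩, hq, rfl⟩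
    exact ⟨q, hq, g, rfl⟩
  · rintro ⟨q, hq, g, rfl⟩
    exact ⟨(q, g), hq, rfl⟩

/-- A local equivalence extends, near a point which has the same stabilizer as its image, to an
equivariant local equivalence. -/
theorem IsLocalEquivalence.exists_isEquivariantLocalEquivalence
    [FiniteDimensional ℝ E] [FiniteDimensional ℝ EG] [IsManifold 𝓘(ℝ, E) ∞ P]
    [FiniteDimensional ℝ E'] [IsManifold 𝓘(ℝ, E') ∞ P'] [LieGroup 𝓘(ℝ, EG) ∞ G]
    {Φ : OpenPartialHomeomorph P' P}
    (hΦ : IsLocalEquivalence S' S Φ) {p : P'} (hp : p ∈ Φ.source)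
    (hstab : ∀ g : G, S'.act p g = p ↔ S.act (Φ p) g = Φ p) :
    ∃ Ψ : OpenPartialHomeomorph P' P, IsEquivariantLocalEquivalence S' S Ψ ∧ p ∈ Ψ.source ∧
      Ψ p = Φ p ∧ ∀ r ∈ Ψ.source, ∃ q ∈ Φ.source, ∃ g : G,
        r = S'.act q g ∧ Ψ r = S.act (Φ q) g := by
  obtain ⟨W, hW, hpW, hWe⟩ := hΦ.exists_nhds_equivariant hp fun g => (hstab g).1
  obtain ⟨W', hW', hpW', hWe'⟩ := hΦ.symm.exists_nhds_equivariant (Φ.map_source hp) fun g hg => by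
    rw [Φ.left_inv hp]; exact (hstab g).2 hg
  -- `W` gives equivariance of `Φ`, and the preimage of `W'` that of its inverse; the two halves of
  -- the orbit condition use one each.
  let V : Set P' := (Φ.source ∩ Φ ⁻¹' W') ∩ W
  have hV : IsOpen V := (Φ.isOpen_inter_preimage hW').inter hW
  have hpV : p ∈ V := ⟨⟨hp, hpW'⟩, hpW⟩
  obtain ⟨Ψ, hΨ, hΨs, hΨe⟩ := hΦ.exists_equivariant_extension hV (fun q hq => hq.1.1) (by
    intro q hq q' hq' g
    constructor
    · rintro rfl
      exact (hWe q hq.2 g hq'.2).symm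
    · intro h
      have h1 := hWe' (Φ q) hq.1.2 g (by rw [h]; exact hq'.1.2)
      rwa [h, Φ.left_inv hq'.1.1, Φ.left_inv hq.1.1, eq_comm] at h1)
  refine ⟨Ψ, hΨ, (hΨs p).2 ⟨p, hpV, 1, S'.act_one p⟩, ?_, fun r hr => ?_⟩
  · have := hΨe p hpV 1
    rwa [S'.act_one, S.act_one] at this
  · obtain ⟨q, hq, g, rfl⟩ := (hΨs r).1 hr
    exact ⟨q, hq.1.1, g, rfl, hΨe q hq g⟩

end Structure

end GStr

end

theorem mainTheorem10 {n : ℕ} (G : Subgroup (GStr.GLin n)) (hG : IsClosed (G : Set (GStr.GLin n)))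
    {EG : Type*} [NormedAddCommGroup EG] [NormedSpace ℝ EG] [FiniteDimensional ℝ EG]
    [ChartedSpace EG G] [LieGroup 𝓘(ℝ, EG) ∞ G]
    (hι : ContMDiff 𝓘(ℝ, EG) 𝓘(ℝ, GStr.Vec n →L[ℝ] GStr.Vec n) ∞
      (fun g : G => ((g : GStr.GLin n) : GStr.Vec n →L[ℝ] GStr.Vec n)))
    {E : Type*} [NormedAddCommGroup E] [NormedSpace ℝ E] [FiniteDimensional ℝ E]
    {P : Type*} [TopologicalSpace P] [T2Space P] [SecondCountableTopology P]
    [ChartedSpace E P] [IsManifold 𝓘(ℝ, E) ∞ P]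
    (S : GStr.GStructureConn G EG E P) (hS : S.FullyRegular)
    {E' : Type*} [NormedAddCommGroup E'] [NormedSpace ℝ E'] [FiniteDimensional ℝ E']
    {P' : Type*} [TopologicalSpace P'] [T2Space P'] [SecondCountableTopology P']
    [ChartedSpace E' P'] [IsManifold 𝓘(ℝ, E') ∞ P']
    (S' : GStr.GStructureConn G EG E' P') (R : S.Realization S')
    (p₀' : P') (p₀ : P) (hp : R.h' p₀' = S.classMap p₀) :
    (∃ Φ : OpenPartialHomeomorph P' P, GStr.IsLocalEquivalence S' S Φ ∧
      p₀' ∈ Φ.source ∧ Φ p₀' = p₀ ∧ ∀ p ∈ Φ.source, S.classMap (Φ p) = R.h' p) ∧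
    ((∀ g : G, S'.act p₀' g = p₀' ↔ S.act p₀ g = p₀) →
      ∃ Φ : OpenPartialHomeomorph P' P, GStr.IsEquivariantLocalEquivalence S' S Φ ∧
        p₀' ∈ Φ.source ∧ Φ p₀' = p₀ ∧ ∀ p ∈ Φ.source, S.classMap (Φ p) = R.h' p) := by
  obtain ⟨Φ, hΦ, hs, hΦp, hh⟩ := hS.exists_isLocalEquivalence R hp
  refine ⟨⟨Φ, hΦ, hs, hΦp, hh⟩, fun hstab => ?_⟩
  obtain ⟨Ψ, hΨ, hΨs, hΨp, hΨr⟩ := hΦ.exists_isEquivariantLocalEquivalence hs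
    (by rw [hΦp]; exact hstab)
  refine ⟨Ψ, hΨ, hΨs, hΨp.trans hΦp, fun r hr => ?_⟩
  -- At `r = q g` both maps to `X` are translates by `g` of their values at `q`, where they are
  -- known to agree.
  obtain ⟨q, hq, g, rfl, hg⟩ := hΨr r hr
  rw [hg, R.h'_equivariant, ← hh q hq]
  rfl
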